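/- **Setting.** Let $G=(V,E)$ be a finite hypergraph ($E$ a finite set of subsets of $V$), $n=|V|$, $k\ge 2$, and let $f:V\to[k]$ be an unknown surjective labelling. The *cut set* $C$ consists of the hyperedges that contain two nodes of different labels, and $\partial C=\bigcup_{e\in C}e$. Let $V_1,\dots,V_T$ be the connected components of $G-C$, and $\Omega_r(e)=e\cap V_r$. For components $V_r,V_s$ of different labels, the *cut component* $C_{rs}$ is the set of hyperedges that meet both $V_r$ and $V_s$; $m$ is the number of non-empty cut components (unordered pairs $\{r,s\}$). For $\beta>0$, $G$ is *$\beta$-balanced* if $|V_i|\ge \beta n$ for all $i$. Let $d$ be the path distance in $G-C$ (number of hyperedges). For cut hyperedges $e,e'$ let $$\Delta(e,e')=\sup_{r,s:\;e,e'\in C_{rs}}\ \sup_{u\in\Omega_r(e),\,v\in\Omega_s(e)}\ \inf_{u'\in\Omega_r(e'),\,v'\in\Omega_s(e')}\bigl(d(u,u')+d(v,v')+1\bigr),$$ and $\Delta(e,e')=\infty$ if no cut component contains both. $C$ is *$\kappa$-clustered* if every non-empty cut component is the vertex set of a strongly connected component of the digraph $H_\kappa$ on $C$ that has an arc $e\to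 e'$ iff $\Delta(e,e')\le\kappa$. Put $$\mathcal Q^*(\delta)=\frac{\log\frac1{\beta\delta}}{\log\frac1{1-\beta}}+m\bigl(\lceil\log_2 n\rceil-\lceil\log_2\kappa\rceil\bigr)+\min(|\partial C|,|C|)\bigl(\lceil\log_2\kappa\rceil+1\bigr).$$ The noisy pairwise oracle $\mathcal O_p$, $0\le p<1/2$, answers whether $f(u)=f(v)$; each unordered pair independently gets a wrong answer with probability $p$, and repeated queries of the same pair get the same answer. $D(x\|y)$ is the Kullback–Leibler divergence of Bernoulli laws (natural logarithm; $1/\infty=0$). **Algorithm.** *Phase 1.* Draw $M\le n$ nodes uniformly at random without replacement and cluster them by the algorithm of Mazumdar and Saha for known $k$. With $N=64k^2\log M/(1-2p)^4$, $T(a)=pa+\frac{6}{1-2p}\sqrt{N\log M}$, $\theta(a)=2p(1-p)a+2\sqrt{N\log M}$, it repeats the following. Fill up a working set $V'$ with arbitrary unassigned sampled nodes to $\lceil N\rceil$ nodes (or with all of them if there are too few) and query all its pairs; let $N^+(u)$ be the set of nodes of $V'\setminus\{u\}$ with a "yes" answer about $u$. Among the nodes with $|N^+(u)|\ge T(|V'|)$,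 join $u,v$ if $|N^+(u)\,\triangle\, N^+(v)|\le\theta(|V'|)$, and form the connected components. The components of size at least $64k\log M/(1-2p)^4$ become active; stop if there are none, and otherwise remove them from $V'$. Then add each unassigned sampled node outside $V'$ to an active component if a strict majority of its answers with $\lceil 16\log M/(1-2p)^2\rceil$ arbitrary members of that component is "yes". Output the enlarged active components. *Phase 2.* Let $S_1,S_2,\dots$ be the clusters output by Phase 1. Run $HS^2$, starting with no labelled nodes, for at most $\lfloor\mathcal Q^*(\delta/4)\rfloor$ node queries: remove all hyperedges seen to contain two differently labelled nodes; if differently labelled nodes are still joined by a path, query the midpoint of a shortest such path (ties broken arbitrarily); otherwise query a uniformly random unlabelled node; stop if there is none. The label of a queried node $v$ is the cluster $S_j$ containing $v$ if there is one, and otherwise a cluster maximising $M_j/|S_j|$, where $M_j$ is the number of $u\in S_j$ with $\mathcal O_p(v,u)=$ "yes". The output is the set of removed hyperedges, that is, of the hyperedges seen to contain two differently labelled nodes. **Theorem.** There is an absolute constant $c>0$ such that the following holds. Let $G$ be $\beta$-balanced with $\beta>0$, let $C$ be $\kappa$-clustered with $1\le\kappa\le n$, and let $0\le p<1/2$, $\delta>0$,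 $M\le n$. If $$\frac{M}{\log M}\ge\frac{128k}{\beta(2p-1)^4},\qquad M\ge\frac{12}{\beta}\log\frac{4k}{\delta},\qquad M\ge\frac8\delta,\qquad M\ge\frac{2}{\beta D(0.5\|p)}\log\frac{8(k-1)\mathcal Q^*(\delta/4)}{\delta},$$ then, with probability at least $1-\delta$, the output of the two-phase algorithm is exactly $C$ and the number of pairs queried is at most $c\,\frac{Mk^2\log M}{(1-2p)^4}+M\,\mathcal Q^*(\delta/4)$. -/

import Mathlib

open scoped ENNReal

noncomputable section

open scoped Classical in
/-- The clique graph of a family `E` of hyperedges: `u ≠ v` are adjacent iff some hyperedge of `E`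
contains both.  Walks of length `l` in it are the hyperpaths `v₀, e₁, v₁, …, e_l, v_l` with
`{vᵢ₋₁, vᵢ} ⊆ eᵢ ∈ E`, so `edist` is the hyperpath distance. -/
def hyperGraph {V : Type*} (E : Finset (Finset V)) : SimpleGraph V :=
  SimpleGraph.fromRel fun u v => ∃ e ∈ E, u ∈ e ∧ v ∈ e

section Parameters

variable {V : Type*} [Fintype V] [DecidableEq V] {k : ℕ}

open scoped Classical in
/-- The cut set `C`: the hyperedges that contain two nodes of different classes. -/
def cutSet (E : Finset (Finset V)) (f : V → Fin k) : Finset (Finset V) :=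
  E.filter fun e => ∃ u ∈ e, ∃ v ∈ e, f u ≠ f v

/-- The boundary `∂C`: all nodes that lie in a cut hyperedge. -/
def boundary (E : Finset (Finset V)) (f : V → Fin k) : Finset V :=
  (cutSet E f).sup id

/-- The hypergraph `G - C`, through its clique graph. -/
abbrev cutFree (E : Finset (Finset V)) (f : V → Fin k) : SimpleGraph V :=
  hyperGraph (E \ cutSet E f)

/-- The index type of the connected components `V_1, …, V_T` of `G - C`. -/
abbrev Piece (E : Finset (Finset V)) (f : V → Fin k) : Type _ :=
  (cutFree E f).ConnectedComponent

/-- `G` is `β`-balanced: every component `V_i` of `G - C` has at least `β n` nodes. -/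
def IsBalanced (E : Finset (Finset V)) (f : V → Fin k) (β : ℝ) : Prop :=
  ∀ r : Piece E f, β * Fintype.card V ≤ (r.supp.ncard : ℝ)

/-- `Ω_r(e)`: the nodes of `e` in the component `r`. -/
def omegaPart (E : Finset (Finset V)) (f : V → Fin k) (r : Piece E f) (e : Finset V) : Set V :=
  {u | u ∈ e ∧ u ∈ r.supp}

/-- The cut component `C_{rs}`, for components `r`, `s` of different labels: the hyperedges that
meet both `V_r` and `V_s` (all nodes of a component have the same label; if `r` and `s` carry the
same label this set is empty). -/
def cutComponent (E : Finset (Finset V)) (f : V → Fin k) (r s : Piece E f) : Set (Finset V) :=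
  {e | e ∈ E ∧ ∃ u ∈ omegaPart E f r e, ∃ v ∈ omegaPart E f s e, f u ≠ f v}

/-- `m`: the number of non-empty cut components (`C_{rs}` and `C_{sr}` count once). -/
def numCutComponents (E : Finset (Finset V)) (f : V → Fin k) : ℕ :=
  Set.ncard {z : Sym2 (Piece E f) | ∃ r s, z = s(r, s) ∧ (cutComponent E f r s).Nonempty}

/-- For `e, e' ∈ C_{rs}`: the supremum over `u ∈ Ω_r(e)`, `v ∈ Ω_s(e)` of the infimum over
`u' ∈ Ω_r(e')`, `v' ∈ Ω_s(e')` of `d(u, u') + d(v, v') + 1`, with distances in `G - C`. -/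
def pairDist (E : Finset (Finset V)) (f : V → Fin k) (r s : Piece E f) (e e' : Finset V) : ℕ∞ :=
  ⨆ u ∈ omegaPart E f r e, ⨆ v ∈ omegaPart E f s e,
    ⨅ u' ∈ omegaPart E f r e', ⨅ v' ∈ omegaPart E f s e',
      (cutFree E f).edist u u' + (cutFree E f).edist v v' + 1

/-- There is an arc from `e` to `e'` in `H_κ`, i.e. `Δ(e, e') ≤ κ`: the hyperedges lie in a common
cut component, and the distance above is at most `κ` for all of their common cut components. -/
def ArcLe (E : Finset (Finset V)) (f : V → Fin k) (κ : ℕ) (e e' : Finset V) : Prop :=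
  (∃ r s, e ∈ cutComponent E f r s ∧ e' ∈ cutComponent E f r s) ∧
    ∀ r s, e ∈ cutComponent E f r s → e' ∈ cutComponent E f r s →
      pairDist E f r s e e' ≤ (κ : ℕ∞)

/-- `C` is `κ`-clustered: every non-empty cut component is (the vertex set of) a strongly connected
component of the digraph `H_κ`. -/
def IsClustered (E : Finset (Finset V)) (f : V → Fin k) (κ : ℕ) : Prop :=
  ∀ r s, ∀ e ∈ cutComponent E f r s, ∀ e' : Finset V,
    e' ∈ cutComponent E f r s ↔
      Relation.ReflTransGen (ArcLe E f κ) e e' ∧ Relation.ReflTransGen (ArcLe E f κ) e' e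

/-- The node budget
`Q*(δ) = log(1/(βδ)) / log(1/(1-β)) + m(⌈log₂ n⌉ - ⌈log₂ κ⌉) + min(|∂C|,|C|)(⌈log₂ κ⌉ + 1)`. -/
def nodeBudget (E : Finset (Finset V)) (f : V → Fin k) (β : ℝ) (κ : ℕ) (δ : ℝ) : ℝ :=
  Real.log (1 / (β * δ)) / Real.log (1 / (1 - β))
    + numCutComponents E f
        * ((⌈Real.logb 2 (Fintype.card V)⌉ : ℝ) - (⌈Real.logb 2 κ⌉ : ℝ))
    + min ((boundary E f).card : ℝ) ((cutSet E f).card : ℝ) * ((⌈Real.logb 2 κ⌉ : ℝ) + 1)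

end Parameters

/-- The Kullback-Leibler divergence `D(x‖y)` of the Bernoulli laws with parameters `x`, `y`
(natural logarithm).  The value `D(1/2‖0) = ∞` is not represented: the formula then gives a negative
number, and a bound `M ≥ c / D(1/2‖0)` with `c ≥ 0` is void, as it is when `c / ∞ = 0`. -/
def bernoulliKL (x y : ℝ) : ℝ :=
  x * Real.log (x / y) + (1 - x) * Real.log ((1 - x) / (1 - y))

section Oracle

variable {V : Type*} [Fintype V] [DecidableEq V] {k : ℕ}

theorem noise_sum_eq_one (I : Type*) [Fintype I] [DecidableEq I] (p : ℝ) (h0 : 0 ≤ p)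
    (h1 : p ≤ 1) :
    ∑ ξ : I → Bool, ∏ i, (if ξ i then ENNReal.ofReal p else ENNReal.ofReal (1 - p)) = 1 := by
  have h := Finset.prod_univ_sum (ι := I) (κ := fun _ => Bool) (fun _ => Finset.univ)
    (fun _ b => if b then ENNReal.ofReal p else ENNReal.ofReal (1 - p))
  rw [Fintype.piFinset_univ] at h
  rw [← h]
  apply Finset.prod_eq_one
  intro i _
  rw [Fintype.sum_bool]
  simp only [if_true, Bool.false_eq_true, if_false]
  rw [← ENNReal.ofReal_add h0 (by linarith)]
  simp

/-- The law of the noise: each unordered pair of nodes is independently flagged `true` (the answer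
about this pair is wrong) with probability `p`. -/
def noiseLaw (V : Type*) [Fintype V] [DecidableEq V] (p : ℝ) (h0 : 0 ≤ p) (h1 : p ≤ 1) :
    PMF (Sym2 V → Bool) :=
  PMF.ofFintype
    (fun ξ => ∏ z, (if ξ z then ENNReal.ofReal p else ENNReal.ofReal (1 - p)))
    (noise_sum_eq_one (Sym2 V) p h0 h1)

/-- The answer of the noisy pairwise oracle to "are `u` and `v` in the same class?".  It is
persistent: asking about the same pair again gives the same answer. -/
def oracleAnswer (f : V → Fin k) (ξ : Sym2 V → Bool) (u v : V) : Bool :=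
  xor (decide (f u = f v)) (ξ s(u, v))

end Oracle

/-- An arbitrary way of picking `min j |A|` nodes out of a set `A`. -/
structure PickRule (V : Type*) where
  pick : Finset V → ℕ → Finset V
  pick_subset : ∀ A j, pick A j ⊆ A
  card_pick : ∀ A j, (pick A j).card = min j A.card

/-! ### Phase 1: clustering with noisy pairwise queries (known number `k` of clusters)

Below `n` is the number of points to be clustered. -/

/-- The target size `64 k² log n / (1-2p)⁴` of the working set. -/
def msScale (k n : ℕ) (p : ℝ) : ℝ := 64 * (k : ℝ) ^ 2 * Real.log n / (1 - 2 * p) ^ 4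

/-- The degree threshold `T(a)`. -/
def msDegreeThreshold (k n : ℕ) (p : ℝ) (a : ℕ) : ℝ :=
  p * a + 6 / (1 - 2 * p) * √(msScale k n p * Real.log n)

/-- The threshold `θ(a)` for symmetric differences of neighbourhoods. -/
def msDiffThreshold (k n : ℕ) (p : ℝ) (a : ℕ) : ℝ :=
  2 * p * (1 - p) * a + 2 * √(msScale k n p * Real.log n)

/-- The minimal size `64 k log n / (1-2p)⁴` of an active cluster. -/
def msMinSize (k n : ℕ) (p : ℝ) : ℝ := 64 * (k : ℝ) * Real.log n / (1 - 2 * p) ^ 4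

/-- The number of members of a cluster with which a further point is compared. -/
def msVotes (n : ℕ) (p : ℝ) : ℕ := ⌈16 * Real.log n / (1 - 2 * p) ^ 2⌉₊

/-- State of the clustering algorithm: the unassigned points outside the working set, the working
set `V'`, the clusters output so far, and the pairs queried so far. -/
structure MSState (V : Type*) where
  rest : Finset V
  cur : Finset V
  out : List (Finset V)
  asked : Finset (Sym2 V)

section Clustering

variable {V : Type*} [Fintype V] [DecidableEq V]

/-- `N⁺(u)`: the points of the working set `A` for which the query with `u` was answered "yes". -/
def posNbrs (ans : V → V → Bool) (A : Finset V) (u : V) : Finset V :=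
  A.filter fun w => w ≠ u ∧ ans u w = true

open scoped Classical in
/-- The points of the working set whose positive degree reaches the threshold. -/
def msGood (k n : ℕ) (p : ℝ) (ans : V → V → Bool) (A : Finset V) : Finset V :=
  A.filter fun u => msDegreeThreshold k n p A.card ≤ ((posNbrs ans A u).card : ℝ)

/-- Two such points are put into the same cluster if the symmetric difference of their positive
neighbourhoods is small. -/
def msSimilar (k n : ℕ) (p : ℝ) (ans : V → V → Bool) (A : Finset V) : SimpleGraph V :=
  SimpleGraph.fromRel fun u v =>
    u ∈ msGood k n p ans A ∧ v ∈ msGood k n p ans A ∧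
      ((symmDiff (posNbrs ans A u) (posNbrs ans A v)).card : ℝ) ≤ msDiffThreshold k n p A.card

open scoped Classical in
/-- The clusters formed inside the working set that are large enough to become active. -/
def msActive (k n : ℕ) (p : ℝ) (ans : V → V → Bool) (A : Finset V) : List (Finset V) :=
  (((msGood k n p ans A).image fun u =>
      (msGood k n p ans A).filter fun v => (msSimilar k n p ans A).Reachable u v).filter
    fun S => msMinSize k n p ≤ (S.card : ℝ)).toList

/-- `v` is accepted by the active cluster `S`: a strict majority of the answers about `v` and the
picked members of `S` is "yes". -/
def msAccepts (n : ℕ) (p : ℝ) (R : PickRule V) (ans : V → V → Bool) (v : V) (S : Finset V) : Bool :=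
  decide ((R.pick S (msVotes n p)).card
    < 2 * ((R.pick S (msVotes n p)).filter fun u => ans v u = true).card)

/-- The iteration.  Fill up the working set, query all its pairs and form the active clusters; stop
if there are none.  Otherwise compare every unassigned point outside the working set with every
active cluster, output the active clusters so enlarged, and continue with the points that are
still unassigned.  The first argument bounds the number of rounds; every round except the last one
assigns at least one point. -/
def msRun (k n : ℕ) (p : ℝ) (R : PickRule V) (ans : V → V → Bool) : ℕ → MSState V → MSState V
  | 0, s => s
  | fuel + 1, s =>
    let new := R.pick s.rest (⌈msScale k n p⌉₊ - s.cur.card)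
    let cur := s.cur ∪ new
    let rest := s.rest \ new
    let asked := s.asked ∪ cur.offDiag.image fun x => s(x.1, x.2)
    let act := msActive k n p ans cur
    if act = [] then { s with asked := asked }
    else
      msRun k n p R ans fuel
        { rest := rest.filter fun v => ∀ S ∈ act, msAccepts n p R ans v S = false
          cur := cur.filter fun v => ∀ S ∈ act, v ∉ S
          out := s.out ++ act.map fun S =>
            S ∪ rest.filter fun v => act.find? (msAccepts n p R ans v) = some S
          asked := asked ∪ act.toFinset.biUnion fun S =>
            (rest ×ˢ R.pick S (msVotes n p)).image fun x => s(x.1, x.2) }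

/-- Clustering of the set `W`. -/
def msCluster (k : ℕ) (p : ℝ) (R : PickRule V) (ans : V → V → Bool) (W : Finset V) : MSState V :=
  msRun k W.card p R ans (W.card + 1) { rest := W, cur := ∅, out := [], asked := ∅ }

end Clustering

/-! ### The search algorithm `HS²` -/

section Search

variable {V Λ : Type*}

/-- Two nodes that have been given different labels. -/
def Conflict (L : V → Option Λ) (u v : V) : Prop :=
  ∃ a b, L u = some a ∧ L v = some b ∧ a ≠ b

open scoped Classical in
/-- The hyperedges recognised as cut hyperedges from the labels collected so far. -/
def discovered (E : Finset (Finset V)) (L : V → Option Λ) : Finset (Finset V) :=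
  E.filter fun e => ∃ u ∈ e, ∃ v ∈ e, Conflict L u v

/-- Some two nodes with different labels are joined by a path of hyperedges of `E`. -/
def HasConflictPath (E : Finset (Finset V)) (L : V → Option Λ) : Prop :=
  ∃ u v, Conflict L u v ∧ (hyperGraph E).Reachable u v

/-- `x` is the midpoint of a shortest among all paths that join nodes with different labels. -/
def IsShortestMidpoint (E : Finset (Finset V)) (L : V → Option Λ) (x : V) : Prop :=
  ∃ u v, Conflict L u v ∧ ∃ P : (hyperGraph E).Walk u v,
    (∀ u' v', Conflict L u' v' → ∀ P' : (hyperGraph E).Walk u' v', P.length ≤ P'.length) ∧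
      x = P.getVert (P.length / 2)

/-- The midpoint-of-shortest-path subroutine, with an arbitrary breaking of ties. -/
structure MidpointRule (V Λ : Type*) where
  mid : Finset (Finset V) → (V → Option Λ) → V
  mid_spec : ∀ E L, HasConflictPath E L → IsShortestMidpoint E L (mid E L)

variable [Fintype V] [DecidableEq V]

open scoped Classical in
/-- The unlabelled nodes. -/
def unlabelled (L : V → Option Λ) : Finset V := Finset.univ.filter fun v => L v = none

open scoped Classical in
/-- `HS²` with at most `b` further node queries, started from the partial labelling `L`; querying
the node `x` returns the label `g x`.  The cut hyperedges discovered so far are removed; if nodes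
with different labels are still joined by a path, the midpoint of a shortest such path is queried,
and otherwise a uniformly random unlabelled node.  The result is the final partial labelling. -/
def hs2 (E : Finset (Finset V)) (g : V → Λ) (μ : MidpointRule V Λ) :
    ℕ → (V → Option Λ) → PMF (V → Option Λ)
  | 0, L => PMF.pure L
  | b + 1, L =>
    let E' := E \ discovered E L
    if HasConflictPath E' L then
      hs2 E g μ b (Function.update L (μ.mid E' L) (some (g (μ.mid E' L))))
    else if h : (unlabelled L).Nonempty then
      (PMF.uniformOfFinset (unlabelled L) h).bind fun x =>
        hs2 E g μ b (Function.update L x (some (g x)))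
    else PMF.pure L

end Search

/-! ### The two-phase algorithm -/

section TwoPhase

variable {V : Type*} [Fintype V] [DecidableEq V] {k : ℕ}

/-- The label of `v` in Phase 2, namely one of the clusters `S_1, S_2, …` found in Phase 1: the
cluster that contains `v`, if there is one, and otherwise a cluster `S_j` that maximises `M_j/|S_j|`,
where `M_j` is the number of `u ∈ S_j` for which the query about `v` and `u` is answered "yes". -/
def voteLabel (ans : V → V → Bool) (clusters : List (Finset V)) (v : V) : Option (Finset V) :=
  match clusters.find? fun S => decide (v ∈ S) with
  | some S => some S
  | none => clusters.argmax fun S => ((S.filter fun u => ans v u = true).card : ℚ) / (S.card : ℚ)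

open scoped Classical in
/-- The pairs queried to find the labels of the nodes labelled in `L`. -/
def voteQueries {Λ : Type*} (clusters : List (Finset V)) (L : V → Option Λ) : Finset (Sym2 V) :=
  let U := clusters.toFinset.sup id
  ((Finset.univ.filter fun v => L v ≠ none ∧ v ∉ U) ×ˢ U).image fun x => s(x.1, x.2)

/-- The joint law of the output of the two-phase algorithm (the set of hyperedges returned as the
cut set) and of the set of pairs about which the oracle was queried.  A uniformly random set `W` of
`M` nodes is clustered, and then `HS²` is run from scratch for at most `b` node queries. -/
def noisyHS2 (E : Finset (Finset V)) (f : V → Fin k) (p : ℝ) (h0 : 0 ≤ p) (h1 : p ≤ 1)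
    (M : ℕ) (hM : M ≤ Fintype.card V) (R : PickRule V) (μ : MidpointRule V (Option (Finset V)))
    (b : ℕ) : PMF (Finset (Finset V) × Finset (Sym2 V)) :=
  (PMF.uniformOfFinset (Finset.powersetCard M (Finset.univ : Finset V))
      (Finset.powersetCard_nonempty.2 hM)).bind fun W =>
    (noiseLaw V p h0 h1).bind fun ξ =>
      let ans := oracleAnswer f ξ
      let s := msCluster k p R ans W
      (hs2 E (voteLabel ans s.out) μ b fun _ => none).map fun L =>
        (discovered E L, s.asked ∪ voteQueries s.out L)

end TwoPhase

end

/-! The search is paid for by a potential. Querying the midpoint of a shortest path between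
conflicting labels either discovers a cut hyperedge or leaves a conflict at half the distance,
rounded up. The first hyperedge of an untouched cut component may cost `⌈log₂ n⌉` such queries. Once
a component is known in part, κ-clustering gives an arc of `H_κ` that leaves the discovered set,
hence a conflict path of length at most `κ` and a cost of `⌈log₂ κ⌉`. A query that discovers
something labels a new boundary node and uses up a cut hyperedge, so there are at most `min(|∂C|,
|C|)` of them. Midpoint queries lower the potential (`potential_midpoint_lt`) and random ones do not
raise it (`potential_update_le`).

A random query misses a given unlabelled component with probability at most `1 - β`, and once every
component has a label and no conflict path is left, the cut set is known (`discovered_eq_cutSet`).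
`hs2_fail_le` combines both facts in one induction, and `hs2_budget` inserts the budget.

In Phase 1, Hoeffding's inequality separates the classes by degrees and by symmetric differences of
neighbourhoods (`not_roundGood_le`). The working sets depend on earlier answers, but after a good
round the next state no longer involves the noise. The good trajectory is therefore fixed in
advance, and a plain union bound suffices (`not_isFinal_le`). That every class is well represented
in the sample is `sample_small_le`.

In Phase 2 the queried nodes depend on noisy labels. The run is compared with the run on correct
labels (`hs2_le_of_agree`), which is independent of the noise once the sample is given. Exchanging
the order of summation (`PMF.tsum_mul_toOuterMeasure_comm`) leaves a union bound over at most `Q*`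
nodes with the Chernoff bound of `voteFails_le`. No independence between the phases is needed. -/

noncomputable section

set_option linter.unusedSectionVars false

/-! ### Hyperpaths and conflicts -/

section Paths

variable {V : Type*}

theorem hyperGraph_adj {E : Finset (Finset V)} {u v : V} :
    (hyperGraph E).Adj u v ↔ u ≠ v ∧ ∃ e ∈ E, u ∈ e ∧ v ∈ e := by
  classical
  rw [hyperGraph, SimpleGraph.fromRel_adj]
  constructor
  · rintro ⟨h, ⟨e, he, hu, hv⟩ | ⟨e, he, hv, hu⟩⟩
    · exact ⟨h, e, he, hu, hv⟩
    · exact ⟨h, e, he, hu, hv⟩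
  · rintro ⟨h, e, he, hu, hv⟩
    exact ⟨h, Or.inl ⟨e, he, hu, hv⟩⟩

theorem hyperGraph_mono {E E' : Finset (Finset V)} (h : E ⊆ E') : hyperGraph E ≤ hyperGraph E' := by
  intro u v
  rw [hyperGraph_adj, hyperGraph_adj]
  rintro ⟨hn, e, he, hu, hv⟩
  exact ⟨hn, e, h he, hu, hv⟩

theorem exists_walk_le_one {E : Finset (Finset V)} {e : Finset V} (he : e ∈ E) {u v : V}
    (hu : u ∈ e) (hv : v ∈ e) : ∃ P : (hyperGraph E).Walk u v, P.length ≤ 1 := by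
  by_cases h : u = v
  · subst h
    exact ⟨SimpleGraph.Walk.nil, by simp⟩
  · have hadj : (hyperGraph E).Adj u v := hyperGraph_adj.2 ⟨h, e, he, hu, hv⟩
    exact ⟨SimpleGraph.Walk.cons hadj .nil, by simp⟩

variable {Λ : Type*}

theorem Conflict.ne {L : V → Option Λ} {u v : V} (h : Conflict L u v) : u ≠ v := by
  obtain ⟨a, b, ha, hb, hab⟩ := h
  rintro rfl
  exact hab (Option.some.inj (ha.symm.trans hb))

/-- The length of a shortest path between differently labelled nodes. -/
def conflictDist (E : Finset (Finset V)) (L : V → Option Λ) : ℕ :=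
  sInf {l | ∃ u v, Conflict L u v ∧ ∃ P : (hyperGraph E).Walk u v, P.length = l}

theorem conflictDist_le {E : Finset (Finset V)} {L : V → Option Λ} {u v : V}
    (h : Conflict L u v) (P : (hyperGraph E).Walk u v) : conflictDist E L ≤ P.length :=
  Nat.sInf_le ⟨u, v, h, P, rfl⟩

theorem exists_conflictDist {E : Finset (Finset V)} {L : V → Option Λ} (h : HasConflictPath E L) :
    ∃ u v, Conflict L u v ∧ ∃ P : (hyperGraph E).Walk u v, P.length = conflictDist E L := by
  obtain ⟨u, v, huv, ⟨P⟩⟩ := h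
  exact Nat.sInf_mem (s := {l | ∃ u v, Conflict L u v ∧ ∃ P : (hyperGraph E).Walk u v,
    P.length = l}) ⟨P.length, u, v, huv, P, rfl⟩

theorem mem_discovered {E : Finset (Finset V)} {L : V → Option Λ} {e : Finset V} :
    e ∈ discovered E L ↔ e ∈ E ∧ ∃ u ∈ e, ∃ v ∈ e, Conflict L u v := by
  classical
  simp [discovered]

variable [DecidableEq V]

/-- A query at an unlabelled node keeps conflicts. -/
theorem Conflict.update {L : V → Option Λ} {u v x : V} (a : Λ) (h : Conflict L u v)
    (hx : L x = none) : Conflict (Function.update L x (some a)) u v := by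
  obtain ⟨b, c, hb, hc, hbc⟩ := h
  refine ⟨b, c, ?_, ?_, hbc⟩
  · rw [Function.update_of_ne, hb]
    rintro rfl
    simp [hx] at hb
  · rw [Function.update_of_ne, hc]
    rintro rfl
    simp [hx] at hc

theorem discovered_update_subset {E : Finset (Finset V)} {L : V → Option Λ} {x : V} (a : Λ)
    (hx : L x = none) : discovered E L ⊆ discovered E (Function.update L x (some a)) := by
  intro e he
  rw [mem_discovered] at he ⊢
  obtain ⟨h, u, hu, v, hv, huv⟩ := he
  exact ⟨h, u, hu, v, hv, huv.update a hx⟩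

/-- A single hyperedge joining two conflicting nodes is itself discovered, hence removed. -/
theorem two_le_length {E : Finset (Finset V)} {L : V → Option Λ} {u v : V} (h : Conflict L u v)
    (P : (hyperGraph (E \ discovered E L)).Walk u v) : 2 ≤ P.length := by
  by_contra hlt
  have h1 : P.length = 0 ∨ P.length = 1 := by omega
  rcases h1 with h1 | h1
  · exact h.ne (SimpleGraph.Walk.eq_of_length_eq_zero h1)
  · have hadj := SimpleGraph.Walk.adj_of_length_eq_one h1
    obtain ⟨-, e, he, hu, hv⟩ := hyperGraph_adj.1 hadj
    rw [Finset.mem_sdiff] at he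
    exact he.2 (mem_discovered.2 ⟨he.1, u, hu, v, hv, h⟩)

theorem two_le_conflictDist {E : Finset (Finset V)} {L : V → Option Λ}
    (h : HasConflictPath (E \ discovered E L) L) : 2 ≤ conflictDist (E \ discovered E L) L := by
  obtain ⟨u, v, huv, P, hP⟩ := exists_conflictDist h
  rw [← hP]
  exact two_le_length huv P

/-- A labelled midpoint would conflict with one of the ends, and the half path to that end would be
a shorter conflict path. Length at least two makes both halves strictly shorter. -/
theorem midpoint_unlabelled {E : Finset (Finset V)} {L : V → Option Λ} {x : V}
    (h : IsShortestMidpoint (E \ discovered E L) L x) : L x = none := by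
  obtain ⟨u, v, huv, P, hmin, rfl⟩ := h
  have h2 := two_le_length huv P
  cases hx : L (P.getVert (P.length / 2)) with
  | none => rfl
  | some a =>
    exfalso
    obtain ⟨b, c, hb, hc, hbc⟩ := huv
    by_cases hab : a = b
    · have := hmin _ _ ⟨a, c, hx, hc, by rw [hab]; exact hbc⟩ (P.drop (P.length / 2))
      rw [SimpleGraph.Walk.drop_length] at this
      omega
    · have := hmin _ _ ⟨b, a, hb, hx, fun h => hab h.symm⟩ (P.take (P.length / 2))
      rw [SimpleGraph.Walk.take_length] at this
      omega

/-- Whatever label the midpoint receives, it conflicts with one end, and the longer half has length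
`(l + 1) / 2`. The hyperedge set is the one before the query, so the bound serves the queries that
discover nothing. -/
theorem midpoint_conflictDist {E : Finset (Finset V)} {L : V → Option Λ} {x : V} (a : Λ)
    (h : IsShortestMidpoint (E \ discovered E L) L x) :
    HasConflictPath (E \ discovered E L) (Function.update L x (some a)) ∧
      conflictDist (E \ discovered E L) (Function.update L x (some a)) ≤
        (conflictDist (E \ discovered E L) L + 1) / 2 := by
  have hx := midpoint_unlabelled h
  obtain ⟨u, v, huv, P, hmin, rfl⟩ := h
  have hd : P.length ≤ conflictDist (E \ discovered E L) L := by
    obtain ⟨u', v', h', P', hP'⟩ := exists_conflictDist ⟨u, v, huv, ⟨P⟩⟩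
    rw [← hP']
    exact hmin _ _ h' _
  have hxa : Function.update L (P.getVert (P.length / 2)) (some a) (P.getVert (P.length / 2))
      = some a := Function.update_self ..
  obtain ⟨b, c, hb, hc, hbc⟩ := huv.update a hx
  by_cases hab : a = b
  · have hcf : Conflict (Function.update L (P.getVert (P.length / 2)) (some a))
        (P.getVert (P.length / 2)) v := ⟨a, c, hxa, hc, by rw [hab]; exact hbc⟩
    refine ⟨⟨_, _, hcf, ⟨P.drop (P.length / 2)⟩⟩, ?_⟩
    refine (conflictDist_le hcf (P.drop (P.length / 2))).trans ?_
    rw [SimpleGraph.Walk.drop_length]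
    omega
  · have hcf : Conflict (Function.update L (P.getVert (P.length / 2)) (some a))
        u (P.getVert (P.length / 2)) := ⟨b, a, hb, hxa, fun h => hab h.symm⟩
    refine ⟨⟨_, _, hcf, ⟨P.take (P.length / 2)⟩⟩, ?_⟩
    refine (conflictDist_le hcf (P.take (P.length / 2))).trans ?_
    rw [SimpleGraph.Walk.take_length]
    omega

theorem conflictDist_lt_card [Fintype V] {E : Finset (Finset V)} {L : V → Option Λ}
    (h : HasConflictPath E L) : conflictDist E L < Fintype.card V := by
  obtain ⟨u, v, huv, ⟨P⟩⟩ := h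
  exact (conflictDist_le huv P.toPath.1).trans_lt P.toPath.2.length_lt

end Paths

/-! ### The potential of the search algorithm -/

section Potential

variable {V : Type*} {k : ℕ} {Λ : Type*}

/-- A partial labelling that records values of `g`. -/
def Consistent (g : V → Λ) (L : V → Option Λ) : Prop :=
  ∀ v a, L v = some a → a = g v

theorem Consistent.update [DecidableEq V] {g : V → Λ} {L : V → Option Λ} (h : Consistent g L)
    (x : V) : Consistent g (Function.update L x (some (g x))) := by
  intro v a hv
  by_cases hx : v = x
  · subst hx
    rw [Function.update_self] at hv
    exact (Option.some.inj hv).symm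
  · rw [Function.update_of_ne hx] at hv
    exact h v a hv

theorem Consistent.conflict {g : V → Λ} {f : V → Fin k} (hg : ∀ u v, g u = g v ↔ f u = f v)
    {L : V → Option Λ} (h : Consistent g L) {u v : V} (huv : Conflict L u v) : f u ≠ f v := by
  obtain ⟨a, b, ha, hb, hab⟩ := huv
  rw [h u a ha, h v b hb] at hab
  exact fun h' => hab ((hg u v).2 h')

theorem conflict_of_labelled {g : V → Λ} {f : V → Fin k} (hg : ∀ u v, g u = g v ↔ f u = f v)
    {L : V → Option Λ} (h : Consistent g L) {u v : V} (hu : L u ≠ none) (hv : L v ≠ none)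
    (huv : f u ≠ f v) : Conflict L u v := by
  obtain ⟨a, ha⟩ := Option.ne_none_iff_exists'.1 hu
  obtain ⟨b, hb⟩ := Option.ne_none_iff_exists'.1 hv
  refine ⟨a, b, ha, hb, ?_⟩
  rw [h u a ha, h v b hb]
  exact fun h' => huv ((hg u v).1 h')

variable [Fintype V] [DecidableEq V]

theorem mem_cutSet {E : Finset (Finset V)} {f : V → Fin k} {e : Finset V} :
    e ∈ cutSet E f ↔ e ∈ E ∧ ∃ u ∈ e, ∃ v ∈ e, f u ≠ f v := by
  simp [cutSet]

theorem mem_boundary {E : Finset (Finset V)} {f : V → Fin k} {v : V} :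
    v ∈ boundary E f ↔ ∃ e ∈ cutSet E f, v ∈ e := by
  simp [boundary, Finset.mem_sup]

theorem discovered_subset_cutSet {E : Finset (Finset V)} {g : V → Λ} {f : V → Fin k}
    (hg : ∀ u v, g u = g v ↔ f u = f v) {L : V → Option Λ} (h : Consistent g L) :
    discovered E L ⊆ cutSet E f := by
  intro e he
  obtain ⟨he, u, hu, v, hv, huv⟩ := mem_discovered.1 he
  exact mem_cutSet.2 ⟨he, u, hu, v, hv, h.conflict hg huv⟩

theorem cutFree_reachable_label {E : Finset (Finset V)} {f : V → Fin k} {u v : V}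
    (h : (cutFree E f).Reachable u v) : f u = f v := by
  obtain ⟨P⟩ := h
  induction P with
  | nil => rfl
  | cons hadj _ ih =>
    rw [← ih]
    obtain ⟨-, e, he, hu, hv⟩ := hyperGraph_adj.1 hadj
    rw [Finset.mem_sdiff] at he
    by_contra hne
    exact he.2 (mem_cutSet.2 ⟨he.1, _, hu, _, hv, hne⟩)

/-- Only cut hyperedges are ever removed, so paths inside a component of `G - C` survive the whole
search. -/
theorem cutFree_le {E : Finset (Finset V)} {g : V → Λ} {f : V → Fin k}
    (hg : ∀ u v, g u = g v ↔ f u = f v) {L : V → Option Λ} (h : Consistent g L) :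
    cutFree E f ≤ hyperGraph (E \ discovered E L) :=
  hyperGraph_mono (Finset.sdiff_subset_sdiff subset_rfl (discovered_subset_cutSet hg h))

theorem mem_cutComponent_of_ne {E : Finset (Finset V)} {f : V → Fin k} {e : Finset V}
    (he : e ∈ E) {u v : V} (hu : u ∈ e) (hv : v ∈ e) (huv : f u ≠ f v) :
    e ∈ cutComponent E f ((cutFree E f).connectedComponentMk u)
      ((cutFree E f).connectedComponentMk v) :=
  ⟨he, u, ⟨hu, rfl⟩, v, ⟨hv, rfl⟩, huv⟩

/-- Every cut component is discovered either completely or not at all. -/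
def IsPure (E : Finset (Finset V)) (f : V → Fin k) (D : Finset (Finset V)) : Prop :=
  ∀ r s, (∀ e ∈ cutComponent E f r s, e ∈ D) ∨ (∀ e ∈ cutComponent E f r s, e ∉ D)

/-- The non-empty cut components of which nothing has been discovered. -/
def freshPairs (E : Finset (Finset V)) (f : V → Fin k) (D : Finset (Finset V)) :
    Set (Sym2 (Piece E f)) :=
  {z | ∃ r s, z = s(r, s) ∧ (cutComponent E f r s).Nonempty ∧ ∀ e ∈ cutComponent E f r s, e ∉ D}

open scoped Classical in
/-- The smaller one of the numbers of unlabelled boundary nodes and of undiscovered cut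
hyperedges. -/
def numUndone (E : Finset (Finset V)) (f : V → Fin k) (L : V → Option Λ) : ℕ :=
  min ((boundary E f).filter fun v => L v = none).card (cutSet E f \ discovered E L).card

open scoped Classical in
/-- An upper bound for the number of midpoint queries still to be made. -/
def potential (E : Finset (Finset V)) (f : V → Fin k) (κ : ℕ) (L : V → Option Λ) : ℕ :=
  let w := (freshPairs E f (discovered E L)).ncard
  let u := numUndone E f L
  let l := Nat.clog 2 (Fintype.card V)
  let c := Nat.clog 2 κ
  let s := Nat.clog 2 (conflictDist (E \ discovered E L) L)
  -- Each discovery is charged `c`, and the first one in a fresh cut component `l - c` more. While a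
  -- conflict path exists, the pending discovery is charged its actual cost `s` instead. If all
  -- components are pure it opens a fresh one, and `s` stands for `(l - c) + c`; otherwise
  -- clustering gives `s ≤ c`, and `s` stands for `c` alone.
  if HasConflictPath (E \ discovered E L) L then
    if IsPure E f (discovered E L) then (w - 1) * (l - c) + (u - 1) * c + s
    else w * (l - c) + (u - 1) * c + s
  else w * (l - c) + u * c

theorem potential_of_isPure {E : Finset (Finset V)} {f : V → Fin k} {κ : ℕ} {L : V → Option Λ}
    (hc : HasConflictPath (E \ discovered E L) L) (hp : IsPure E f (discovered E L)) :
    potential E f κ L = ((freshPairs E f (discovered E L)).ncard - 1)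
      * (Nat.clog 2 (Fintype.card V) - Nat.clog 2 κ) + (numUndone E f L - 1) * Nat.clog 2 κ
      + Nat.clog 2 (conflictDist (E \ discovered E L) L) := by
  simp only [potential, if_pos hc, if_pos hp]

theorem potential_of_not_isPure {E : Finset (Finset V)} {f : V → Fin k} {κ : ℕ} {L : V → Option Λ}
    (hc : HasConflictPath (E \ discovered E L) L) (hp : ¬ IsPure E f (discovered E L)) :
    potential E f κ L = (freshPairs E f (discovered E L)).ncard
      * (Nat.clog 2 (Fintype.card V) - Nat.clog 2 κ) + (numUndone E f L - 1) * Nat.clog 2 κ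
      + Nat.clog 2 (conflictDist (E \ discovered E L) L) := by
  simp only [potential, if_pos hc, if_neg hp]

theorem potential_of_not_hasConflictPath {E : Finset (Finset V)} {f : V → Fin k} {κ : ℕ}
    {L : V → Option Λ} (hc : ¬ HasConflictPath (E \ discovered E L) L) :
    potential E f κ L = (freshPairs E f (discovered E L)).ncard
      * (Nat.clog 2 (Fintype.card V) - Nat.clog 2 κ) + numUndone E f L * Nat.clog 2 κ := by
  simp only [potential, if_neg hc]

instance finite_sym2_piece (E : Finset (Finset V)) (f : V → Fin k) : Finite (Sym2 (Piece E f)) := by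
  classical
  infer_instance

theorem freshPairs_anti {E : Finset (Finset V)} {f : V → Fin k} {D D' : Finset (Finset V)}
    (h : D ⊆ D') : freshPairs E f D' ⊆ freshPairs E f D := by
  rintro z ⟨r, s, rfl, hne, hD⟩
  exact ⟨r, s, rfl, hne, fun e he h' => hD e he (h h')⟩

/-- A conflict path contains an undiscovered cut hyperedge. -/
theorem exists_undiscovered {E : Finset (Finset V)} {g : V → Λ} {f : V → Fin k}
    (hg : ∀ u v, g u = g v ↔ f u = f v) {L : V → Option Λ} (h : Consistent g L)
    (hc : HasConflictPath (E \ discovered E L) L) : ∃ e ∈ cutSet E f, e ∉ discovered E L := by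
  by_contra! hall
  obtain ⟨u, v, huv, hr⟩ := hc
  have hle : hyperGraph (E \ discovered E L) ≤ cutFree E f :=
    hyperGraph_mono (Finset.sdiff_subset_sdiff subset_rfl hall)
  exact h.conflict hg huv (cutFree_reachable_label (hr.mono hle))

/-- Makes the truncated subtraction `u - 1` in the potential harmless: of two nodes of different
classes in an undiscovered cut hyperedge, one is still unlabelled. -/
theorem numUndone_pos {E : Finset (Finset V)} {g : V → Λ} {f : V → Fin k}
    (hg : ∀ u v, g u = g v ↔ f u = f v) {L : V → Option Λ} (h : Consistent g L)
    (hc : HasConflictPath (E \ discovered E L) L) : 1 ≤ numUndone E f L := by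
  obtain ⟨e, he, heD⟩ := exists_undiscovered hg h hc
  rw [numUndone, le_min_iff, Nat.one_le_iff_ne_zero, Nat.one_le_iff_ne_zero, Finset.card_ne_zero,
    Finset.card_ne_zero]
  refine ⟨?_, e, Finset.mem_sdiff.2 ⟨he, heD⟩⟩
  obtain ⟨heE, u, hu, v, hv, huv⟩ := mem_cutSet.1 he
  by_cases hLu : L u = none
  · exact ⟨u, Finset.mem_filter.2 ⟨mem_boundary.2 ⟨e, he, hu⟩, hLu⟩⟩
  by_cases hLv : L v = none
  · exact ⟨v, Finset.mem_filter.2 ⟨mem_boundary.2 ⟨e, he, hv⟩, hLv⟩⟩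
  · exact absurd (mem_discovered.2 ⟨heE, u, hu, v, hv, conflict_of_labelled hg h hLu hLv huv⟩) heD

theorem numUndone_update_le {E : Finset (Finset V)} {f : V → Fin k} {L : V → Option Λ} {x : V}
    (a : Λ) (hx : L x = none) :
    numUndone E f (Function.update L x (some a)) ≤ numUndone E f L := by
  refine min_le_min (Finset.card_le_card fun v hv => ?_) (Finset.card_le_card
    (Finset.sdiff_subset_sdiff subset_rfl (discovered_update_subset a hx)))
  rw [Finset.mem_filter] at hv ⊢
  refine ⟨hv.1, ?_⟩
  by_cases h : v = x
  · rw [h, hx]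
  · rw [← hv.2, Function.update_of_ne h]

/-- A query that leads to a discovery. -/
theorem numUndone_update_lt {E : Finset (Finset V)} {g : V → Λ} {f : V → Fin k}
    (hg : ∀ u v, g u = g v ↔ f u = f v) {L : V → Option Λ} (h : Consistent g L) {x : V}
    (hx : L x = none) {e : Finset V}
    (he : e ∈ discovered E (Function.update L x (some (g x)))) (heD : e ∉ discovered E L) :
    numUndone E f (Function.update L x (some (g x))) < numUndone E f L := by
  have heC := discovered_subset_cutSet hg (h.update x) he
  -- Only the label of `x` is new, so a newly discovered hyperedge contains `x`. Thus `x` is a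
  -- boundary node, and both terms of the minimum drop.
  have hxe : x ∈ e := by
    by_contra hxe
    have hne : ∀ {u}, u ∈ e → u ≠ x := fun hu h => hxe (h ▸ hu)
    apply heD
    obtain ⟨heE, u, hu, v, hv, a, b, ha, hb, hab⟩ := mem_discovered.1 he
    rw [Function.update_of_ne (hne hu)] at ha
    rw [Function.update_of_ne (hne hv)] at hb
    exact mem_discovered.2 ⟨heE, u, hu, v, hv, a, b, ha, hb, hab⟩
  refine min_lt_min (Finset.card_lt_card ?_) (Finset.card_lt_card ?_)
  · rw [Finset.ssubset_iff_of_subset]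
    · refine ⟨x, Finset.mem_filter.2 ⟨mem_boundary.2 ⟨e, heC, hxe⟩, hx⟩, ?_⟩
      simp
    · intro v hv
      rw [Finset.mem_filter] at hv ⊢
      refine ⟨hv.1, ?_⟩
      by_cases h : v = x
      · rw [h, hx]
      · rw [← hv.2, Function.update_of_ne h]
  · rw [Finset.ssubset_iff_of_subset (Finset.sdiff_subset_sdiff subset_rfl
      (discovered_update_subset _ hx))]
    exact ⟨e, Finset.mem_sdiff.2 ⟨heC, heD⟩, by simp [he]⟩

/-- Purity is what puts a new discovery into a component that was untouched before; otherwise it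
could lie in one that is already opened. -/
theorem freshPairs_lt {E : Finset (Finset V)} {f : V → Fin k} {D D' : Finset (Finset V)}
    (hsub : D ⊆ D') (hp : IsPure E f D) {e : Finset V} (heC : e ∈ cutSet E f) (he : e ∈ D')
    (heD : e ∉ D) : (freshPairs E f D').ncard < (freshPairs E f D).ncard := by
  obtain ⟨heE, u, hu, v, hv, huv⟩ := mem_cutSet.1 heC
  have hm := mem_cutComponent_of_ne heE hu hv huv
  refine Set.ncard_lt_ncard ?_ (Set.toFinite _)
  refine ⟨freshPairs_anti hsub, fun hle => ?_⟩
  have : s((cutFree E f).connectedComponentMk u, (cutFree E f).connectedComponentMk v)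
      ∈ freshPairs E f D := by
    refine ⟨_, _, rfl, ⟨e, hm⟩, ?_⟩
    rcases hp _ _ with h | h
    · exact absurd (h e hm) heD
    · exact h
  obtain ⟨r, s, hz, -, hD⟩ := hle this
  rcases Sym2.eq_iff.1 hz with ⟨h1, h2⟩ | ⟨h1, h2⟩
  · rw [← h1, ← h2] at hD
    exact hD e hm he
  · rw [← h1, ← h2] at hD
    exact hD e (mem_cutComponent_of_ne heE hv hu huv.symm) he

theorem freshPairs_pos {E : Finset (Finset V)} {g : V → Λ} {f : V → Fin k}
    (hg : ∀ u v, g u = g v ↔ f u = f v) {L : V → Option Λ} (h : Consistent g L)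
    (hc : HasConflictPath (E \ discovered E L) L) (hp : IsPure E f (discovered E L)) :
    1 ≤ (freshPairs E f (discovered E L)).ncard := by
  obtain ⟨e, he, heD⟩ := exists_undiscovered hg h hc
  exact (Nat.zero_le _).trans_lt
    (freshPairs_lt (discovered_subset_cutSet hg h) hp he he heD)

/-- If some cut component has been discovered in part, then there is a conflict path of length at
most `κ`. -/
theorem conflictDist_le_of_not_isPure {E : Finset (Finset V)} {g : V → Λ} {f : V → Fin k}
    (hg : ∀ u v, g u = g v ↔ f u = f v) {L : V → Option Λ} (h : Consistent g L) {κ : ℕ}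
    (hclu : IsClustered E f κ) (hp : ¬ IsPure E f (discovered E L)) :
    conflictDist (E \ discovered E L) L ≤ κ := by
  simp only [IsPure, not_forall, not_or, exists_prop, not_not] at hp
  obtain ⟨r, s, ⟨e', he', he'D⟩, e, he, heD⟩ := hp
  obtain ⟨h1, h2⟩ := (hclu r s e he e').1 he'
  -- A chain of arcs from the discovered `e` to the undiscovered `e'` leaves the discovered set at
  -- some arc.
  have harc : ∃ x y, ArcLe E f κ x y ∧ x ∈ discovered E L ∧ y ∉ discovered E L := by
    clear he' h2
    induction h1 with
    | refl => exact absurd heD he'D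
    | @tail b c hb hbc ih =>
      by_cases hbD : b ∈ discovered E L
      · exact ⟨b, c, hbc, hbD, he'D⟩
      · exact ih hbD
  obtain ⟨x, y, ⟨⟨r', s', hx', hy'⟩, harc⟩, hxD, hyD⟩ := harc
  obtain ⟨hxE, u, hu, v, hv, huv⟩ := mem_discovered.1 hxD
  have hxC := mem_cutComponent_of_ne hxE hu hv (h.conflict hg huv)
  -- `x` and `y` share a cut component, so they are mutually reachable; by clustering, `y` then lies
  -- in every cut component of `x`, in particular in the one given by the conflicting pair `u`, `v`.
  have hyC := (hclu _ _ x hxC y).2 ((hclu r' s' x hx' y).1 hy')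
  have hle := harc _ _ hxC hyC
  -- The supremum in `pairDist` covers the labelled pair `u`, `v`, and an infimum of extended
  -- naturals that is at most `κ` is witnessed.
  have key : ∃ u' ∈ omegaPart E f ((cutFree E f).connectedComponentMk u) y,
      ∃ v' ∈ omegaPart E f ((cutFree E f).connectedComponentMk v) y,
      (cutFree E f).edist u u' + (cutFree E f).edist v v' + 1 ≤ (κ : ℕ∞) := by
    by_contra! hno
    have h3 : ((κ + 1 : ℕ) : ℕ∞) ≤ pairDist E f ((cutFree E f).connectedComponentMk u)
        ((cutFree E f).connectedComponentMk v) x y := by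
      refine le_iSup₂_of_le u ⟨hu, rfl⟩ (le_iSup₂_of_le v ⟨hv, rfl⟩ ?_)
      refine le_iInf₂ fun u' hu' => le_iInf₂ fun v' hv' => ?_
      rw [Nat.cast_add, Nat.cast_one]
      exact Order.add_one_le_of_lt (hno u' hu' v' hv')
    have h4 := h3.trans hle
    rw [Nat.cast_le] at h4
    omega
  obtain ⟨u', hu', v', hv', hd⟩ := key
  have hru : (cutFree E f).Reachable u u' := SimpleGraph.ConnectedComponent.eq.1 hu'.2.symm
  have hrv : (cutFree E f).Reachable v v' := SimpleGraph.ConnectedComponent.eq.1 hv'.2.symm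
  obtain ⟨P, hP⟩ := hru.exists_walk_length_eq_edist
  obtain ⟨Q, hQ⟩ := hrv.exists_walk_length_eq_edist
  obtain ⟨S, hS⟩ := exists_walk_le_one (Finset.mem_sdiff.2 ⟨hyC.1, hyD⟩) hu'.1 hv'.1
  rw [← hP, ← hQ] at hd
  have hd' : P.length + Q.length + 1 ≤ κ := by exact_mod_cast hd
  have hmono := cutFree_le (E := E) hg h
  refine (conflictDist_le huv (((P.mapLe hmono).append S).append (Q.mapLe hmono).reverse)).trans ?_
  simp only [SimpleGraph.Walk.length_append, SimpleGraph.Walk.length_reverse,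
    SimpleGraph.Walk.length_map, SimpleGraph.Walk.mapLe]
  omega

/-- A bound without cases: the pending cost `s` is at most `l` if all components are pure and at
most `c` otherwise. It is applied after queries that may change the case. -/
theorem potential_le {E : Finset (Finset V)} {g : V → Λ} {f : V → Fin k}
    (hg : ∀ u v, g u = g v ↔ f u = f v) {L : V → Option Λ} (h : Consistent g L) {κ : ℕ}
    (hclu : IsClustered E f κ) (hκ : κ ≤ Fintype.card V) :
    potential E f κ L ≤ (freshPairs E f (discovered E L)).ncard
      * (Nat.clog 2 (Fintype.card V) - Nat.clog 2 κ) + numUndone E f L * Nat.clog 2 κ := by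
  have hlc : Nat.clog 2 κ ≤ Nat.clog 2 (Fintype.card V) := Nat.clog_mono_right 2 hκ
  by_cases hc : HasConflictPath (E \ discovered E L) L
  swap
  · exact (potential_of_not_hasConflictPath hc).le
  by_cases hp : IsPure E f (discovered E L)
  · rw [potential_of_isPure hc hp]
    have hw := freshPairs_pos hg h hc hp
    have hu := numUndone_pos hg h hc
    have hs := Nat.clog_mono_right 2 (conflictDist_lt_card hc).le
    obtain ⟨w, hw'⟩ := Nat.exists_eq_add_of_le' hw
    obtain ⟨u, hu'⟩ := Nat.exists_eq_add_of_le' hu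
    rw [hw', hu', Nat.add_sub_cancel, Nat.add_sub_cancel, add_mul, add_mul]
    omega
  · rw [potential_of_not_isPure hc hp]
    have hu := numUndone_pos hg h hc
    have hs := Nat.clog_mono_right 2 (conflictDist_le_of_not_isPure hg h hclu hp)
    obtain ⟨u, hu'⟩ := Nat.exists_eq_add_of_le' hu
    rw [hu', Nat.add_sub_cancel, add_mul]
    omega

/-- Without a conflict path the potential equals the bound of `potential_le`, and that bound is
monotone in the labelling. -/
theorem potential_update_le {E : Finset (Finset V)} {g : V → Λ} {f : V → Fin k}
    (hg : ∀ u v, g u = g v ↔ f u = f v) {L : V → Option Λ} (h : Consistent g L) {κ : ℕ}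
    (hclu : IsClustered E f κ) (hκ : κ ≤ Fintype.card V)
    (hc : ¬ HasConflictPath (E \ discovered E L) L) {x : V} (hx : L x = none) :
    potential E f κ (Function.update L x (some (g x))) ≤ potential E f κ L := by
  refine (potential_le hg (h.update x) hclu hκ).trans ?_
  rw [potential_of_not_hasConflictPath hc]
  have h1 := Set.ncard_le_ncard (freshPairs_anti (E := E) (f := f)
    (discovered_update_subset (E := E) (g x) hx)) (Set.toFinite _)
  have h2 := numUndone_update_le (E := E) (f := f) (g x) hx
  gcongr

/-- If nothing is discovered, the halving lowers `s` by at least one and nothing else grows. If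
something is discovered, the terms other than `s` already cover the bound of `potential_le` for the
new labelling, and `s ≥ 1` is saved. -/
theorem potential_midpoint_lt {E : Finset (Finset V)} {g : V → Λ} {f : V → Fin k}
    (hg : ∀ u v, g u = g v ↔ f u = f v) {L : V → Option Λ} (h : Consistent g L) {κ : ℕ}
    (hclu : IsClustered E f κ) (hκ : κ ≤ Fintype.card V)
    (hc : HasConflictPath (E \ discovered E L) L) {x : V}
    (hx : IsShortestMidpoint (E \ discovered E L) L x) :
    potential E f κ (Function.update L x (some (g x))) < potential E f κ L := by
  have hlc : Nat.clog 2 κ ≤ Nat.clog 2 (Fintype.card V) := Nat.clog_mono_right 2 hκ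
  have hx0 := midpoint_unlabelled hx
  have hsub := discovered_update_subset (E := E) (g x) hx0
  -- For `d ≥ 2`, `Nat.clog 2 d` is one more than its value at `(d + 1) / 2`, the bound for the
  -- distance after a midpoint query.
  have hclog := Nat.clog_of_two_le (b := 2) one_lt_two (two_le_conflictDist hc)
  have hu := numUndone_pos hg h hc
  by_cases hD : discovered E (Function.update L x (some (g x))) = discovered E L
  · obtain ⟨hc', hd⟩ := midpoint_conflictDist (g x) hx
    have hs : Nat.clog 2 (conflictDist (E \ discovered E L) (Function.update L x (some (g x))))
        < Nat.clog 2 (conflictDist (E \ discovered E L) L) := by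
      rw [hclog]
      exact Nat.lt_succ_of_le (Nat.clog_mono_right 2 hd)
    have h2 := numUndone_update_le (E := E) (f := f) (g x) hx0
    have h3 : (numUndone E f (Function.update L x (some (g x))) - 1) * Nat.clog 2 κ
        ≤ (numUndone E f L - 1) * Nat.clog 2 κ := by gcongr
    have hc'' : HasConflictPath (E \ discovered E (Function.update L x (some (g x))))
        (Function.update L x (some (g x))) := by rwa [hD]
    by_cases hp : IsPure E f (discovered E L)
    · rw [potential_of_isPure hc hp, potential_of_isPure hc'' (by rwa [hD]), hD]
      omega
    · rw [potential_of_not_isPure hc hp, potential_of_not_isPure hc'' (by rwa [hD]), hD]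
      omega
  · obtain ⟨e, he, heD⟩ := Finset.exists_of_ssubset (hsub.ssubset_of_ne (Ne.symm hD))
    refine (potential_le hg (h.update x) hclu hκ).trans_lt ?_
    have h2 := numUndone_update_lt hg h hx0 he heD
    have h3 : numUndone E f (Function.update L x (some (g x))) * Nat.clog 2 κ
        ≤ (numUndone E f L - 1) * Nat.clog 2 κ := Nat.mul_le_mul_right _ (by omega)
    by_cases hp : IsPure E f (discovered E L)
    · rw [potential_of_isPure hc hp]
      have h1 := freshPairs_lt hsub hp (discovered_subset_cutSet hg (h.update x) he) he heD
      have h4 : (freshPairs E f (discovered E (Function.update L x (some (g x))))).ncard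
          * (Nat.clog 2 (Fintype.card V) - Nat.clog 2 κ)
          ≤ ((freshPairs E f (discovered E L)).ncard - 1)
          * (Nat.clog 2 (Fintype.card V) - Nat.clog 2 κ) := Nat.mul_le_mul_right _ (by omega)
      omega
    · rw [potential_of_not_isPure hc hp]
      have h1 := Set.ncard_le_ncard (freshPairs_anti (E := E) (f := f) hsub) (Set.toFinite _)
      have h4 := Nat.mul_le_mul_right (Nat.clog 2 (Fintype.card V) - Nat.clog 2 κ) h1
      omega

/-- The initial value of the potential. -/
theorem potential_none_le {E : Finset (Finset V)} {g : V → Λ} {f : V → Fin k}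
    (hg : ∀ u v, g u = g v ↔ f u = f v) {κ : ℕ}
    (hclu : IsClustered E f κ) (hκ : κ ≤ Fintype.card V) :
    potential E f κ (fun _ => (none : Option Λ)) ≤ numCutComponents E f
      * (Nat.clog 2 (Fintype.card V) - Nat.clog 2 κ)
      + min (boundary E f).card (cutSet E f).card * Nat.clog 2 κ := by
  have h : Consistent g (fun _ => (none : Option Λ)) := fun v a h => by simp at h
  refine (potential_le hg h hclu hκ).trans ?_
  have h1 : (freshPairs E f (discovered E fun _ => (none : Option Λ))).ncard
      ≤ numCutComponents E f :=
    Set.ncard_le_ncard (fun z ⟨r, s, hz, hne, _⟩ => ⟨r, s, hz, hne⟩) (Set.toFinite _)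
  have h2 : numUndone E f (fun _ => (none : Option Λ))
      ≤ min (boundary E f).card (cutSet E f).card :=
    min_le_min (Finset.card_le_card (Finset.filter_subset _ _))
      (Finset.card_le_card Finset.sdiff_subset)
  gcongr

/-- If every component of `G - C` has a labelled node and there is no conflict path, then the cut
set has been discovered. -/
theorem discovered_eq_cutSet {E : Finset (Finset V)} {g : V → Λ} {f : V → Fin k}
    (hg : ∀ u v, g u = g v ↔ f u = f v) {L : V → Option Λ} (h : Consistent g L)
    (hc : ¬ HasConflictPath (E \ discovered E L) L)
    (hit : ∀ r : Piece E f, ∃ v ∈ r.supp, L v ≠ none) : discovered E L = cutSet E f := by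
  refine (discovered_subset_cutSet hg h).antisymm fun e he => ?_
  by_contra heD
  obtain ⟨heE, u, hu, v, hv, huv⟩ := mem_cutSet.1 he
  obtain ⟨u', hu', hLu⟩ := hit ((cutFree E f).connectedComponentMk u)
  obtain ⟨v', hv', hLv⟩ := hit ((cutFree E f).connectedComponentMk v)
  have hru : (cutFree E f).Reachable u' u := SimpleGraph.ConnectedComponent.eq.1 hu'
  have hrv : (cutFree E f).Reachable v' v := SimpleGraph.ConnectedComponent.eq.1 hv'
  obtain ⟨P, -⟩ := exists_walk_le_one (Finset.mem_sdiff.2 ⟨heE, heD⟩) hu hv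
  refine hc ⟨u', v', conflict_of_labelled hg h hLu hLv ?_, ?_⟩
  · rwa [cutFree_reachable_label hru, cutFree_reachable_label hrv]
  · exact ((hru.mono (cutFree_le hg h)).trans ⟨P⟩).trans (hrv.mono (cutFree_le hg h)).symm

end Potential

/-! ### The law of the search algorithm -/

section SearchLaw

theorem PMF.toOuterMeasure_le_one {α : Type*} (q : PMF α) (s : Set α) :
    q.toOuterMeasure s ≤ 1 := by
  refine (MeasureTheory.measure_mono (Set.subset_univ s)).trans ?_
  rw [(PMF.toOuterMeasure_apply_eq_one_iff q Set.univ).2 (Set.subset_univ _)]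

variable {V : Type*} {k : ℕ} {Λ : Type*} [Fintype V] [DecidableEq V]

theorem mem_unlabelled {L : V → Option Λ} {v : V} : v ∈ unlabelled L ↔ L v = none := by
  simp [unlabelled]

/-- A property that is kept by queries of unlabelled nodes holds for every possible result. -/
theorem hs2_induction {E : Finset (Finset V)} {g : V → Λ} (μ : MidpointRule V Λ)
    {Q : ℕ → (V → Option Λ) → Prop}
    (step : ∀ b L x, Q (b + 1) L → L x = none → Q b (Function.update L x (some (g x))))
    (halt : ∀ b L, Q b L → Q 0 L) :
    ∀ (b : ℕ) (L : V → Option Λ), Q b L → ∀ L' ∈ (hs2 E g μ b L).support, Q 0 L' := by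
  intro b
  induction b with
  | zero =>
    intro L hL L' hL'
    rw [hs2, PMF.support_pure, Set.mem_singleton_iff] at hL'
    rwa [hL']
  | succ b ih =>
    intro L hL L' hL'
    rw [hs2] at hL'
    split_ifs at hL' with hc hu
    · exact ih _ (step b L _ hL (midpoint_unlabelled (μ.mid_spec _ _ hc))) L' hL'
    · rw [PMF.mem_support_bind_iff] at hL'
      obtain ⟨x, hx, hL'⟩ := hL'
      rw [PMF.mem_support_uniformOfFinset_iff, mem_unlabelled] at hx
      exact ih _ (step b L x hL hx) L' hL'
    · rw [PMF.support_pure, Set.mem_singleton_iff] at hL'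
      rw [hL']
      exact halt _ _ hL

open scoped Classical in
/-- The labelled nodes. -/
def labelled (L : V → Option Λ) : Finset V := Finset.univ.filter fun v => L v ≠ none

theorem hs2_card_labelled {E : Finset (Finset V)} {g : V → Λ} (μ : MidpointRule V Λ) (b : ℕ)
    {L' : V → Option Λ} (hL' : L' ∈ (hs2 E g μ b fun _ => none).support) :
    (labelled L').card ≤ b := by
  refine hs2_induction μ (Q := fun j L => (labelled L).card + j ≤ b) ?_ ?_ b _ ?_ L' hL'
  · intro j L x hL hx
    have hsub : labelled (Function.update L x (some (g x))) ⊆ insert x (labelled L) := by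
      intro v hv
      by_cases h : v = x
      · simp [h]
      · simp only [labelled, Finset.mem_filter, Function.update_of_ne h] at hv
        simp [labelled, hv]
    have h1 := Finset.card_le_card hsub
    have h2 := Finset.card_insert_le x (labelled L)
    omega
  · intro j L h
    omega
  · simp [labelled]

/-- Replacing the label function costs at most the probability that the two label functions differ
at a queried node. -/
theorem hs2_le_of_agree {E : Finset (Finset V)} (g g₀ : V → Λ) (μ : MidpointRule V Λ)
    (B : Set (V → Option Λ)) (b : ℕ) (L : V → Option Λ) :
    (hs2 E g μ b L).toOuterMeasure B ≤
      (hs2 E g₀ μ b L).toOuterMeasure (B ∪ {L' | ∃ v, L' v ≠ none ∧ g v ≠ g₀ v}) := by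
  induction b generalizing L with
  | zero =>
    rw [hs2, hs2]
    exact MeasureTheory.measure_mono Set.subset_union_left
  | succ b ih =>
    have key : ∀ x, (hs2 E g μ b (Function.update L x (some (g x)))).toOuterMeasure B ≤
        (hs2 E g₀ μ b (Function.update L x (some (g₀ x)))).toOuterMeasure
          (B ∪ {L' | ∃ v, L' v ≠ none ∧ g v ≠ g₀ v}) := by
      intro x
      by_cases hx : g x = g₀ x
      · rw [hx]
        exact ih _
      -- At a disagreement the two runs part, but `x` stays labelled in the second one, whose
      -- enlarged event therefore has probability one.
      · refine (PMF.toOuterMeasure_le_one _ _).trans (le_of_eq ?_)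
        symm
        rw [PMF.toOuterMeasure_apply_eq_one_iff]
        intro L' hL'
        refine Or.inr ⟨x, ?_, hx⟩
        refine hs2_induction μ (Q := fun _ L => L x ≠ none) ?_ ?_ b _ ?_ L' hL'
        · intro _ L y hL hy
          by_cases h : x = y
          · simp [h]
          · rwa [Function.update_of_ne h]
        · exact fun _ _ h => h
        · simp
    rw [hs2, hs2]
    split_ifs with hc hu
    · exact key _
    · rw [PMF.toOuterMeasure_bind_apply, PMF.toOuterMeasure_bind_apply]
      exact ENNReal.tsum_le_tsum fun x => mul_le_mul_right (key x) _
    · exact MeasureTheory.measure_mono Set.subset_union_left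

/-- No labelled node lies in the component. -/
def Unhit {E : Finset (Finset V)} {f : V → Fin k} (L : V → Option Λ) (r : Piece E f) : Prop :=
  ∀ v ∈ r.supp, L v = none

open scoped Classical in
instance pieceFintype (E : Finset (Finset V)) (f : V → Fin k) : Fintype (Piece E f) :=
  Fintype.ofFinite _

/-- The components partition `V`. The bound turns a union over components into a factor `1 / β`. -/
theorem card_piece_mul_le {E : Finset (Finset V)} {f : V → Fin k} {β : ℝ}
    (hbal : IsBalanced E f β) (hV : 0 < Fintype.card V) : Fintype.card (Piece E f) * β ≤ 1 := by
  classical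
  have h1 : ∑ r : Piece E f, r.supp.ncard = Fintype.card V := by
    have := Finset.card_eq_sum_card_fiberwise (s := (Finset.univ : Finset V))
      (t := (Finset.univ : Finset (Piece E f)))
      (f := fun v => (cutFree E f).connectedComponentMk v) (by simp [Set.MapsTo])
    rw [← Finset.card_univ, this]
    refine Finset.sum_congr rfl fun r _ => ?_
    rw [← Set.ncard_coe_finset]
    congr 1
    ext v
    simp [SimpleGraph.ConnectedComponent.mem_supp_iff]
  have h2 : ∑ _r : Piece E f, β * Fintype.card V ≤ ∑ r : Piece E f, (r.supp.ncard : ℝ) :=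
    Finset.sum_le_sum fun r _ => hbal r
  rw [← Nat.cast_sum, h1, Finset.sum_const, Finset.card_univ, nsmul_eq_mul, ← mul_assoc] at h2
  have h3 : (0 : ℝ) < Fintype.card V := by exact_mod_cast hV
  nlinarith

theorem two_le_card_piece {E : Finset (Finset V)} {f : V → Fin k} (hk : 2 ≤ k)
    (hf : Function.Surjective f) : 2 ≤ Fintype.card (Piece E f) := by
  obtain ⟨u, hu⟩ := hf ⟨0, by omega⟩
  obtain ⟨v, hv⟩ := hf ⟨1, by omega⟩
  refine Fintype.one_lt_card_iff.2 ⟨(cutFree E f).connectedComponentMk u,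
    (cutFree E f).connectedComponentMk v, fun h => ?_⟩
  have := cutFree_reachable_label (SimpleGraph.ConnectedComponent.eq.1 h)
  rw [hu, hv] at this
  simp at this

/-- An unhit component is unlabelled as a whole, so all of its at least `β n` nodes are among the at
most `n` candidates. -/
theorem uniform_miss_le {E : Finset (Finset V)} {f : V → Fin k} {β : ℝ}
    (hβ0 : 0 ≤ β) (hβ1 : β ≤ 1)
    (hbal : IsBalanced E f β) {L : V → Option Λ} (h : (unlabelled L).Nonempty) {r : Piece E f}
    (hr : Unhit L r) :
    (PMF.uniformOfFinset (unlabelled L) h).toOuterMeasure {x | x ∉ r.supp} ≤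
      ENNReal.ofReal (1 - β) := by
  classical
  rw [PMF.toOuterMeasure_uniformOfFinset_apply]
  have hU : 0 < (unlabelled L).card := h.card_pos
  rw [ENNReal.div_le_iff (by exact_mod_cast hU.ne') (by simp)]
  rw [← ENNReal.ofReal_natCast, ← ENNReal.ofReal_natCast, ← ENNReal.ofReal_mul (by linarith)]
  refine ENNReal.ofReal_le_ofReal ?_
  have h1 := Finset.card_filter_add_card_filter_not (s := unlabelled L) (fun x => x ∈ r.supp)
  have h2 : ((unlabelled L).filter fun x => x ∈ r.supp).card = r.supp.ncard := by
    rw [← Set.ncard_coe_finset]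
    congr 1
    ext v
    simp only [Finset.coe_filter, mem_unlabelled, Set.mem_ofPred_eq]
    exact ⟨fun h => h.2, fun h => ⟨hr v h, h⟩⟩
  have h3 := hbal r
  have h4 : ((unlabelled L).card : ℝ) ≤ Fintype.card V := by
    exact_mod_cast Finset.card_le_univ _
  have h5 : (r.supp.ncard : ℝ) + (((unlabelled L).filter fun x => x ∉ r.supp).card : ℝ)
      = (unlabelled L).card := by
    rw [← h1, ← h2]
    push_cast
    rfl
  have h6 : β * (unlabelled L).card ≤ β * Fintype.card V := by gcongr
  simp only [Set.mem_ofPred_eq]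
  linarith

open scoped Classical in
-- The exponent `b - potential` counts the random queries that are still affordable. A midpoint
-- query lowers the potential at least as much as the budget. A random query costs one unit of
-- budget, but a given component stays unhit with probability at most `1 - β`, which supplies the
-- lost factor. Once conflict paths are gone, failure requires an unhit component; hence the sum.
theorem hs2_fail_le {E : Finset (Finset V)} {g : V → Λ} {f : V → Fin k}
    (hg : ∀ u v, g u = g v ↔ f u = f v) {κ : ℕ} (hclu : IsClustered E f κ)
    (hκ : κ ≤ Fintype.card V) {β : ℝ} (hβ0 : 0 ≤ β) (hβ1 : β ≤ 1) (hbal : IsBalanced E f β)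
    (μ : MidpointRule V Λ) (b : ℕ) (L : V → Option Λ) (h : Consistent g L)
    (hb : potential E f κ L ≤ b) :
    (hs2 E g μ b L).toOuterMeasure {L' | discovered E L' ≠ cutSet E f} ≤
      ∑ r : Piece E f, if Unhit L r then ENNReal.ofReal (1 - β) ^ (b - potential E f κ L) else 0 := by
  have hq : ENNReal.ofReal (1 - β) ≤ 1 := by
    rw [ENNReal.ofReal_le_one]
    linarith
  -- A labelling with a hit in every component and without conflict path.
  have hzero : ∀ b L, Consistent g L → discovered E L = cutSet E f →
      (hs2 E g μ b L).toOuterMeasure {L' | discovered E L' ≠ cutSet E f} = 0 := by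
    intro b L h hL
    rw [PMF.toOuterMeasure_apply_eq_zero_iff, Set.disjoint_left]
    intro L' hL'
    have := hs2_induction μ (Q := fun _ L => Consistent g L ∧ discovered E L = cutSet E f) ?_ ?_ b
      _ ⟨h, hL⟩ L' hL'
    · simp [this.2]
    · rintro _ L x ⟨h, hL⟩ hx
      refine ⟨h.update x, (discovered_subset_cutSet hg (h.update x)).antisymm ?_⟩
      rw [← hL]
      exact discovered_update_subset _ hx
    · exact fun _ _ h => h
  have hone : ∀ (q : PMF (V → Option Λ)) (L : V → Option Λ), (∃ r : Piece E f, Unhit L r) →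
      q.toOuterMeasure {L' | discovered E L' ≠ cutSet E f} ≤
      ∑ r : Piece E f, if Unhit L r then ENNReal.ofReal (1 - β) ^ 0 else 0 := by
    rintro q L ⟨r, hr⟩
    refine (PMF.toOuterMeasure_le_one _ _).trans ?_
    refine le_trans ?_ (Finset.single_le_sum (fun _ _ => zero_le) (Finset.mem_univ r))
    simp [hr]
  induction b generalizing L with
  | zero =>
    -- The potential is zero here, so it cannot drop further, as it would at a midpoint.
    have hc : ¬ HasConflictPath (E \ discovered E L) L := by
      intro hc
      have := potential_midpoint_lt hg h hclu hκ hc (μ.mid_spec _ _ hc)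
      omega
    by_cases hex : ∃ r : Piece E f, Unhit L r
    · rw [Nat.zero_sub]
      exact hone _ L hex
    · simp only [Unhit, not_exists, not_forall, exists_prop] at hex
      rw [hzero 0 L h (discovered_eq_cutSet hg h hc hex)]
      exact zero_le
  | succ b ih =>
    by_cases hc : HasConflictPath (E \ discovered E L) L
    · rw [hs2]
      simp only [if_pos hc]
      have hmid := μ.mid_spec _ _ hc
      have hlt := potential_midpoint_lt hg h hclu hκ hc hmid
      refine (ih _ (h.update _) (by omega)).trans (Finset.sum_le_sum fun r _ => ?_)
      by_cases hr : Unhit L r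
      · rw [if_pos hr]
        split_ifs
        · exact pow_le_pow_of_le_one zero_le hq (by omega)
        · exact zero_le
      · rw [if_neg, if_neg hr]
        refine fun hr' => hr fun v hv => ?_
        by_contra hne
        have := hr' v hv
        have hx := midpoint_unlabelled hmid
        by_cases hvx : v = μ.mid (E \ discovered E L) L
        · exact hne (hvx ▸ hx)
        · rw [Function.update_of_ne hvx] at this
          exact hne this
    · by_cases hex : ∃ r : Piece E f, Unhit L r
      -- In the equality case the exponent is zero and the trivial bound one suffices. Otherwise a
      -- unit of budget is free for the random query.
      · by_cases hb' : potential E f κ L = b + 1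
        · rw [hb', Nat.sub_self]
          exact hone _ L hex
        have hne : (unlabelled L).Nonempty := by
          obtain ⟨r, hr⟩ := hex
          obtain ⟨v, hv⟩ := r.nonempty_supp
          exact ⟨v, mem_unlabelled.2 (hr v hv)⟩
        rw [hs2]
        simp only [if_neg hc, dif_pos hne]
        rw [PMF.toOuterMeasure_bind_apply]
        set U := PMF.uniformOfFinset (unlabelled L) hne with hU
        set j := b - potential E f κ L with hj
        -- A component is unhit after the query only if it was unhit before and avoids `x`. Labelled
        -- `x` have weight zero.
        have hstep : ∀ x, U x * (hs2 E g μ b (Function.update L x (some (g x)))).toOuterMeasure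
            {L' | discovered E L' ≠ cutSet E f} ≤
            U x * ∑ r : Piece E f, if Unhit L r ∧ x ∉ r.supp then ENNReal.ofReal (1 - β) ^ j
              else 0 := by
          intro x
          by_cases hx : L x = none
          · refine mul_le_mul_right ?_ _
            have hle := potential_update_le hg h hclu hκ hc hx
            refine (ih _ (h.update x) (by omega)).trans (Finset.sum_le_sum fun r _ => ?_)
            by_cases hr : Unhit (Function.update L x (some (g x))) r
            · rw [if_pos hr, if_pos]
              · exact pow_le_pow_of_le_one zero_le hq (by omega)
              · have hxr : x ∉ r.supp := fun hxr => by simpa using hr x hxr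
                refine ⟨fun v hv => ?_, hxr⟩
                rw [← hr v hv, Function.update_of_ne]
                rintro rfl
                exact hxr hv
            · rw [if_neg hr]
              exact zero_le
          · have : U x = 0 := by
              rw [hU, PMF.uniformOfFinset_apply_of_notMem]
              rwa [mem_unlabelled]
            rw [this, zero_mul, zero_mul]
        refine (ENNReal.tsum_le_tsum hstep).trans ?_
        rw [tsum_fintype]
        simp_rw [Finset.mul_sum]
        rw [Finset.sum_comm]
        refine Finset.sum_le_sum fun r _ => ?_
        by_cases hr : Unhit L r
        · simp only [hr, true_and, if_true]
          have hs : b + 1 - potential E f κ L = j + 1 := by omega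
          rw [hs, pow_succ']
          refine le_trans (le_of_eq ?_) (mul_le_mul_left (uniform_miss_le hβ0 hβ1 hbal hne hr) _)
          rw [PMF.toOuterMeasure_apply, tsum_fintype, Finset.sum_mul]
          refine Finset.sum_congr rfl fun x _ => ?_
          by_cases hx : x ∈ r.supp
          · rw [if_neg (not_not.2 hx), mul_zero, Set.indicator_of_notMem
              (show x ∉ {x | x ∉ r.supp} from not_not.2 hx), zero_mul]
          · rw [if_pos hx, Set.indicator_of_mem (show x ∈ {x | x ∉ r.supp} from hx)]
        · simp [hr]
      · simp only [Unhit, not_exists, not_forall, exists_prop] at hex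
        rw [hzero _ L h (discovered_eq_cutSet hg h hc hex)]
        exact zero_le

theorem consistent_none (g : V → Λ) : Consistent g fun _ => none := fun v a h => by simp at h

/-- The second summand bounds the initial potential. The `1` in the factor `⌈log₂ κ⌉ + 1` of the
budget is slack here. -/
theorem add_le_nodeBudget (E : Finset (Finset V)) (f : V → Fin k) (β : ℝ) {κ : ℕ}
    (hκ : κ ≤ Fintype.card V) (ε : ℝ) :
    Real.log (1 / (β * ε)) / Real.log (1 / (1 - β)) + ((numCutComponents E f
      * (Nat.clog 2 (Fintype.card V) - Nat.clog 2 κ)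
      + min (boundary E f).card (cutSet E f).card * Nat.clog 2 κ : ℕ) : ℝ) ≤
      nodeBudget E f β κ ε := by
  have hcl : Nat.clog 2 κ ≤ Nat.clog 2 (Fintype.card V) := Nat.clog_mono_right 2 hκ
  have hceil : ∀ a : ℕ, (⌈Real.logb 2 a⌉ : ℝ) = Nat.clog 2 a := by
    intro a
    have := Real.ceil_logb_natCast (b := 2) (r := (a : ℝ)) (by positivity)
    rw [Nat.cast_ofNat] at this
    rw [this, Int.clog_natCast, Int.cast_natCast]
  rw [nodeBudget, hceil, hceil]
  push_cast [Nat.cast_sub hcl]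
  have : (0 : ℝ) ≤ min ((boundary E f).card : ℝ) (cutSet E f).card := by positivity
  linarith

theorem log_div_log_pos {β ε : ℝ} (hβ0 : 0 < β) (hβ : β ≤ 1 / 2) (hε : 0 < ε) (hε1 : ε ≤ 1) :
    0 < Real.log (1 / (β * ε)) / Real.log (1 / (1 - β)) := by
  refine div_pos (Real.log_pos ?_) (Real.log_pos ?_)
  · rw [lt_div_iff₀ (by positivity)]
    nlinarith
  · rw [lt_div_iff₀ (by linarith)]
    linarith

theorem nodeBudget_pos (E : Finset (Finset V)) (f : V → Fin k) {β : ℝ} {κ : ℕ}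
    (hκ : κ ≤ Fintype.card V) {ε : ℝ} (hβ0 : 0 < β) (hβ : β ≤ 1 / 2) (hε : 0 < ε)
    (hε1 : ε ≤ 1) : 0 < nodeBudget E f β κ ε :=
  (add_pos_of_pos_of_nonneg (log_div_log_pos hβ0 hβ hε hε1) (Nat.cast_nonneg _)).trans_le
    (add_le_nodeBudget E f β hκ ε)

/-- The budget of node queries suffices for the search with correct labels. -/
theorem hs2_budget {E : Finset (Finset V)} {g : V → Λ} {f : V → Fin k} (hk : 2 ≤ k)
    (hf : Function.Surjective f)
    (hg : ∀ u v, g u = g v ↔ f u = f v) {κ : ℕ} (hclu : IsClustered E f κ)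
    (hκ : κ ≤ Fintype.card V) {β : ℝ} (hβ0 : 0 < β) (hβ : β ≤ 1 / 2) (hbal : IsBalanced E f β)
    (μ : MidpointRule V Λ) {ε : ℝ} (hε : 0 < ε) (hε1 : ε ≤ 1) :
    (hs2 E g μ ⌊nodeBudget E f β κ ε⌋₊ fun _ => none).toOuterMeasure
      {L' | discovered E L' ≠ cutSet E f} ≤ ENNReal.ofReal (2 * ε) := by
  classical
  have hV : 0 < Fintype.card V := by
    obtain ⟨u, -⟩ := hf ⟨0, by omega⟩
    exact Fintype.card_pos_iff.2 ⟨u⟩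
  have hbud := add_le_nodeBudget E f β hκ ε
  have hA0 := (log_div_log_pos hβ0 hβ hε hε1).le
  have hpot := potential_none_le (Λ := Λ) hg hclu hκ
  set A := Real.log (1 / (β * ε)) / Real.log (1 / (1 - β)) with hA
  set Φ := numCutComponents E f * (Nat.clog 2 (Fintype.card V) - Nat.clog 2 κ)
    + min (boundary E f).card (cutSet E f).card * Nat.clog 2 κ with hΦ
  have hlog : 0 < Real.log (1 / (1 - β)) := by
    apply Real.log_pos
    rw [lt_div_iff₀ (by linarith)]
    linarith
  -- `Φ` is an integer, so rounding the budget down still leaves `⌊A⌋` queries beyond the initial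
  -- potential.
  have hfl : ⌊A⌋₊ + Φ ≤ ⌊nodeBudget E f β κ ε⌋₊ := by
    rw [← Nat.floor_add_natCast hA0]
    exact Nat.floor_le_floor hbud
  refine (hs2_fail_le hg hclu hκ hβ0.le (by linarith) hbal μ _ _ (consistent_none g)
    (by omega)).trans ?_
  have hq : ENNReal.ofReal (1 - β) ≤ 1 := by
    rw [ENNReal.ofReal_le_one]
    linarith
  have hT := card_piece_mul_le hbal hV
  -- `A` solves `(1 - β) ^ A = β ε`. Rounding it down loses at most one factor `1 / (1 - β) ≤ 2`,
  -- the source of the `2 ε`; the factor `β` cancels the number of components.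
  have hterm : (1 - β) ^ ⌊A⌋₊ ≤ 2 * (β * ε) := by
    have h1 : (1 - β) ^ ⌊A⌋₊ * (1 - β) ≤ β * ε := by
      rw [← pow_succ, ← Real.rpow_natCast]
      have h2 : (1 - β) ^ A = β * ε := by
        rw [Real.rpow_def_of_pos (by linarith), hA, one_div (1 - β), Real.log_inv, one_div,
          Real.log_inv, neg_div_neg_eq, mul_div_cancel₀, Real.exp_log (by positivity)]
        rw [one_div, Real.log_inv] at hlog
        linarith
      rw [← h2]
      refine Real.rpow_le_rpow_of_exponent_ge (by linarith) (by linarith) ?_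
      push_cast
      exact (Nat.lt_floor_add_one A).le
    have h3 : 0 ≤ (1 - β) ^ ⌊A⌋₊ := pow_nonneg (by linarith) _
    nlinarith
  calc ∑ r : Piece E f, (if Unhit (fun _ => (none : Option Λ)) r then
        ENNReal.ofReal (1 - β) ^ (⌊nodeBudget E f β κ ε⌋₊ - potential E f κ
          (fun _ => (none : Option Λ))) else 0)
      ≤ ∑ _r : Piece E f, ENNReal.ofReal (2 * (β * ε)) := by
        refine Finset.sum_le_sum fun r _ => ?_
        split_ifs
        · refine (pow_le_pow_of_le_one zero_le hq (show ⌊A⌋₊ ≤ _ by omega)).trans ?_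
          rw [← ENNReal.ofReal_pow (by linarith)]
          exact ENNReal.ofReal_le_ofReal hterm
        · exact zero_le
    _ = ENNReal.ofReal (Fintype.card (Piece E f) * (2 * (β * ε))) := by
        rw [Finset.sum_const, Finset.card_univ, nsmul_eq_mul, ENNReal.ofReal_mul (p := (Fintype.card (Piece E f) : ℝ)) (by positivity),
          ENNReal.ofReal_natCast]
    _ ≤ _ := ENNReal.ofReal_le_ofReal (by nlinarith)

end SearchLaw

/-! ### Concentration of the noise -/

section Noise

open MeasureTheory ProbabilityTheory

variable {V : Type*} [Fintype V] [DecidableEq V] {p : ℝ} (h0 : 0 ≤ p) (h1 : p ≤ 1)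

/-- The law of a single flag. -/
def flagLaw (p : ℝ) : Measure Bool :=
  ENNReal.ofReal p • Measure.dirac true + ENNReal.ofReal (1 - p) • Measure.dirac false

theorem isProbabilityMeasure_flagLaw {p : ℝ} (h0 : 0 ≤ p) (h1 : p ≤ 1) :
    IsProbabilityMeasure (flagLaw p) := by
  constructor
  simp only [flagLaw, Measure.add_apply, Measure.smul_apply, measure_univ, smul_eq_mul, mul_one]
  rw [← ENNReal.ofReal_add h0 (by linarith)]
  simp

theorem flagLaw_singleton (b : Bool) :
    flagLaw p {b} = if b then ENNReal.ofReal p else ENNReal.ofReal (1 - p) := by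
  cases b <;> simp [flagLaw]

theorem toMeasure_noiseLaw :
    (noiseLaw V p h0 h1).toMeasure = Measure.pi fun _ => flagLaw p := by
  have := isProbabilityMeasure_flagLaw h0 h1
  refine Measure.ext_of_singleton fun ξ => ?_
  rw [PMF.toMeasure_apply_singleton _ _ (measurableSet_singleton ξ), Measure.pi_singleton]
  simp only [flagLaw_singleton]
  rfl

/-- The flag of the pair `z` as a real number. -/
def flag (z : Sym2 V) (ξ : Sym2 V → Bool) : ℝ := if ξ z then 1 else 0

theorem iIndepFun_noise :
    iIndepFun (fun z (ξ : Sym2 V → Bool) => ξ z) (noiseLaw V p h0 h1).toMeasure := by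
  have := isProbabilityMeasure_flagLaw h0 h1
  rw [toMeasure_noiseLaw]
  exact iIndepFun_pi (X := fun _ b => b) fun _ => aemeasurable_id

theorem integral_comp_noise (φ : Bool → ℝ) (z : Sym2 V) :
    ∫ ξ, φ (ξ z) ∂(noiseLaw V p h0 h1).toMeasure = p * φ true + (1 - p) * φ false := by
  have := isProbabilityMeasure_flagLaw h0 h1
  rw [toMeasure_noiseLaw]
  have := (measurePreserving_eval (fun _ : Sym2 V => flagLaw p) z)
  have h2 := integral_map (μ := Measure.pi fun _ : Sym2 V => flagLaw p)
    (φ := fun ξ : Sym2 V → Bool => ξ z) (this.measurable.aemeasurable) (f := φ)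
    (Measurable.of_discrete.aestronglyMeasurable)
  have h3 : Measure.map (fun ξ : Sym2 V → Bool => ξ z) (Measure.pi fun _ => flagLaw p)
      = flagLaw p := this.map_eq
  rw [← h2]
  rw [h3, flagLaw, integral_add_measure (.smul_measure (.of_finite) (by simp))
    (.smul_measure (.of_finite) (by simp)), integral_smul_measure, integral_smul_measure,
    integral_dirac, integral_dirac, ENNReal.toReal_ofReal h0, ENNReal.toReal_ofReal (by linarith)]
  rfl

/-- Blocks rather than single flags are needed: a term of a symmetric difference compares two
answers and so depends on two flags. -/
theorem noise_indepFun {S T : Finset (Sym2 V)} (hST : Disjoint S T) {X Y : (Sym2 V → Bool) → ℝ}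
    (hX : DependsOn X (S : Set (Sym2 V))) (hY : DependsOn Y (T : Set (Sym2 V))) :
    IndepFun X Y (noiseLaw V p h0 h1).toMeasure := by
  have h := (iIndepFun_noise (V := V) h0 h1).indepFun_finset S T hST
    (fun z => measurable_pi_apply z)
  obtain ⟨φ, rfl⟩ := dependsOn_iff_exists_comp.1 hX
  obtain ⟨ψ, rfl⟩ := dependsOn_iff_exists_comp.1 hY
  exact h.comp (φ := φ) (ψ := ψ) .of_discrete .of_discrete

/-- The sum of centred variables that depend on disjoint blocks of flags. -/
theorem hasSubgaussianMGF_sum {ι : Type*} {s : Finset ι} {B : ι → Finset (Sym2 V)}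
    (hB : (s : Set ι).PairwiseDisjoint B) {X : ι → (Sym2 V → Bool) → ℝ}
    (hX : ∀ i ∈ s, DependsOn (X i) (B i : Set (Sym2 V))) {a : ℝ}
    (ha : ∀ i ∈ s, ∀ ξ, X i ξ ∈ Set.Icc a (a + 1)) :
    HasSubgaussianMGF
      (fun ξ => ∑ i ∈ s, (X i ξ - ∫ ξ', X i ξ' ∂(noiseLaw V p h0 h1).toMeasure))
      (s.card * (1 / 4)) (noiseLaw V p h0 h1).toMeasure := by
  classical
  induction s using Finset.induction_on with
  | empty => simp
  | insert i s his ih =>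
    have hone : HasSubgaussianMGF
        (fun ξ => X i ξ - ∫ ξ', X i ξ' ∂(noiseLaw V p h0 h1).toMeasure) (1 / 4)
        (noiseLaw V p h0 h1).toMeasure := by
      have := hasSubgaussianMGF_of_mem_Icc (μ := (noiseLaw V p h0 h1).toMeasure) (X := X i)
        (a := a) (b := a + 1) Measurable.of_discrete.aemeasurable
        (ae_of_all _ (ha i (Finset.mem_insert_self i s)))
      convert this using 1
      rw [add_sub_cancel_left, nnnorm_one]
      norm_num
    have hrest := ih (hB.subset (by simp)) (fun j hj => hX j (Finset.mem_insert_of_mem hj))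
      (fun j hj => ha j (Finset.mem_insert_of_mem hj))
    have hind : IndepFun (fun ξ => X i ξ - ∫ ξ', X i ξ' ∂(noiseLaw V p h0 h1).toMeasure)
        (fun ξ => ∑ i ∈ s, (X i ξ - ∫ ξ', X i ξ' ∂(noiseLaw V p h0 h1).toMeasure))
        (noiseLaw V p h0 h1).toMeasure := by
      refine noise_indepFun h0 h1 (S := B i) (T := s.biUnion B) ?_ ?_ ?_
      · rw [Finset.disjoint_biUnion_right]
        intro j hj
        exact hB (by simp) (by simp [hj]) (by rintro rfl; exact his hj)
      · intro ξ ξ' h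
        simp only [hX i (Finset.mem_insert_self i s) h]
      · intro ξ ξ' h
        refine Finset.sum_congr rfl fun j hj => ?_
        rw [hX j (Finset.mem_insert_of_mem hj) fun z hz => h z
          (Finset.mem_coe.2 (Finset.mem_biUnion.2 ⟨j, hj, hz⟩))]
    have := hone.add_of_indepFun hrest hind
    rw [Finset.card_insert_of_notMem his]
    convert this using 1
    · funext ξ
      rw [Finset.sum_insert his]
    · push_cast
      ring

/-- **Hoeffding's inequality** for variables that depend on disjoint blocks of flags. -/
theorem noise_tail {ι : Type*} {s : Finset ι} {B : ι → Finset (Sym2 V)}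
    (hB : (s : Set ι).PairwiseDisjoint B) {X : ι → (Sym2 V → Bool) → ℝ}
    (hX : ∀ i ∈ s, DependsOn (X i) (B i : Set (Sym2 V))) {a : ℝ}
    (ha : ∀ i ∈ s, ∀ ξ, X i ξ ∈ Set.Icc a (a + 1)) {m : ι → ℝ}
    (hm : ∀ i ∈ s, ∫ ξ, X i ξ ∂(noiseLaw V p h0 h1).toMeasure = m i) {t N : ℝ} (ht : 0 ≤ t)
    (hN : s.card ≤ N) (hN0 : 0 < N) :
    (noiseLaw V p h0 h1).toOuterMeasure {ξ | t ≤ ∑ i ∈ s, X i ξ - ∑ i ∈ s, m i} ≤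
      ENNReal.ofReal (Real.exp (-(2 * t ^ 2 / N))) := by
  rw [← PMF.toMeasure_apply_eq_toOuterMeasure]
  -- For empty `s` the sub-Gaussian parameter is zero and the general bound degenerates to one; the
  -- event is then empty unless `t = 0`.
  rcases s.eq_empty_or_nonempty with rfl | hs
  · rcases ht.eq_or_lt with rfl | ht
    · refine prob_le_one.trans ?_
      simp
    · simp [not_le.2 ht]
  have h := (hasSubgaussianMGF_sum h0 h1 hB hX ha).measure_ge_le ht
  rw [← ofReal_measureReal]
  refine ENNReal.ofReal_le_ofReal ?_
  have heq : {ξ | t ≤ ∑ i ∈ s, X i ξ - ∑ i ∈ s, m i} =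
      {ξ | t ≤ ∑ i ∈ s, (X i ξ - ∫ ξ', X i ξ' ∂(noiseLaw V p h0 h1).toMeasure)} := by
    ext ξ
    rw [Set.mem_ofPred_eq, Set.mem_ofPred_eq, Finset.sum_sub_distrib, Finset.sum_congr rfl hm]
  rw [heq]
  refine h.trans (Real.exp_le_exp.2 ?_)
  have hc : (0 : ℝ) < s.card := by exact_mod_cast hs.card_pos
  push_cast
  rw [neg_div, neg_le_neg_iff, div_le_div_iff₀ hN0 (by positivity)]
  nlinarith [sq_nonneg t]

theorem noise_tail' {ι : Type*} {s : Finset ι} {B : ι → Finset (Sym2 V)}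
    (hB : (s : Set ι).PairwiseDisjoint B) {X : ι → (Sym2 V → Bool) → ℝ}
    (hX : ∀ i ∈ s, DependsOn (X i) (B i : Set (Sym2 V))) {a : ℝ}
    (ha : ∀ i ∈ s, ∀ ξ, X i ξ ∈ Set.Icc a (a + 1)) {m : ι → ℝ}
    (hm : ∀ i ∈ s, ∫ ξ, X i ξ ∂(noiseLaw V p h0 h1).toMeasure = m i) {t N : ℝ} (ht : 0 ≤ t)
    (hN : s.card ≤ N) (hN0 : 0 < N) :
    (noiseLaw V p h0 h1).toOuterMeasure {ξ | t ≤ ∑ i ∈ s, m i - ∑ i ∈ s, X i ξ} ≤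
      ENNReal.ofReal (Real.exp (-(2 * t ^ 2 / N))) := by
  have := noise_tail h0 h1 hB (X := fun i ξ => -X i ξ) (a := -(a + 1)) (m := fun i => -m i)
    (fun i hi ξ ξ' h => by simp only [hX i hi h])
    (fun i hi ξ => ⟨by linarith [(ha i hi ξ).2], by linarith [(ha i hi ξ).1]⟩)
    (fun i hi => by rw [integral_neg, hm i hi]) ht hN hN0
  convert this using 4
  rw [Finset.sum_neg_distrib, Finset.sum_neg_distrib, sub_neg_eq_add, neg_add_eq_sub]

theorem integral_flag (z : Sym2 V) :
    ∫ ξ, flag z ξ ∂(noiseLaw V p h0 h1).toMeasure = p := by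
  have := integral_comp_noise (V := V) h0 h1 (fun b => if b then 1 else 0) z
  simpa [flag] using this

theorem integral_xor_flag {z z' : Sym2 V} (h : z ≠ z') :
    ∫ ξ, (if xor (ξ z) (ξ z') then (1 : ℝ) else 0) ∂(noiseLaw V p h0 h1).toMeasure
      = 2 * p * (1 - p) := by
  have hind : IndepFun (flag z) (flag z') (noiseLaw V p h0 h1).toMeasure := by
    refine noise_indepFun h0 h1 (S := {z}) (T := {z'}) (by simpa using h) ?_ ?_
    · intro ξ ξ' h
      simp [flag, h z (by simp)]
    · intro ξ ξ' h
      simp [flag, h z' (by simp)]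
  have hmul := hind.integral_mul_eq_mul_integral
    (Measurable.of_discrete.aestronglyMeasurable) (Measurable.of_discrete.aestronglyMeasurable)
  have heq : (fun ξ : Sym2 V → Bool => if xor (ξ z) (ξ z') then (1 : ℝ) else 0) =
      fun ξ => flag z ξ + flag z' ξ - 2 * (flag z * flag z') ξ := by
    funext ξ
    cases h1 : ξ z <;> cases h2 : ξ z' <;> norm_num [flag, h1, h2]
  rw [heq, integral_sub .of_finite .of_finite, integral_add .of_finite .of_finite,
    integral_const_mul, hmul, integral_flag, integral_flag]
  ring

/-- The probability that at least half of the answers about distinct pairs are wrong. -/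
theorem noise_half_le {ι : Type*} {s : Finset ι} {z : ι → Sym2 V}
    (hz : Set.InjOn z s) (hp0 : 0 < p) (hp : p < 1 / 2) :
    (noiseLaw V p h0 h1).toOuterMeasure {ξ | s.card ≤ 2 * (s.filter fun i => ξ (z i) = true).card} ≤
      ENNReal.ofReal (Real.exp (-(s.card * bernoulliKL (1 / 2) p))) := by
  classical
  set P := (noiseLaw V p h0 h1).toMeasure with hP
  have hp1 : 0 < 1 - p := by linarith
  -- The optimal Chernoff parameter: the moment generating function of a flag becomes `2 (1 - p)`,
  -- and the bound at half the number of pairs is exactly the one with the divergence.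
  set t := Real.log ((1 - p) / p) with ht
  have ht0 : 0 ≤ t := Real.log_nonneg (by rw [le_div_iff₀ hp0]; linarith)
  have hexp : Real.exp t = (1 - p) / p := Real.exp_log (by positivity)
  rw [← PMF.toMeasure_apply_eq_toOuterMeasure, ← hP]
  have hind : iIndepFun (fun z : Sym2 V => flag z) P :=
    (iIndepFun_noise (V := V) h0 h1).comp (fun _ b => if b then (1 : ℝ) else 0)
      fun _ => .of_discrete
  have hmgf : ∀ z : Sym2 V, mgf (flag z) P t = 2 * (1 - p) := by
    intro z
    have := integral_comp_noise (V := V) h0 h1 (fun b => Real.exp (t * if b then 1 else 0)) z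
    rw [mgf]
    simp only [flag]
    rw [this]
    simp only [if_true, Bool.false_eq_true, if_false, mul_one, mul_zero, Real.exp_zero]
    rw [hexp]
    field_simp
    ring
  have hsum := hind.mgf_sum (t := t) (fun _ => Measurable.of_discrete) (s.image z)
  have hch := measure_ge_le_exp_mul_mgf (μ := P) (X := ∑ i ∈ s.image z, flag i)
    ((s.card : ℝ) / 2) ht0 .of_finite
  rw [hsum, Finset.prod_congr rfl fun z _ => hmgf z, Finset.prod_const,
    Finset.card_image_of_injOn hz] at hch
  rw [← ofReal_measureReal]
  refine ENNReal.ofReal_le_ofReal ?_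
  have heq : {ξ : Sym2 V → Bool | s.card ≤ 2 * (s.filter fun i => ξ (z i) = true).card} =
      {ξ | (s.card : ℝ) / 2 ≤ (∑ i ∈ s.image z, flag i) ξ} := by
    ext ξ
    have : (∑ i ∈ s.image z, flag i) ξ = ((s.filter fun i => ξ (z i) = true).card : ℝ) := by
      rw [Finset.sum_apply, Finset.sum_image hz]
      simp [flag]
    rw [Set.mem_ofPred_eq, Set.mem_ofPred_eq, this, div_le_iff₀ two_pos, mul_comm]
    exact_mod_cast Iff.rfl
  rw [heq]
  refine hch.trans (le_of_eq ?_)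
  have h2 : (2 * (1 - p)) ^ s.card = Real.exp (s.card * Real.log (2 * (1 - p))) := by
    rw [Real.exp_nat_mul, Real.exp_log (by positivity)]
  rw [h2, ← Real.exp_add, ht, bernoulliKL, Real.log_div hp1.ne' hp0.ne',
    Real.log_mul two_ne_zero hp1.ne', Real.log_div (by norm_num) hp0.ne',
    Real.log_div (by norm_num) hp1.ne']
  have h3 : Real.log (1 - 1 / 2) = - Real.log 2 := by
    rw [← Real.log_inv]
    norm_num
  have h4 : Real.log (1 / 2) = - Real.log 2 := by
    rw [← Real.log_inv]
    norm_num
  rw [h3, h4]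
  congr 1
  ring

/-- The noiseless case, where `bernoulliKL (1 / 2) p` is not the true divergence. Nonemptiness
matters: for empty `s` the event is everything. -/
theorem noise_half_eq_zero {ι : Type*} {s : Finset ι} {z : ι → Sym2 V} (hs : s.Nonempty)
    (hp0 : p = 0) :
    (noiseLaw V p h0 h1).toOuterMeasure
      {ξ | s.card ≤ 2 * (s.filter fun i => ξ (z i) = true).card} = 0 := by
  rw [PMF.toOuterMeasure_apply_eq_zero_iff, Set.disjoint_left]
  intro ξ hξ hξ'
  have hpos := hs.card_pos
  rw [Set.mem_ofPred_eq] at hξ'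
  obtain ⟨i, hi⟩ : (s.filter fun i => ξ (z i) = true).Nonempty := by
    rw [← Finset.card_pos]
    omega
  rw [Finset.mem_filter] at hi
  rw [PMF.mem_support_iff] at hξ
  refine hξ ?_
  change ∏ z, (if ξ z then ENNReal.ofReal p else ENNReal.ofReal (1 - p)) = 0
  exact Finset.prod_eq_zero (Finset.mem_univ (z i)) (by simp [hi.2, hp0])

end Noise

/-! ### One round of the clustering algorithm -/

section Parameters

/-- The unit `k log n / (1-2p)²` in which deviations are measured. -/
def msUnit (k n : ℕ) (p : ℝ) : ℝ := k * Real.log n / (1 - 2 * p) ^ 2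

variable {k n : ℕ} {p : ℝ}

theorem two_le_log (hn : 9 ≤ n) : 2 ≤ Real.log n := by
  rw [Real.le_log_iff_exp_le (by positivity)]
  have h1 := Real.exp_one_lt_d9
  have h2 : Real.exp 2 = Real.exp 1 * Real.exp 1 := by
    rw [← Real.exp_add]
    norm_num
  have h3 : (9 : ℝ) ≤ n := by exact_mod_cast hn
  have h4 := Real.exp_pos 1
  nlinarith

theorem two_mul_log_le_msUnit (hk : 2 ≤ k) (hn : 9 ≤ n) (hp0 : 0 ≤ p) (hp : p < 1 / 2) :
    2 * Real.log n ≤ msUnit k n p := by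
  have hL := two_le_log hn
  have hk' : (2 : ℝ) ≤ k := by exact_mod_cast hk
  have hq : 0 < 1 - 2 * p := by linarith
  rw [msUnit, le_div_iff₀ (by positivity)]
  have h1 : (1 - 2 * p) ^ 2 ≤ 1 := pow_le_one₀ hq.le (by linarith)
  have h2 : 2 * Real.log n ≤ k * Real.log n := by gcongr
  nlinarith

/-- With `X = msUnit` and `q = 1 - 2p` the thresholds become `T(a) = p a + 48 X / q` and `θ(a) =
2p(1-p) a + 16 X`, and the minimal cluster size is `64 X / q²`. -/
theorem sqrt_msScale_mul_log (hn : 9 ≤ n) (hp : p < 1 / 2) :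
    √(msScale k n p * Real.log n) = 8 * msUnit k n p := by
  have hL := two_le_log hn
  have hq : 0 < 1 - 2 * p := by linarith
  have : msScale k n p * Real.log n = (8 * msUnit k n p) ^ 2 := by
    rw [msScale, msUnit]
    field_simp
    ring
  rw [this, Real.sqrt_sq]
  rw [msUnit]
  positivity

theorem msMinSize_eq (hp : p < 1 / 2) : msMinSize k n p = 64 * msUnit k n p / (1 - 2 * p) ^ 2 := by
  have hq : 0 < 1 - 2 * p := by linarith
  rw [msMinSize, msUnit]
  field_simp

theorem msScale_eq : msScale k n p = k * msMinSize k n p := by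
  rw [msScale, msMinSize]
  ring

theorem msMinSize_pos (hk : 2 ≤ k) (hn : 9 ≤ n) (hp : p < 1 / 2) : 0 < msMinSize k n p := by
  have hL := two_le_log hn
  have hk' : (2 : ℝ) ≤ k := by exact_mod_cast hk
  have hq : 0 < 1 - 2 * p := by linarith
  rw [msMinSize]
  positivity

theorem msScale_nonneg (hk : 2 ≤ k) (hn : 9 ≤ n) (hp : p < 1 / 2) : 0 ≤ msScale k n p := by
  rw [msScale_eq]
  exact mul_nonneg (Nat.cast_nonneg _) (msMinSize_pos hk hn hp).le

/-- The Hoeffding exponent for a deviation `16 X - 2`. As `N log n = 64 X²`, it would be `8 log n`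
without the `-2` and the `+1` for the rounding of `N`; these corrections are paid by the drop from 8
to 6. -/
theorem ms_exp_le (hk : 2 ≤ k) (hn : 9 ≤ n) (hp0 : 0 ≤ p) (hp : p < 1 / 2) :
    Real.exp (-(2 * (16 * msUnit k n p - 2) ^ 2 / (msScale k n p + 1)))
      ≤ Real.exp (-(6 * Real.log n)) := by
  have hL := two_le_log hn
  have hX := two_mul_log_le_msUnit hk hn hp0 hp
  have hN := msScale_nonneg hk hn hp
  have hq : 0 < 1 - 2 * p := by linarith
  have hNL : msScale k n p * Real.log n = 64 * msUnit k n p ^ 2 := by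
    rw [msScale, msUnit]
    field_simp
  rw [Real.exp_le_exp, neg_le_neg_iff, le_div_iff₀ (by linarith)]
  nlinarith

theorem msVotes_le_of_msMinSize_le (hk : 2 ≤ k) (hn : 9 ≤ n) (hp0 : 0 ≤ p) (hp : p < 1 / 2) {c : ℕ}
    (hc : msMinSize k n p ≤ c) : msVotes n p ≤ c := by
  have hL := two_le_log hn
  have hk' : (2 : ℝ) ≤ k := by exact_mod_cast hk
  have hq : 0 < 1 - 2 * p := by linarith
  refine Nat.ceil_le.2 (le_trans ?_ hc)
  have h1 : (1 - 2 * p) ^ 2 ≤ 1 := pow_le_one₀ hq.le (by linarith)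
  rw [msMinSize, div_le_div_iff₀ (by positivity) (by positivity)]
  have h2 : (1 - 2 * p) ^ 4 ≤ (1 - 2 * p) ^ 2 := pow_le_pow_of_le_one hq.le (by linarith) (by norm_num)
  have h3 : 16 * Real.log n ≤ 64 * k * Real.log n := by nlinarith
  have h4 : 0 < (1 - 2 * p) ^ 2 := by positivity
  nlinarith

/-- With `v ≥ 16 log n / (1 - 2p)²` votes the exponent is `(1 - 2p)² v / 2 ≥ 8 log n`. -/
theorem msVotes_exp_le (hn : 9 ≤ n) (hp : p < 1 / 2) :
    Real.exp (-(2 * ((1 / 2 - p) * msVotes n p) ^ 2 / msVotes n p))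
      ≤ Real.exp (-(6 * Real.log n)) := by
  have hL := two_le_log hn
  have hq : 0 < 1 - 2 * p := by linarith
  have h1 : 16 * Real.log n / (1 - 2 * p) ^ 2 ≤ msVotes n p := Nat.le_ceil _
  have h2 : 0 < (msVotes n p : ℝ) := lt_of_lt_of_le (by positivity) h1
  rw [div_le_iff₀ (by positivity)] at h1
  rw [Real.exp_le_exp, neg_le_neg_iff, le_div_iff₀ h2]
  nlinarith

end Parameters

/-! ### Degrees and symmetric differences of noisy neighbourhoods -/

section Round

variable {V : Type*} [Fintype V] [DecidableEq V] {k : ℕ}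

/-- The part of the class `j` in `A`. -/
def classPart (f : V → Fin k) (A : Finset V) (j : Fin k) : Finset V := A.filter fun v => f v = j

theorem mem_classPart {f : V → Fin k} {A : Finset V} {j : Fin k} {v : V} :
    v ∈ classPart f A j ↔ v ∈ A ∧ f v = j := Finset.mem_filter

theorem oracleAnswer_comm (f : V → Fin k) (ξ : Sym2 V → Bool) (u v : V) :
    oracleAnswer f ξ u v = oracleAnswer f ξ v u := by
  rw [oracleAnswer, oracleAnswer, Sym2.eq_swap]
  simp only [eq_comm]

variable {p : ℝ} (h0 : 0 ≤ p) (h1 : p ≤ 1)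

open MeasureTheory in
theorem integral_answer (f : V → Fin k) (u w : V) :
    ∫ ξ, (if oracleAnswer f ξ u w = true then (1 : ℝ) else 0) ∂(noiseLaw V p h0 h1).toMeasure
      = p + (if f u = f w then 1 - 2 * p else 0) := by
  have := integral_comp_noise (V := V) h0 h1
    (fun b => if xor (decide (f u = f w)) b = true then 1 else 0) s(u, w)
  refine Eq.trans this ?_
  by_cases h : f u = f w <;> simp [h]
  ring

open MeasureTheory in
-- If exactly one of `u`, `v` is in the class of `w`, the answers differ unless exactly one of them
-- is wrong, with probability `1 - 2p(1-p) = 2p(1-p) + (1-2p)²`. The gap `(1-2p)²` is what tells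
-- classes apart.
theorem integral_answer_ne (f : V → Fin k) {u v w : V} (huv : u ≠ v) :
    ∫ ξ, (if oracleAnswer f ξ u w ≠ oracleAnswer f ξ v w then (1 : ℝ) else 0)
        ∂(noiseLaw V p h0 h1).toMeasure
      = 2 * p * (1 - p) + (if f u = f w ↔ f v = f w then 0 else (1 - 2 * p) ^ 2) := by
  have hne : s(u, w) ≠ s(v, w) := by
    intro h
    exact huv (Sym2.congr_left.1 h)
  have h := integral_xor_flag h0 h1 hne
  by_cases hiff : f u = f w ↔ f v = f w
  · rw [if_pos hiff, add_zero, ← h]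
    congr 1
    funext ξ
    simp only [oracleAnswer, hiff]
    cases ξ s(u, w) <;> cases ξ s(v, w) <;> simp
  · rw [if_neg hiff]
    have heq : (fun ξ : Sym2 V → Bool =>
        if oracleAnswer f ξ u w ≠ oracleAnswer f ξ v w then (1 : ℝ) else 0) =
        fun ξ => 1 - if xor (ξ s(u, w)) (ξ s(v, w)) then (1 : ℝ) else 0 := by
      funext ξ
      simp only [oracleAnswer]
      by_cases hu : f u = f w <;> by_cases hv : f v = f w
      · exact absurd (by simp [hu, hv]) hiff
      · simp only [hu, hv]
        cases ξ s(u, w) <;> cases ξ s(v, w) <;> simp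
      · simp only [hu, hv]
        cases ξ s(u, w) <;> cases ξ s(v, w) <;> simp
      · exact absurd (by simp [hu, hv]) hiff
    rw [heq, integral_sub .of_finite .of_finite, h]
    simp
    ring

/-! Deviations of degrees. -/

section Degree

variable (f : V → Fin k) {A : Finset V} {u : V}

theorem card_posNbrs (ξ : Sym2 V → Bool) :
    ((posNbrs (oracleAnswer f ξ) A u).card : ℝ) =
      ∑ w ∈ A.erase u, if oracleAnswer f ξ u w = true then (1 : ℝ) else 0 := by
  rw [Finset.sum_boole, Nat.cast_inj]
  congr 1
  ext w
  simp only [posNbrs, Finset.mem_filter, Finset.mem_erase]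
  tauto

theorem sum_answer_mean (hu : u ∈ A) :
    ∑ w ∈ A.erase u, (p + if f u = f w then 1 - 2 * p else 0) =
      p * (A.card - 1) + (1 - 2 * p) * ((classPart f A (f u)).card - 1) := by
  rw [Finset.sum_add_distrib, Finset.sum_const, nsmul_eq_mul, Finset.card_erase_of_mem hu,
    Nat.cast_pred (Finset.card_pos.2 ⟨u, hu⟩), ← Finset.sum_filter, Finset.sum_const, nsmul_eq_mul]
  have : ((A.erase u).filter fun w => f u = f w) = (classPart f A (f u)).erase u := by
    ext w
    simp only [Finset.mem_filter, Finset.mem_erase, mem_classPart, eq_comm (a := f u)]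
    tauto
  have hm : u ∈ classPart f A (f u) := mem_classPart.2 ⟨hu, rfl⟩
  rw [this, Finset.card_erase_of_mem hm, Nat.cast_pred (Finset.card_pos.2 ⟨u, hm⟩)]
  ring

theorem pairwiseDisjoint_pairs (S : Set V) (u : V) : S.PairwiseDisjoint
    fun w => ({s(u, w)} : Finset (Sym2 V)) := by
  intro w _ w' _ hne
  simp only [Function.onFun, Finset.disjoint_singleton]
  exact fun h => hne (Sym2.congr_right.1 h)

theorem degree_dependsOn (w : V) : DependsOn
    (fun ξ : Sym2 V → Bool => if oracleAnswer f ξ u w = true then (1 : ℝ) else 0)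
    (({s(u, w)} : Finset (Sym2 V)) : Set (Sym2 V)) := by
  intro ξ ξ' h
  have : oracleAnswer f ξ u w = oracleAnswer f ξ' u w := by
    rw [oracleAnswer, oracleAnswer, h s(u, w) (by simp)]
  simp only [this]

theorem degree_lower (hu : u ∈ A) {t N : ℝ} (ht : 0 ≤ t) (hN : A.card ≤ N) :
    (noiseLaw V p h0 h1).toOuterMeasure {ξ | ((posNbrs (oracleAnswer f ξ) A u).card : ℝ) + t ≤
      p * (A.card - 1) + (1 - 2 * p) * ((classPart f A (f u)).card - 1)} ≤
      ENNReal.ofReal (Real.exp (-(2 * t ^ 2 / N))) := by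
  have hA : (0 : ℝ) < A.card := by exact_mod_cast Finset.card_pos.2 ⟨u, hu⟩
  refine le_trans (MeasureTheory.measure_mono ?_) (noise_tail' h0 h1 (s := A.erase u) (pairwiseDisjoint_pairs _ u)
    (fun w _ => degree_dependsOn f w) (a := 0)
    (fun w _ ξ => by split_ifs <;> norm_num)
    (fun w _ => integral_answer h0 h1 f u w) ht (N := N)
    (le_trans (by exact_mod_cast Finset.card_le_card (Finset.erase_subset _ _)) hN)
    (lt_of_lt_of_le hA hN))
  intro ξ hξ
  rw [Set.mem_ofPred_eq] at hξ ⊢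
  rw [sum_answer_mean f hu, ← card_posNbrs f]
  linarith

theorem degree_upper (hu : u ∈ A) {t N : ℝ} (ht : 0 ≤ t) (hN : A.card ≤ N) :
    (noiseLaw V p h0 h1).toOuterMeasure {ξ |
      p * (A.card - 1) + (1 - 2 * p) * ((classPart f A (f u)).card - 1) + t ≤
      ((posNbrs (oracleAnswer f ξ) A u).card : ℝ)} ≤
      ENNReal.ofReal (Real.exp (-(2 * t ^ 2 / N))) := by
  have hA : (0 : ℝ) < A.card := by exact_mod_cast Finset.card_pos.2 ⟨u, hu⟩
  refine le_trans (MeasureTheory.measure_mono ?_) (noise_tail h0 h1 (s := A.erase u) (pairwiseDisjoint_pairs _ u)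
    (fun w _ => degree_dependsOn f w) (a := 0)
    (fun w _ ξ => by split_ifs <;> norm_num)
    (fun w _ => integral_answer h0 h1 f u w) ht (N := N)
    (le_trans (by exact_mod_cast Finset.card_le_card (Finset.erase_subset _ _)) hN)
    (lt_of_lt_of_le hA hN))
  intro ξ hξ
  rw [Set.mem_ofPred_eq] at hξ ⊢
  rw [sum_answer_mean f hu, ← card_posNbrs f]
  linarith

end Degree

/-! Deviations of symmetric differences. -/

section SymmDiff

variable (f : V → Fin k) {A : Finset V} {u v : V}

/-- The terms at `u` and `v` are governed by the same flag, that of the pair `u`, `v`, and would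
spoil the disjointness of the blocks. They contribute two together or nothing. -/
theorem card_symmDiff_posNbrs (hu : u ∈ A) (hv : v ∈ A) (huv : u ≠ v) (ξ : Sym2 V → Bool) :
    ((symmDiff (posNbrs (oracleAnswer f ξ) A u) (posNbrs (oracleAnswer f ξ) A v)).card : ℝ) =
      (∑ w ∈ (A.erase u).erase v,
        if oracleAnswer f ξ u w ≠ oracleAnswer f ξ v w then (1 : ℝ) else 0)
      + if oracleAnswer f ξ u v = true then 2 else 0 := by
  have hsplit : symmDiff (posNbrs (oracleAnswer f ξ) A u) (posNbrs (oracleAnswer f ξ) A v) =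
      ((A.erase u).erase v).filter (fun w => oracleAnswer f ξ u w ≠ oracleAnswer f ξ v w) ∪
        ({u, v} : Finset V).filter fun _ => oracleAnswer f ξ u v = true := by
    ext w
    simp only [posNbrs, Finset.mem_symmDiff, Finset.mem_union, Finset.mem_filter,
      Finset.mem_erase, Finset.mem_insert, Finset.mem_singleton]
    by_cases hwu : w = u
    · subst hwu
      simp [hu, huv, oracleAnswer_comm f ξ v w]
    · by_cases hwv : w = v
      · subst hwv
        simp [hv, hwu]
      · simp only [hwu, hwv, not_false_eq_true, true_and, ne_eq, false_and, or_false]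
        cases oracleAnswer f ξ u w <;> cases oracleAnswer f ξ v w <;> simp
  rw [hsplit, Finset.card_union_of_disjoint, Nat.cast_add, Finset.sum_boole]
  · congr 1
    by_cases h : oracleAnswer f ξ u v = true
    · simp [h, Finset.card_pair huv]
    · simp [h]
  · rw [Finset.disjoint_left]
    intro w hw hw'
    simp only [Finset.mem_filter, Finset.mem_erase, Finset.mem_insert,
      Finset.mem_singleton] at hw hw'
    tauto

theorem sum_answer_ne_mean_of_eq (hu : u ∈ A) (hv : v ∈ A) (huv : u ≠ v) (hf : f u = f v) :
    ∑ w ∈ (A.erase u).erase v,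
      (2 * p * (1 - p) + if f u = f w ↔ f v = f w then 0 else (1 - 2 * p) ^ 2) =
      2 * p * (1 - p) * (A.card - 2) := by
  have hv' : v ∈ A.erase u := Finset.mem_erase.2 ⟨huv.symm, hv⟩
  simp only [hf, if_true, add_zero, Finset.sum_const, nsmul_eq_mul]
  rw [Finset.card_erase_of_mem hv', Nat.cast_pred (Finset.card_pos.2 ⟨v, hv'⟩),
    Finset.card_erase_of_mem hu, Nat.cast_pred (Finset.card_pos.2 ⟨u, hu⟩)]
  ring

theorem sum_answer_ne_mean_of_ne (hu : u ∈ A) (hv : v ∈ A) (hf : f u ≠ f v) :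
    ∑ w ∈ (A.erase u).erase v,
      (2 * p * (1 - p) + if f u = f w ↔ f v = f w then 0 else (1 - 2 * p) ^ 2) =
      2 * p * (1 - p) * (A.card - 2) + (1 - 2 * p) ^ 2 *
        ((classPart f A (f u)).card + (classPart f A (f v)).card - 2) := by
  have huv : u ≠ v := fun h => hf (h ▸ rfl)
  have hv' : v ∈ A.erase u := Finset.mem_erase.2 ⟨huv.symm, hv⟩
  have hmu : u ∈ classPart f A (f u) := mem_classPart.2 ⟨hu, rfl⟩
  have hmv : v ∈ classPart f A (f v) := mem_classPart.2 ⟨hv, rfl⟩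
  rw [Finset.sum_add_distrib, Finset.sum_const, nsmul_eq_mul,
    Finset.card_erase_of_mem hv', Nat.cast_pred (Finset.card_pos.2 ⟨v, hv'⟩),
    Finset.card_erase_of_mem hu, Nat.cast_pred (Finset.card_pos.2 ⟨u, hu⟩)]
  simp_rw [← ite_not (p := f u = f _ ↔ f v = f _)]
  rw [← Finset.sum_filter, Finset.sum_const, nsmul_eq_mul]
  have : (((A.erase u).erase v).filter fun w => ¬ (f u = f w ↔ f v = f w)) =
      (classPart f A (f u)).erase u ∪ (classPart f A (f v)).erase v := by
    ext w
    simp only [Finset.mem_filter, Finset.mem_erase, mem_classPart, Finset.mem_union,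
      eq_comm (a := f w)]
    constructor
    · tauto
    · rintro (⟨h1, h2, h3⟩ | ⟨h1, h2, h3⟩)
      · have h4 : ¬ f v = f w := fun h => hf (h3.trans h.symm)
        refine ⟨⟨fun h => h4 (h ▸ rfl), h1, h2⟩, by tauto⟩
      · have h4 : ¬ f u = f w := fun h => hf (h.trans h3.symm)
        refine ⟨⟨h1, fun h => h4 (h ▸ rfl), h2⟩, by tauto⟩
  rw [this, Finset.card_union_of_disjoint, Finset.card_erase_of_mem hmu,
    Finset.card_erase_of_mem hmv, Nat.cast_add, Nat.cast_pred (Finset.card_pos.2 ⟨u, hmu⟩),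
    Nat.cast_pred (Finset.card_pos.2 ⟨v, hmv⟩)]
  · ring
  · rw [Finset.disjoint_left]
    intro w hw hw'
    simp only [Finset.mem_erase, mem_classPart] at hw hw'
    exact hf (hw.2.2.symm.trans hw'.2.2)

theorem symmDiff_blocks (huv : u ≠ v) : (((A.erase u).erase v : Finset V) : Set V).PairwiseDisjoint
    fun w => ({s(u, w), s(v, w)} : Finset (Sym2 V)) := by
  intro w hw w' hw' hne
  simp only [Finset.coe_erase, Set.mem_sdiff, Set.mem_singleton_iff] at hw hw'
  simp only [Function.onFun, Finset.disjoint_insert_left, Finset.disjoint_insert_right,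
    Finset.mem_insert, Finset.mem_singleton, Finset.disjoint_singleton_left, Sym2.eq_iff]
  grind

theorem symmDiff_dependsOn (w : V) : DependsOn
    (fun ξ : Sym2 V → Bool => if oracleAnswer f ξ u w ≠ oracleAnswer f ξ v w then (1 : ℝ) else 0)
    (({s(u, w), s(v, w)} : Finset (Sym2 V)) : Set (Sym2 V)) := by
  intro ξ ξ' h
  have h2 : oracleAnswer f ξ u w = oracleAnswer f ξ' u w := by
    rw [oracleAnswer, oracleAnswer, h s(u, w) (by simp)]
  have h3 : oracleAnswer f ξ v w = oracleAnswer f ξ' v w := by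
    rw [oracleAnswer, oracleAnswer, h s(v, w) (by simp)]
  simp only [h2, h3]

theorem symmDiff_upper (hu : u ∈ A) (hv : v ∈ A) (huv : u ≠ v) (hf : f u = f v) {t N : ℝ}
    (ht : 0 ≤ t) (hN : A.card ≤ N) :
    (noiseLaw V p h0 h1).toOuterMeasure {ξ | 2 * p * (1 - p) * (A.card - 2) + t + 2 ≤
      ((symmDiff (posNbrs (oracleAnswer f ξ) A u) (posNbrs (oracleAnswer f ξ) A v)).card : ℝ)} ≤
      ENNReal.ofReal (Real.exp (-(2 * t ^ 2 / N))) := by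
  have hA : (0 : ℝ) < A.card := by exact_mod_cast Finset.card_pos.2 ⟨u, hu⟩
  refine le_trans (MeasureTheory.measure_mono ?_)
    (noise_tail h0 h1 (symmDiff_blocks (A := A) huv)
    (fun w _ => symmDiff_dependsOn f w) (a := 0)
    (fun w _ ξ => by split_ifs <;> norm_num)
    (fun w _ => integral_answer_ne h0 h1 f huv) ht (N := N)
    (le_trans (by exact_mod_cast Finset.card_le_card ((Finset.erase_subset _ _).trans
      (Finset.erase_subset _ _))) hN)
    (lt_of_lt_of_le hA hN))
  intro ξ hξ
  rw [Set.mem_ofPred_eq] at hξ ⊢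
  rw [card_symmDiff_posNbrs f hu hv huv] at hξ
  rw [sum_answer_ne_mean_of_eq f hu hv huv hf]
  split_ifs at hξ <;> linarith

theorem symmDiff_lower (hu : u ∈ A) (hv : v ∈ A) (hf : f u ≠ f v) {t N : ℝ}
    (ht : 0 ≤ t) (hN : A.card ≤ N) :
    (noiseLaw V p h0 h1).toOuterMeasure {ξ |
      ((symmDiff (posNbrs (oracleAnswer f ξ) A u) (posNbrs (oracleAnswer f ξ) A v)).card : ℝ) + t ≤
      2 * p * (1 - p) * (A.card - 2) + (1 - 2 * p) ^ 2 *
        ((classPart f A (f u)).card + (classPart f A (f v)).card - 2)} ≤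
      ENNReal.ofReal (Real.exp (-(2 * t ^ 2 / N))) := by
  have huv : u ≠ v := fun h => hf (h ▸ rfl)
  have hA : (0 : ℝ) < A.card := by exact_mod_cast Finset.card_pos.2 ⟨u, hu⟩
  refine le_trans (MeasureTheory.measure_mono ?_)
    (noise_tail' h0 h1 (symmDiff_blocks (A := A) huv)
    (fun w _ => symmDiff_dependsOn f w) (a := 0)
    (fun w _ ξ => by split_ifs <;> norm_num)
    (fun w _ => integral_answer_ne h0 h1 f huv) ht (N := N)
    (le_trans (by exact_mod_cast Finset.card_le_card ((Finset.erase_subset _ _).trans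
      (Finset.erase_subset _ _))) hN)
    (lt_of_lt_of_le hA hN))
  intro ξ hξ
  rw [Set.mem_ofPred_eq] at hξ ⊢
  rw [card_symmDiff_posNbrs f hu hv huv] at hξ
  rw [sum_answer_ne_mean_of_ne f hu hv hf]
  split_ifs at hξ <;> linarith

end SymmDiff

/-- A majority of wrong answers about `v` and the members of a set is unlikely. -/
theorem wrong_majority (v : V) {S : Finset V} (hS : S.Nonempty) (hp : p < 1 / 2) :
    (noiseLaw V p h0 h1).toOuterMeasure
      {ξ | S.card ≤ 2 * (S.filter fun u => ξ s(v, u) = true).card} ≤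
      ENNReal.ofReal (Real.exp (-(2 * ((1 / 2 - p) * S.card) ^ 2 / S.card))) := by
  have hc : (0 : ℝ) < S.card := by exact_mod_cast hS.card_pos
  refine le_trans (MeasureTheory.measure_mono ?_)
    (noise_tail h0 h1 (s := S) (pairwiseDisjoint_pairs _ v) (X := fun u => flag s(v, u))
      (fun u _ ξ ξ' h => by simp only [flag, h s(v, u) (by simp)]) (a := 0)
      (fun u _ ξ => by unfold flag; split_ifs <;> norm_num)
      (fun u _ => integral_flag h0 h1 s(v, u)) (t := (1 / 2 - p) * S.card)
      (mul_nonneg (by linarith) hc.le) le_rfl hc)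
  intro ξ hξ
  rw [Set.mem_ofPred_eq] at hξ ⊢
  simp only [flag, Finset.sum_boole, Finset.sum_const, nsmul_eq_mul]
  have : (S.card : ℝ) ≤ 2 * ((S.filter fun u => ξ s(v, u) = true).card : ℝ) := by
    exact_mod_cast hξ
  linarith

end Round

/-! ### The good event of a round -/

section RoundEvent

variable {V : Type*} [Fintype V] [DecidableEq V] {k : ℕ} {p : ℝ}

/-- The answers that make a round with working set `A` and outside points `B` work as intended. -/
structure RoundGood (f : V → Fin k) (n : ℕ) (p : ℝ) (R : PickRule V) (A B : Finset V)
    (ξ : Sym2 V → Bool) : Prop where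
  mem_good : ∀ u ∈ A, msMinSize k n p ≤ (classPart f A (f u)).card →
    u ∈ msGood k n p (oracleAnswer f ξ) A
  -- Weaker than a converse of `mem_good`: a class of intermediate size may be good in part, but it
  -- is still large enough for `dissimilar`.
  of_good : ∀ u ∈ A, u ∈ msGood k n p (oracleAnswer f ξ) A →
    24 * msUnit k n p / (1 - 2 * p) ^ 2 ≤ (classPart f A (f u)).card
  similar : ∀ u ∈ A, ∀ v ∈ A, u ≠ v → f u = f v →
    ((symmDiff (posNbrs (oracleAnswer f ξ) A u) (posNbrs (oracleAnswer f ξ) A v)).card : ℝ) ≤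
      msDiffThreshold k n p A.card
  dissimilar : ∀ u ∈ A, ∀ v ∈ A, f u ≠ f v →
    24 * msUnit k n p / (1 - 2 * p) ^ 2 ≤ (classPart f A (f u)).card →
    24 * msUnit k n p / (1 - 2 * p) ^ 2 ≤ (classPart f A (f v)).card →
    msDiffThreshold k n p A.card <
      ((symmDiff (posNbrs (oracleAnswer f ξ) A u) (posNbrs (oracleAnswer f ξ) A v)).card : ℝ)
  vote : ∀ v ∈ B, ∀ j, msMinSize k n p ≤ (classPart f A j).card →
    (msAccepts n p R (oracleAnswer f ξ) v (classPart f A j) = true ↔ f v = j)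

variable {n : ℕ} {f : V → Fin k} {R : PickRule V} {A B : Finset V} {ξ : Sym2 V → Bool}

theorem msGood_subset (ans : V → V → Bool) : msGood k n p ans A ⊆ A := Finset.filter_subset _ _

namespace RoundGood

/-- Good points of one class are pairwise adjacent and no edge joins different classes, so the
components are the good parts of classes. -/
theorem reachable_iff (h : RoundGood f n p R A B ξ) {u v : V}
    (hu : u ∈ msGood k n p (oracleAnswer f ξ) A) (hv : v ∈ msGood k n p (oracleAnswer f ξ) A) :
    (msSimilar k n p (oracleAnswer f ξ) A).Reachable u v ↔ f u = f v := by
  constructor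
  · rintro ⟨P⟩
    clear hu hv
    induction P with
    | nil => rfl
    | @cons a b c hadj _ ih =>
      rw [← ih]
      by_contra hne
      have key : ∀ {x y : V}, f x ≠ f y → ¬ (x ∈ msGood k n p (oracleAnswer f ξ) A ∧
          y ∈ msGood k n p (oracleAnswer f ξ) A ∧
          ((symmDiff (posNbrs (oracleAnswer f ξ) A x) (posNbrs (oracleAnswer f ξ) A y)).card : ℝ)
            ≤ msDiffThreshold k n p A.card) := by
        rintro x y hxy ⟨hx, hy, hle⟩
        have hxA := msGood_subset _ hx
        have hyA := msGood_subset _ hy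
        exact absurd hle (not_le.2 (h.dissimilar x hxA y hyA hxy (h.of_good x hxA hx)
          (h.of_good y hyA hy)))
      rw [msSimilar, SimpleGraph.fromRel_adj] at hadj
      rcases hadj.2 with h' | h'
      · exact key hne h'
      · exact key (Ne.symm hne) h'
  · intro huv
    by_cases hne : u = v
    · rw [hne]
    · refine SimpleGraph.Adj.reachable ?_
      rw [msSimilar, SimpleGraph.fromRel_adj]
      exact ⟨hne, Or.inl ⟨hu, hv, h.similar u (msGood_subset _ hu) v (msGood_subset _ hv) hne huv⟩⟩

/-- In a good round the active clusters are exactly the large classes of the working set. -/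
theorem msActive_eq (h : RoundGood f n p R A B ξ) (hpos : 0 < msMinSize k n p) :
    msActive k n p (oracleAnswer f ξ) A =
      (((Finset.univ.filter fun j => msMinSize k n p ≤ (classPart f A j).card).image
        (classPart f A)).toList) := by
  classical
  rw [msActive]
  congr 1
  have hcomp : ∀ u ∈ msGood k n p (oracleAnswer f ξ) A,
      ((msGood k n p (oracleAnswer f ξ) A).filter fun v =>
        (msSimilar k n p (oracleAnswer f ξ) A).Reachable u v) =
      (msGood k n p (oracleAnswer f ξ) A).filter fun v => f v = f u := by
    intro u hu
    refine Finset.filter_congr fun v hv => ?_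
    rw [h.reachable_iff hu hv, eq_comm]
  -- Large classes are good in full. The good part of a smaller class is too small to become active.
  have hfull : ∀ j, msMinSize k n p ≤ (classPart f A j).card →
      ((msGood k n p (oracleAnswer f ξ) A).filter fun v => f v = j) = classPart f A j := by
    intro j hj
    ext v
    rw [Finset.mem_filter, mem_classPart]
    constructor
    · rintro ⟨hv, rfl⟩
      exact ⟨msGood_subset _ hv, rfl⟩
    · rintro ⟨hv, rfl⟩
      exact ⟨h.mem_good v hv hj, rfl⟩
  ext S
  simp only [Finset.mem_filter, Finset.mem_image, Finset.mem_univ, true_and]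
  constructor
  · rintro ⟨⟨u, hu, rfl⟩, hS⟩
    have hle : msMinSize k n p ≤ (classPart f A (f u)).card := by
      refine hS.trans ?_
      rw [hcomp u hu]
      exact_mod_cast Finset.card_le_card (Finset.filter_subset_filter _ (msGood_subset _))
    exact ⟨f u, hle, by rw [← hfull _ hle, ← hcomp u hu]⟩
  · rintro ⟨j, hj, rfl⟩
    refine ⟨?_, hj⟩
    have hcard : 0 < (classPart f A j).card := by
      have := hpos.trans_le hj
      exact_mod_cast this
    obtain ⟨u, hu⟩ := Finset.card_pos.1 hcard
    obtain ⟨huA, rfl⟩ := mem_classPart.1 hu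
    have hug := h.mem_good u huA hj
    exact ⟨u, hug, by rw [hcomp u hug, hfull _ hj]⟩

end RoundGood

variable (h0 : 0 ≤ p) (h1 : p ≤ 1)

/-- A union bound over at most `5 n²` events of probability at most `n⁻⁶` each. The sets `A` and `B`
are fixed and do not depend on the noise. -/
theorem not_roundGood_le (hk : 2 ≤ k) (hn : 9 ≤ n) (hkn : k ≤ n) (hp : p < 1 / 2)
    (hA : A.card ≤ ⌈msScale k n p⌉₊) (hAn : A.card ≤ n) (hBn : B.card ≤ n) :
    (noiseLaw V p h0 h1).toOuterMeasure {ξ | ¬ RoundGood f n p R A B ξ} ≤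
      ENNReal.ofReal (5 * (n : ℝ) ^ 2 * Real.exp (-(6 * Real.log n))) := by
  set P := (noiseLaw V p h0 h1).toOuterMeasure with hP
  set ε := ENNReal.ofReal (Real.exp (-(6 * Real.log n))) with hε
  have hL := two_le_log hn
  have hX := two_mul_log_le_msUnit hk hn h0 hp
  have hN := msScale_nonneg hk hn hp
  have hsqrt := sqrt_msScale_mul_log (k := k) hn hp
  have hmin := msMinSize_eq (k := k) (n := n) hp
  have hq : 0 < 1 - 2 * p := by linarith
  have hq2 : 0 < (1 - 2 * p) ^ 2 := by positivity
  have hAN : (A.card : ℝ) ≤ msScale k n p + 1 :=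
    le_trans (by exact_mod_cast hA) (Nat.ceil_lt_add_one hN).le
  have hexp : ENNReal.ofReal (Real.exp (-(2 * (16 * msUnit k n p - 2) ^ 2 / (msScale k n p + 1))))
      ≤ ε := ENNReal.ofReal_le_ofReal (ms_exp_le hk hn h0 hp)
  have ht : 0 ≤ 16 * msUnit k n p - 2 := by linarith
  have hT : msDegreeThreshold k n p A.card = p * A.card + 48 * (msUnit k n p / (1 - 2 * p)) := by
    rw [msDegreeThreshold, hsqrt]
    ring
  have hθ : msDiffThreshold k n p A.card = 2 * p * (1 - p) * A.card + 16 * msUnit k n p := by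
    rw [msDiffThreshold, hsqrt]
    ring
  have hXq : msUnit k n p ≤ msUnit k n p / (1 - 2 * p) := by
    rw [le_div_iff₀ hq]
    nlinarith
  have heq : ∀ a : ℝ, (1 - 2 * p) * (a * msUnit k n p / (1 - 2 * p) ^ 2) =
      a * (msUnit k n p / (1 - 2 * p)) := by
    intro a
    field_simp
  have hempty : ∀ {s : Set (Sym2 V → Bool)}, s = ∅ → P s ≤ ε := by
    rintro s rfl
    rw [MeasureTheory.measure_empty]
    exact zero_le
  have hc2 : ∀ {c a : ℝ}, a * msUnit k n p / (1 - 2 * p) ^ 2 ≤ c →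
      a * (msUnit k n p / (1 - 2 * p)) ≤ (1 - 2 * p) * c := by
    intro c a h
    rw [← heq]
    exact mul_le_mul_of_nonneg_left h hq.le
  have hc3 : ∀ {c a : ℝ}, c ≤ a * msUnit k n p / (1 - 2 * p) ^ 2 →
      (1 - 2 * p) * c ≤ a * (msUnit k n p / (1 - 2 * p)) := by
    intro c a h
    rw [← heq]
    exact mul_le_mul_of_nonneg_left h hq.le
  -- The mean degree is at least `p a + 64 X / q - 1`, against the threshold `p a + 48 X / q`.
  have b1 : ∀ u ∈ A, P {ξ | ¬ (msMinSize k n p ≤ (classPart f A (f u)).card →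
      u ∈ msGood k n p (oracleAnswer f ξ) A)} ≤ ε := by
    intro u hu
    refine le_trans (MeasureTheory.measure_mono ?_)
      ((degree_lower h0 h1 f hu ht hAN).trans hexp)
    intro ξ hξ
    rw [Set.mem_ofPred_eq, Classical.not_imp, msGood, Finset.mem_filter, not_and, not_le] at hξ
    obtain ⟨hc, hlt⟩ := hξ
    have hlt := hlt hu
    rw [hT] at hlt
    rw [hmin] at hc
    have := hc2 hc
    rw [Set.mem_ofPred_eq]
    linarith
  -- The mean degree is at most `p a + 24 X / q`, which falls short of the threshold by `24 X / q ≥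
  -- 16 X`.
  have b2 : ∀ u ∈ A, P {ξ | ¬ (u ∈ msGood k n p (oracleAnswer f ξ) A →
      24 * msUnit k n p / (1 - 2 * p) ^ 2 ≤ (classPart f A (f u)).card)} ≤ ε := by
    intro u hu
    refine le_trans (MeasureTheory.measure_mono ?_)
      ((degree_upper h0 h1 f hu ht hAN).trans hexp)
    intro ξ hξ
    rw [Set.mem_ofPred_eq, Classical.not_imp, msGood, Finset.mem_filter, not_le, hT] at hξ
    obtain ⟨⟨-, hge⟩, hlt⟩ := hξ
    have := hc3 hlt.le
    rw [Set.mem_ofPred_eq]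
    linarith
  -- The deviation `16 X - 2` plus the two possible contributions of `u` and `v` themselves makes up
  -- the margin `16 X` of the threshold.
  have b3 : ∀ x ∈ A ×ˢ A, P {ξ | ¬ (x.1 ≠ x.2 → f x.1 = f x.2 →
      ((symmDiff (posNbrs (oracleAnswer f ξ) A x.1) (posNbrs (oracleAnswer f ξ) A x.2)).card : ℝ) ≤
      msDiffThreshold k n p A.card)} ≤ ε := by
    rintro ⟨u, v⟩ hx
    rw [Finset.mem_product] at hx
    by_cases hc : u ≠ v ∧ f u = f v
    · refine le_trans (MeasureTheory.measure_mono ?_)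
        ((symmDiff_upper h0 h1 f hx.1 hx.2 hc.1 hc.2 ht hAN).trans hexp)
      intro ξ hξ
      rw [Set.mem_ofPred_eq, Classical.not_imp, Classical.not_imp, not_le, hθ] at hξ
      rw [Set.mem_ofPred_eq]
      have : 0 ≤ 2 * p * (1 - p) := by nlinarith
      linarith [hξ.2.2]
    · refine hempty (Set.eq_empty_iff_forall_notMem.2 fun ξ => ?_)
      simp only [Set.mem_ofPred_eq, not_not]
      exact fun h h' => absurd ⟨h, h'⟩ hc
  -- Two classes of size at least `24 X / q²` raise the mean by about `48 X`, of which the threshold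
  -- takes `16 X`; the remaining `32 X` exceed the deviation.
  have b4 : ∀ x ∈ A ×ˢ A, P {ξ | ¬ (f x.1 ≠ f x.2 →
      24 * msUnit k n p / (1 - 2 * p) ^ 2 ≤ (classPart f A (f x.1)).card →
      24 * msUnit k n p / (1 - 2 * p) ^ 2 ≤ (classPart f A (f x.2)).card →
      msDiffThreshold k n p A.card < ((symmDiff (posNbrs (oracleAnswer f ξ) A x.1)
        (posNbrs (oracleAnswer f ξ) A x.2)).card : ℝ))} ≤ ε := by
    rintro ⟨u, v⟩ hx
    rw [Finset.mem_product] at hx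
    by_cases hc : f u ≠ f v
    · refine le_trans (MeasureTheory.measure_mono ?_)
        ((symmDiff_lower h0 h1 f hx.1 hx.2 hc ht hAN).trans hexp)
      intro ξ hξ
      rw [Set.mem_ofPred_eq, Classical.not_imp, Classical.not_imp, Classical.not_imp, not_lt,
        hθ] at hξ
      obtain ⟨-, hcu, hcv, hle⟩ := hξ
      rw [div_le_iff₀ hq2] at hcu hcv
      rw [Set.mem_ofPred_eq]
      nlinarith
    · refine hempty (Set.eq_empty_iff_forall_notMem.2 fun ξ => ?_)
      simp only [Set.mem_ofPred_eq, not_not]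
      exact fun h => absurd h hc
  -- All picked members belong to class `j`, so a wrong verdict needs wrong answers from at least
  -- half of them.
  have b5 : ∀ x ∈ B ×ˢ (Finset.univ : Finset (Fin k)), P {ξ | ¬ (
      msMinSize k n p ≤ (classPart f A x.2).card →
      (msAccepts n p R (oracleAnswer f ξ) x.1 (classPart f A x.2) = true ↔ f x.1 = x.2))} ≤ ε := by
    rintro ⟨v, j⟩ hx
    rw [Finset.mem_product] at hx
    by_cases hc : msMinSize k n p ≤ (classPart f A j).card
    · have hcard : (R.pick (classPart f A j) (msVotes n p)).card = msVotes n p := by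
        rw [R.card_pick, min_eq_left]
        exact msVotes_le_of_msMinSize_le hk hn h0 hp hc
      have hpos : 0 < msVotes n p := Nat.ceil_pos.2 (by positivity)
      have hne : (R.pick (classPart f A j) (msVotes n p)).Nonempty := by
        rw [← Finset.card_pos, hcard]
        exact hpos
      have hw := wrong_majority h0 h1 v hne hp
      refine le_trans (MeasureTheory.measure_mono ?_) (hw.trans ?_)
      · intro ξ hξ
        rw [Set.mem_ofPred_eq, Classical.not_imp, msAccepts, decide_eq_true_eq] at hξ
        obtain ⟨-, hξ⟩ := hξ
        rw [Set.mem_ofPred_eq]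
        by_contra hlt
        rw [not_le] at hlt
        apply hξ
        have hsub := R.pick_subset (classPart f A j) (msVotes n p)
        have hans : ∀ u ∈ R.pick (classPart f A j) (msVotes n p),
            oracleAnswer f ξ v u = xor (decide (f v = j)) (ξ s(v, u)) := by
          intro u hu
          rw [oracleAnswer, (mem_classPart.1 (hsub hu)).2]
        rw [Finset.filter_congr fun u hu => by rw [hans u hu]]
        by_cases hv : f v = j
        · simp only [hv, decide_true, Bool.true_xor, Bool.not_eq_true', iff_true]
          have := Finset.card_filter_add_card_filter_not
            (s := R.pick (classPart f A j) (msVotes n p)) (fun u => ξ s(v, u) = true)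
          simp only [Bool.not_eq_true] at this
          omega
        · simp only [hv, decide_false, Bool.false_xor, iff_false, not_lt]
          exact hlt.le
      · rw [hcard]
        exact ENNReal.ofReal_le_ofReal (msVotes_exp_le hn hp)
    · refine hempty (Set.eq_empty_iff_forall_notMem.2 fun ξ => ?_)
      simp only [Set.mem_ofPred_eq, not_not]
      exact fun h => absurd h hc
  have hsub : {ξ | ¬ RoundGood f n p R A B ξ} ⊆
      (⋃ u ∈ A, {ξ | ¬ (msMinSize k n p ≤ (classPart f A (f u)).card →
        u ∈ msGood k n p (oracleAnswer f ξ) A)}) ∪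
      (⋃ u ∈ A, {ξ | ¬ (u ∈ msGood k n p (oracleAnswer f ξ) A →
        24 * msUnit k n p / (1 - 2 * p) ^ 2 ≤ (classPart f A (f u)).card)}) ∪
      (⋃ x ∈ A ×ˢ A, {ξ | ¬ (x.1 ≠ x.2 → f x.1 = f x.2 →
        ((symmDiff (posNbrs (oracleAnswer f ξ) A x.1) (posNbrs (oracleAnswer f ξ) A x.2)).card : ℝ)
        ≤ msDiffThreshold k n p A.card)}) ∪
      (⋃ x ∈ A ×ˢ A, {ξ | ¬ (f x.1 ≠ f x.2 →
        24 * msUnit k n p / (1 - 2 * p) ^ 2 ≤ (classPart f A (f x.1)).card →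
        24 * msUnit k n p / (1 - 2 * p) ^ 2 ≤ (classPart f A (f x.2)).card →
        msDiffThreshold k n p A.card < ((symmDiff (posNbrs (oracleAnswer f ξ) A x.1)
          (posNbrs (oracleAnswer f ξ) A x.2)).card : ℝ))}) ∪
      (⋃ x ∈ B ×ˢ (Finset.univ : Finset (Fin k)), {ξ | ¬ (
        msMinSize k n p ≤ (classPart f A x.2).card →
        (msAccepts n p R (oracleAnswer f ξ) x.1 (classPart f A x.2) = true ↔ f x.1 = x.2))}) := by
    intro ξ hξ
    by_contra hno
    simp only [Set.mem_union, Set.mem_iUnion, not_or, not_exists, Set.mem_ofPred_eq, not_not,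
      Finset.mem_product, Finset.mem_univ, and_true] at hno
    obtain ⟨⟨⟨⟨h1, h2⟩, h3⟩, h4⟩, h5⟩ := hno
    exact hξ ⟨h1, h2, fun u hu v hv => h3 (u, v) ⟨hu, hv⟩, fun u hu v hv => h4 (u, v) ⟨hu, hv⟩,
      fun v hv j => h5 (v, j) hv⟩
  have hbU : ∀ {α : Type _} (s : Finset α) (F : α → Set (Sym2 V → Bool)),
      (∀ x ∈ s, P (F x) ≤ ε) → P (⋃ x ∈ s, F x) ≤ s.card * ε := by
    intro α s F hF
    refine (MeasureTheory.measure_biUnion_finset_le s F).trans ?_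
    refine (Finset.sum_le_sum hF).trans ?_
    rw [Finset.sum_const, nsmul_eq_mul]
  refine (MeasureTheory.measure_mono hsub).trans ?_
  have hu2 : ∀ {s t : Set (Sym2 V → Bool)} {a b : ℝ≥0∞}, P s ≤ a → P t ≤ b → P (s ∪ t) ≤ a + b :=
    fun h h' => (MeasureTheory.measure_union_le _ _).trans (add_le_add h h')
  refine (hu2 (hu2 (hu2 (hu2 (hbU A _ b1) (hbU A _ b2)) (hbU _ _ b3)) (hbU _ _ b4))
    (hbU _ _ b5)).trans ?_
  rw [Finset.card_product, Finset.card_product, Finset.card_univ, Fintype.card_fin,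
    ← add_mul, ← add_mul, ← add_mul, ← add_mul, ENNReal.ofReal_mul (by positivity), ← hε]
  refine mul_le_mul_left ?_ _
  have : A.card + A.card + A.card * A.card + A.card * A.card + B.card * k ≤ 5 * n ^ 2 := by
    have e1 : A.card * A.card ≤ n * n := Nat.mul_le_mul hAn hAn
    have e2 : B.card * k ≤ n * n := Nat.mul_le_mul hBn hkn
    nlinarith
  calc _ = ((A.card + A.card + A.card * A.card + A.card * A.card + B.card * k : ℕ) : ℝ≥0∞) := by
        push_cast
        rfl
    _ ≤ ((5 * n ^ 2 : ℕ) : ℝ≥0∞) := by exact_mod_cast this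
    _ = _ := by
        rw [← ENNReal.ofReal_natCast]
        push_cast
        rfl

end RoundEvent

/-! ### The run of the clustering algorithm -/

section Run

variable {V : Type*} [Fintype V] [DecidableEq V] {k : ℕ} {p : ℝ}

/-- The pairs of distinct members of `A`. -/
def pairsOf (A : Finset V) : Finset (Sym2 V) := A.offDiag.image fun x => s(x.1, x.2)

theorem pairsOf_mono {A B : Finset V} (h : A ⊆ B) : pairsOf A ⊆ pairsOf B :=
  Finset.image_subset_image (Finset.offDiag_mono h)

theorem pairsOf_union_subset (A B : Finset V) :
    pairsOf (A ∪ B) ⊆ pairsOf A ∪ (B ×ˢ (A ∪ B)).image fun x => s(x.1, x.2) := by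
  intro z hz
  simp only [pairsOf, Finset.mem_image, Finset.mem_offDiag, Finset.mem_union,
    Finset.mem_product] at hz ⊢
  obtain ⟨⟨x, y⟩, ⟨hx, hy, hne⟩, rfl⟩ := hz
  rcases hx with hx | hx
  · rcases hy with hy | hy
    · exact Or.inl ⟨(x, y), ⟨hx, hy, hne⟩, rfl⟩
    · exact Or.inr ⟨(y, x), ⟨hy, Or.inl hx⟩, Sym2.eq_swap⟩
  · exact Or.inr ⟨(x, y), ⟨hx, hy⟩, rfl⟩

/-- The classes that have become large in the working set `A`. -/
def largeClasses (f : V → Fin k) (n : ℕ) (p : ℝ) (A : Finset V) : Finset (Fin k) :=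
  open scoped Classical in
  Finset.univ.filter fun j => msMinSize k n p ≤ (classPart f A j).card

theorem mem_largeClasses {f : V → Fin k} {n : ℕ} {A : Finset V} {j : Fin k} :
    j ∈ largeClasses f n p A ↔ msMinSize k n p ≤ (classPart f A j).card := by
  simp [largeClasses]

/-- The state is as it should be when exactly the classes in `J` have not been output. -/
structure IsValid (f : V → Fin k) (n : ℕ) (p : ℝ) (W : Finset V) (J : Finset (Fin k))
    (s : MSState V) : Prop where
  disj : Disjoint s.rest s.cur
  union : s.rest ∪ s.cur = W.filter fun v => f v ∈ J
  cur_le : s.cur.card ≤ ⌈msScale k n p⌉₊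
  out : ∀ S, S ∈ s.out ↔ ∃ j, j ∉ J ∧ S = classPart f W j
  pairs : pairsOf s.cur ⊆ s.asked
  -- Amortised count: a point that leaves `rest` pays for `⌈N⌉` pairs in the working set, and a
  -- class that leaves `J` pays for the votes about it.
  asked : s.asked.card + s.rest.card * ⌈msScale k n p⌉₊ + J.card * (W.card * msVotes n p) ≤
    W.card * ⌈msScale k n p⌉₊ + k * (W.card * msVotes n p)

/-- The final state is as it should be. -/
structure IsFinal (f : V → Fin k) (n : ℕ) (p : ℝ) (W : Finset V) (s : MSState V) : Prop where
  out : ∀ S, S ∈ s.out ↔ ∃ j, S = classPart f W j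
  asked : s.asked.card ≤ W.card * ⌈msScale k n p⌉₊ + k * (W.card * msVotes n p)

variable {f : V → Fin k} {n : ℕ} {W : Finset V} {J : Finset (Fin k)} {s : MSState V}
  {R : PickRule V}

theorem msActive_eq_nil_iff {A B : Finset V} {ξ : Sym2 V → Bool}
    (h : RoundGood f n p R A B ξ) (hpos : 0 < msMinSize k n p) :
    msActive k n p (oracleAnswer f ξ) A = [] ↔ largeClasses f n p A = ∅ := by
  rw [h.msActive_eq hpos, Finset.toList_eq_nil, Finset.image_eq_empty]
  rfl

theorem mem_msActive {A B : Finset V} {ξ : Sym2 V → Bool}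
    (h : RoundGood f n p R A B ξ) (hpos : 0 < msMinSize k n p) {S : Finset V} :
    S ∈ msActive k n p (oracleAnswer f ξ) A ↔
      ∃ j ∈ largeClasses f n p A, classPart f A j = S := by
  rw [h.msActive_eq hpos, Finset.mem_toList, Finset.mem_image]
  rfl

theorem classPart_nonempty {A : Finset V} (hpos : 0 < msMinSize k n p) {j : Fin k}
    (hj : j ∈ largeClasses f n p A) : (classPart f A j).Nonempty := by
  rw [mem_largeClasses] at hj
  rw [← Finset.card_pos]
  exact_mod_cast hpos.trans_le hj

theorem classPart_inj {A : Finset V} (hpos : 0 < msMinSize k n p) {j j' : Fin k}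
    (hj : j ∈ largeClasses f n p A) (h : classPart f A j = classPart f A j') : j = j' := by
  obtain ⟨v, hv⟩ := classPart_nonempty hpos hj
  have hv' := hv
  rw [h] at hv'
  exact (mem_classPart.1 hv).2.symm.trans (mem_classPart.1 hv').2

theorem accepts_iff {A B : Finset V} {ξ : Sym2 V → Bool}
    (h : RoundGood f n p R A B ξ) {v : V} (hv : v ∈ B) {j : Fin k}
    (hj : j ∈ largeClasses f n p A) :
    msAccepts n p R (oracleAnswer f ξ) v (classPart f A j) = true ↔ f v = j :=
  h.vote v hv j (mem_largeClasses.1 hj)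

/-- Only the cluster of its own class accepts an outside point, so the order of the list is
immaterial. -/
theorem find?_accepts {A B : Finset V} {ξ : Sym2 V → Bool}
    (h : RoundGood f n p R A B ξ) (hpos : 0 < msMinSize k n p) {v : V} (hv : v ∈ B) {j : Fin k}
    (hj : j ∈ largeClasses f n p A) :
    (msActive k n p (oracleAnswer f ξ) A).find? (msAccepts n p R (oracleAnswer f ξ) v)
      = some (classPart f A j) ↔ f v = j := by
  constructor
  · intro hf
    exact (accepts_iff h hv hj).1 (List.find?_some hf)
  · intro hf
    cases hfind : (msActive k n p (oracleAnswer f ξ) A).find?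
        (msAccepts n p R (oracleAnswer f ξ) v) with
    | none =>
      rw [List.find?_eq_none] at hfind
      exact absurd ((accepts_iff h hv hj).2 hf)
        (hfind _ ((mem_msActive h hpos).2 ⟨j, hj, rfl⟩))
    | some S =>
      obtain ⟨j', hj', rfl⟩ := (mem_msActive h hpos).1 (List.mem_of_find?_eq_some hfind)
      rw [← hf, (accepts_iff h hv hj').1 (List.find?_some hfind)]

/-- The points with which the working set is filled up. -/
def fillUp (k n : ℕ) (p : ℝ) (R : PickRule V) (s : MSState V) : Finset V :=
  R.pick s.rest (⌈msScale k n p⌉₊ - s.cur.card)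

/-- The state after a good round. -/
def nextState (f : V → Fin k) (n : ℕ) (p : ℝ) (R : PickRule V) (s : MSState V) : MSState V :=
  let A := s.cur ∪ fillUp k n p R s
  let B := s.rest \ fillUp k n p R s
  let act := ((largeClasses f n p A).image (classPart f A)).toList
  { rest := B.filter fun v => f v ∉ largeClasses f n p A
    cur := A.filter fun v => f v ∉ largeClasses f n p A
    out := s.out ++ act.map fun S => S ∪ B.filter fun v => classPart f A (f v) = S
    asked := s.asked ∪ pairsOf A ∪ act.toFinset.biUnion fun S =>
            (B ×ˢ R.pick S (msVotes n p)).image fun x => s(x.1, x.2) }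

/-- This is why no conditioning is needed: no answer occurs in `nextState`, so the sets of the next
round are determined before the noise is drawn. -/
theorem msRun_succ_of_roundGood (hpos : 0 < msMinSize k n p) {ξ : Sym2 V → Bool}
    (h : RoundGood f n p R (s.cur ∪ fillUp k n p R s) (s.rest \ fillUp k n p R s) ξ) (fuel : ℕ) :
    msRun k n p R (oracleAnswer f ξ) (fuel + 1) s =
      if largeClasses f n p (s.cur ∪ fillUp k n p R s) = ∅ then
        { s with asked := s.asked ∪ pairsOf (s.cur ∪ fillUp k n p R s) }
      else msRun k n p R (oracleAnswer f ξ) fuel (nextState f n p R s) := by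
  rw [msRun]
  change (if msActive k n p (oracleAnswer f ξ) (s.cur ∪ fillUp k n p R s) = [] then _ else _) = _
  by_cases he : largeClasses f n p (s.cur ∪ fillUp k n p R s) = ∅
  · rw [if_pos he, if_pos ((msActive_eq_nil_iff h hpos).2 he)]
    rfl
  · rw [if_neg he, if_neg fun h' => he ((msActive_eq_nil_iff h hpos).1 h')]
    congr 1
    rw [nextState, MSState.mk.injEq]
    refine ⟨?_, ?_, ?_, ?_⟩
    · refine Finset.filter_congr fun v hv => ?_
      constructor
      · intro hall hj
        have := hall _ ((mem_msActive h hpos).2 ⟨_, hj, rfl⟩)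
        have h2 := (accepts_iff h hv hj).2 rfl
        rw [fillUp] at h2 this
        rw [h2] at this
        exact Bool.noConfusion this
      · intro hj S hS
        obtain ⟨j, hj', rfl⟩ := (mem_msActive h hpos).1 hS
        rw [← Bool.not_eq_true]
        intro hacc
        rw [← (accepts_iff h hv hj').1 hacc] at hj'
        exact hj hj'
    · refine Finset.filter_congr fun v hv => ?_
      constructor
      · intro hall hj
        exact hall _ ((mem_msActive h hpos).2 ⟨_, hj, rfl⟩) (mem_classPart.2 ⟨hv, rfl⟩)
      · intro hj S hS hvS
        obtain ⟨j, hj', rfl⟩ := (mem_msActive h hpos).1 hS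
        rw [← (mem_classPart.1 hvS).2] at hj'
        exact hj hj'
    · congr 1
      rw [show ((largeClasses f n p (s.cur ∪ fillUp k n p R s)).image
        (classPart f (s.cur ∪ fillUp k n p R s))).toList =
        msActive k n p (oracleAnswer f ξ) (s.cur ∪ fillUp k n p R s) from
          (h.msActive_eq hpos).symm]
      refine List.map_congr_left fun S hS => ?_
      congr 1
      refine Finset.filter_congr fun v hv => ?_
      obtain ⟨j, hj, rfl⟩ := (mem_msActive h hpos).1 hS
      refine (find?_accepts h hpos hv hj).trans ⟨fun hf => by rw [hf], fun hf => ?_⟩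
      exact (classPart_inj hpos hj hf.symm).symm
    · rw [show ((largeClasses f n p (s.cur ∪ fillUp k n p R s)).image
        (classPart f (s.cur ∪ fillUp k n p R s))).toList =
        msActive k n p (oracleAnswer f ξ) (s.cur ∪ fillUp k n p R s) from
          (h.msActive_eq hpos).symm]
      rfl

namespace IsValid

theorem fillUp_subset (s : MSState V) : fillUp k n p R s ⊆ s.rest := R.pick_subset _ _

theorem card_union_fillUp_le (h : IsValid f n p W J s) :
    (s.cur ∪ fillUp k n p R s).card ≤ ⌈msScale k n p⌉₊ := by
  refine (Finset.card_union_le _ _).trans ?_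
  rw [fillUp, R.card_pick]
  have := h.cur_le
  omega

theorem mem_iff (h : IsValid f n p W J s) {v : V} :
    v ∈ s.cur ∪ fillUp k n p R s ∨ v ∈ s.rest \ fillUp k n p R s ↔ v ∈ W ∧ f v ∈ J := by
  have h1 : v ∈ s.rest ∪ s.cur ↔ v ∈ W ∧ f v ∈ J := by rw [h.union, Finset.mem_filter]
  rw [← h1]
  simp only [Finset.mem_union, Finset.mem_sdiff]
  have := @fillUp_subset V _ _ k p n R s v
  tauto

theorem disjoint (h : IsValid f n p W J s) :
    Disjoint (s.cur ∪ fillUp k n p R s) (s.rest \ fillUp k n p R s) := by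
  rw [Finset.disjoint_union_left]
  exact ⟨h.disj.symm.mono_right Finset.sdiff_subset, Finset.disjoint_sdiff⟩

theorem largeClasses_subset (h : IsValid f n p W J s) (hpos : 0 < msMinSize k n p) :
    largeClasses f n p (s.cur ∪ fillUp k n p R s) ⊆ J := by
  intro j hj
  obtain ⟨v, hv⟩ := classPart_nonempty hpos hj
  rw [mem_classPart] at hv
  rw [← hv.2]
  exact (h.mem_iff.1 (Or.inl hv.1)).2

/-- As long as some class has not been output, some class is large in the working set. -/
theorem largeClasses_nonempty (h : IsValid f n p W J s)
    (hW : ∀ j, msMinSize k n p ≤ (classPart f W j).card) (hJ : J.Nonempty) :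
    (largeClasses f n p (s.cur ∪ fillUp k n p R s)).Nonempty := by
  have hcard : (fillUp k n p R s).card = min (⌈msScale k n p⌉₊ - s.cur.card) s.rest.card :=
    R.card_pick _ _
  -- If all remaining points fit, the classes in `J` are present in full. Otherwise the working set
  -- has `⌈N⌉` points with `N = k * msMinSize`, and the pigeonhole principle applies.
  by_cases hle : s.rest.card ≤ ⌈msScale k n p⌉₊ - s.cur.card
  · rw [min_eq_right hle] at hcard
    have hall : fillUp k n p R s = s.rest :=
      Finset.eq_of_subset_of_card_le (fillUp_subset s) hcard.ge
    obtain ⟨j, hj⟩ := hJ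
    refine ⟨j, mem_largeClasses.2 ((hW j).trans ?_)⟩
    refine Nat.cast_le.2 (Finset.card_le_card fun v hv => ?_)
    rw [mem_classPart] at hv ⊢
    have : v ∈ s.rest ∪ s.cur := by
      rw [h.union, Finset.mem_filter, hv.2]
      exact ⟨hv.1, hj⟩
    rw [hall, Finset.union_comm]
    exact ⟨this, hv.2⟩
  · rw [min_eq_left (not_le.1 hle).le] at hcard
    have hA : (s.cur ∪ fillUp k n p R s).card = ⌈msScale k n p⌉₊ := by
      rw [Finset.card_union_of_disjoint (h.disj.symm.mono_right (fillUp_subset s)), hcard]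
      have := h.cur_le
      omega
    by_contra hne
    rw [Finset.not_nonempty_iff_eq_empty, Finset.eq_empty_iff_forall_notMem] at hne
    have hsum := Finset.card_eq_sum_card_fiberwise (s := s.cur ∪ fillUp k n p R s)
      (t := (Finset.univ : Finset (Fin k))) (f := f) (by simp [Set.MapsTo])
    have hlt : ((s.cur ∪ fillUp k n p R s).card : ℝ) < ∑ _j : Fin k, msMinSize k n p := by
      rw [hsum, Nat.cast_sum]
      refine Finset.sum_lt_sum_of_nonempty ⟨hJ.choose, Finset.mem_univ _⟩ fun j _ => ?_
      exact not_le.1 fun h' => hne j (mem_largeClasses.2 h')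
    rw [Finset.sum_const, Finset.card_univ, Fintype.card_fin, nsmul_eq_mul, ← msScale_eq, hA]
      at hlt
    exact absurd (Nat.le_ceil (msScale k n p)) (not_le.2 hlt)

/-- Pairs inside the old working set were asked before; a new pair contains one of the added points.
-/
theorem card_asked_le (h : IsValid f n p W J s) :
    (s.asked ∪ pairsOf (s.cur ∪ fillUp k n p R s)).card ≤
      s.asked.card + (fillUp k n p R s).card * ⌈msScale k n p⌉₊ := by
  have hsub : s.asked ∪ pairsOf (s.cur ∪ fillUp k n p R s) ⊆ s.asked ∪
      (fillUp k n p R s ×ˢ (s.cur ∪ fillUp k n p R s)).image fun x => s(x.1, x.2) := by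
    refine Finset.union_subset Finset.subset_union_left ?_
    exact (pairsOf_union_subset _ _).trans (Finset.union_subset_union h.pairs subset_rfl)
  refine (Finset.card_le_card hsub).trans ((Finset.card_union_le _ _).trans ?_)
  refine add_le_add_right (Finset.card_image_le.trans ?_) _
  rw [Finset.card_product]
  exact Nat.mul_le_mul_left _ h.card_union_fillUp_le

theorem card_rest (s : MSState V) : (s.rest \ fillUp k n p R s).card + (fillUp k n p R s).card
    = s.rest.card := Finset.card_sdiff_add_card_eq_card (fillUp_subset s)

theorem card_rest_le (h : IsValid f n p W J s) : s.rest.card ≤ W.card := by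
  refine Finset.card_le_card ?_
  refine Finset.subset_union_left.trans (h.union.subset.trans (Finset.filter_subset _ _))

/-- A good round leads to a valid state. -/
theorem nextState (h : IsValid f n p W J s) (hpos : 0 < msMinSize k n p) :
    IsValid f n p W (J \ largeClasses f n p (s.cur ∪ fillUp k n p R s))
      (nextState f n p R s) := by
  set A := s.cur ∪ fillUp k n p R s with hA
  set B := s.rest \ fillUp k n p R s with hB
  have hsubJ := h.largeClasses_subset (R := R) hpos
  rw [← hA] at hsubJ
  have hmem : ∀ {v}, v ∈ A ∨ v ∈ B ↔ v ∈ W ∧ f v ∈ J := h.mem_iff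
  refine ⟨?_, ?_, ?_, ?_, ?_, ?_⟩
  · exact (h.disjoint.symm).mono (Finset.filter_subset _ _) (Finset.filter_subset _ _)
  · ext v
    simp only [_root_.nextState, ← hA, ← hB, Finset.mem_union, Finset.mem_filter, Finset.mem_sdiff]
    have := @hmem v
    tauto
  · exact (Finset.card_le_card (Finset.filter_subset _ _)).trans h.card_union_fillUp_le
  · intro S
    have hclass : ∀ j ∈ largeClasses f n p A,
        (classPart f A j ∪ B.filter fun v => classPart f A (f v) = classPart f A j) =
          classPart f W j := by
      intro j hj
      ext v
      simp only [Finset.mem_union, mem_classPart, Finset.mem_filter]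
      constructor
      · rintro (⟨hv, rfl⟩ | ⟨hv, hvj⟩)
        · exact ⟨(hmem.1 (Or.inl hv)).1, rfl⟩
        · exact ⟨(hmem.1 (Or.inr hv)).1, (classPart_inj hpos hj hvj.symm).symm⟩
      · rintro ⟨hv, rfl⟩
        rcases hmem.2 ⟨hv, hsubJ hj⟩ with h' | h'
        · exact Or.inl ⟨h', rfl⟩
        · exact Or.inr ⟨h', rfl⟩
    simp only [_root_.nextState, ← hA, ← hB, List.mem_append, List.mem_map, Finset.mem_toList,
      Finset.mem_image, h.out, Finset.mem_sdiff]
    constructor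
    · rintro (⟨j, hj, rfl⟩ | ⟨_, ⟨j, hj, rfl⟩, rfl⟩)
      · exact ⟨j, fun h' => hj h'.1, rfl⟩
      · exact ⟨j, fun h' => h'.2 hj, hclass j hj⟩
    · rintro ⟨j, hj, rfl⟩
      by_cases hjJ : j ∈ J
      · have hjl : j ∈ largeClasses f n p A := by tauto
        exact Or.inr ⟨_, ⟨j, hjl, rfl⟩, hclass j hjl⟩
      · exact Or.inl ⟨j, hjJ, rfl⟩
  · refine (pairsOf_mono (Finset.filter_subset _ _)).trans ?_
    exact Finset.subset_union_right.trans Finset.subset_union_left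
  · have h1 := h.card_asked_le (R := R)
    have h2 := card_rest (k := k) (n := n) (p := p) (R := R) s
    have h3 := h.asked
    have h4 : (_root_.nextState f n p R s).rest.card ≤ B.card :=
      Finset.card_le_card (Finset.filter_subset _ _)
    have h5 : (J \ largeClasses f n p A).card + (largeClasses f n p A).card = J.card :=
      Finset.card_sdiff_add_card_eq_card hsubJ
    have h6 : (_root_.nextState f n p R s).asked.card ≤ (s.asked ∪ pairsOf A).card +
        (largeClasses f n p A).card * (W.card * msVotes n p) := by
      refine (Finset.card_union_le _ _).trans (add_le_add_right ?_ _)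
      refine (Finset.card_biUnion_le_card_mul _ _ (W.card * msVotes n p) ?_).trans ?_
      · intro S _
        refine Finset.card_image_le.trans ?_
        rw [Finset.card_product]
        refine Nat.mul_le_mul ((Finset.card_le_card Finset.sdiff_subset).trans h.card_rest_le) ?_
        rw [R.card_pick]
        exact min_le_left _ _
      · refine Nat.mul_le_mul_right _ ?_
        rw [Finset.toList_toFinset]
        exact Finset.card_image_le
    rw [← hA] at h1
    rw [← hB] at h2
    have h7 := Nat.mul_le_mul_right ⌈msScale k n p⌉₊ h4
    have h8 : B.card * ⌈msScale k n p⌉₊ + (fillUp k n p R s).card * ⌈msScale k n p⌉₊ =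
        s.rest.card * ⌈msScale k n p⌉₊ := by rw [← add_mul, h2]
    have h9 : (J \ largeClasses f n p A).card * (W.card * msVotes n p) +
        (largeClasses f n p A).card * (W.card * msVotes n p) =
        J.card * (W.card * msVotes n p) := by rw [← add_mul, h5]
    omega

end IsValid

variable (h0 : 0 ≤ p) (h1 : p ≤ 1)

/-- A union bound along the deterministic good trajectory. A good round that does not stop takes a
class out of `J`, so fuel beyond `|J|` leaves a round for the stopping test. -/
theorem not_isFinal_le (hk : 2 ≤ k) (hn : 9 ≤ n) (hkn : k ≤ n) (hp : p < 1 / 2)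
    (hWn : W.card ≤ n) (hW : ∀ j, msMinSize k n p ≤ (classPart f W j).card) (fuel : ℕ) :
    ∀ (J : Finset (Fin k)) (s : MSState V), IsValid f n p W J s → J.card < fuel →
    (noiseLaw V p h0 h1).toOuterMeasure
      {ξ | ¬ IsFinal f n p W (msRun k n p R (oracleAnswer f ξ) fuel s)} ≤
      fuel * ENNReal.ofReal (5 * (n : ℝ) ^ 2 * Real.exp (-(6 * Real.log n))) := by
  have hpos := msMinSize_pos hk hn hp
  induction fuel with
  | zero => intro J s _ h; omega
  | succ fuel ih =>
    intro J s h hJ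
    set A := s.cur ∪ fillUp k n p R s with hA
    set B := s.rest \ fillUp k n p R s with hB
    have hAn : A.card ≤ n := by
      refine (Finset.card_le_card fun v hv => ?_).trans hWn
      exact (h.mem_iff.1 (Or.inl hv)).1
    have hBn : B.card ≤ n := (Finset.card_le_card Finset.sdiff_subset).trans
      (h.card_rest_le.trans hWn)
    have hround := not_roundGood_le (f := f) (R := R) (B := B) h0 h1 hk hn hkn hp
      h.card_union_fillUp_le hAn hBn
    by_cases hL : largeClasses f n p A = ∅
    · have hJ0 : J = ∅ := by
        by_contra hne
        obtain ⟨j, hj⟩ := h.largeClasses_nonempty (R := R) hW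
          (Finset.nonempty_iff_ne_empty.2 hne)
        rw [← hA, hL] at hj
        simp at hj
      refine (MeasureTheory.measure_mono ?_).trans (hround.trans ?_)
      · intro ξ hξ hgood
        apply hξ
        rw [msRun_succ_of_roundGood hpos hgood, if_pos hL]
        refine ⟨fun S => ?_, ?_⟩
        · rw [h.out]
          simp [hJ0]
        · have h1 := h.card_asked_le (R := R)
          have h2 := IsValid.card_rest (k := k) (n := n) (p := p) (R := R) s
          have h3 := h.asked
          have h4 : (fillUp k n p R s).card * ⌈msScale k n p⌉₊ ≤
              s.rest.card * ⌈msScale k n p⌉₊ := Nat.mul_le_mul_right _ (by omega)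
          simp only
          omega
      · refine le_mul_of_one_le_left zero_le ?_
        exact_mod_cast Nat.succ_le_succ (Nat.zero_le fuel)
    · have hnext := ih _ _ (h.nextState (R := R) hpos) (by
        have := Finset.card_sdiff_add_card_eq_card (h.largeClasses_subset (R := R) hpos)
        rw [← hA] at this ⊢
        have := Finset.card_pos.2 (Finset.nonempty_iff_ne_empty.2 hL)
        omega)
      have hsub : {ξ | ¬ IsFinal f n p W (msRun k n p R (oracleAnswer f ξ) (fuel + 1) s)} ⊆
          {ξ | ¬ RoundGood f n p R A B ξ} ∪
          {ξ | ¬ IsFinal f n p W (msRun k n p R (oracleAnswer f ξ) fuel (nextState f n p R s))} := by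
        intro ξ hξ
        by_cases hgood : RoundGood f n p R A B ξ
        · right
          rw [Set.mem_ofPred_eq, msRun_succ_of_roundGood hpos hgood, if_neg hL] at hξ
          exact hξ
        · exact Or.inl hgood
      refine (MeasureTheory.measure_mono hsub).trans
        ((MeasureTheory.measure_union_le _ _).trans ?_)
      rw [Nat.cast_succ, add_mul, one_mul, add_comm]
      exact add_le_add hnext hround

theorem msCluster_not_isFinal_le (hk : 2 ≤ k) (hn : 9 ≤ W.card) (hkn : k ≤ W.card)
    (hp : p < 1 / 2) (hW : ∀ j, msMinSize k W.card p ≤ (classPart f W j).card) :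
    (noiseLaw V p h0 h1).toOuterMeasure
      {ξ | ¬ IsFinal f W.card p W (msCluster k p R (oracleAnswer f ξ) W)} ≤
      ENNReal.ofReal (1 / W.card) := by
  have hvalid : IsValid f W.card p W Finset.univ
      { rest := W, cur := ∅, out := [], asked := ∅ } := by
    refine ⟨?_, ?_, ?_, ?_, ?_, ?_⟩
    · simp
    · simp
    · simp
    · simp
    · simp [pairsOf]
    · simp
  refine (not_isFinal_le h0 h1 hk hn hkn hp le_rfl hW (W.card + 1) _ _ hvalid (by
    rw [Finset.card_univ, Fintype.card_fin]; omega)).trans ?_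
  have hn' : (9 : ℝ) ≤ W.card := by exact_mod_cast hn
  have hpos : (0 : ℝ) < W.card := by linarith
  rw [← ENNReal.ofReal_natCast, ← ENNReal.ofReal_mul (by positivity)]
  refine ENNReal.ofReal_le_ofReal ?_
  -- The total over `n + 1` rounds is `5 n² (n + 1) / n⁶`, well below `1 / n`.
  have hexp : Real.exp (-(6 * Real.log W.card)) = ((W.card : ℝ) ^ 6)⁻¹ := by
    rw [Real.exp_neg, ← Nat.cast_ofNat (n := 6), Real.exp_nat_mul, Real.exp_log hpos]
  rw [hexp, le_div_iff₀ hpos, ← mul_assoc, mul_right_comm, ← div_eq_mul_inv,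
    div_le_one (by positivity)]
  push_cast
  have h3 : (W.card : ℝ) ^ 6 = W.card ^ 3 * W.card ^ 3 := by ring
  have h4 : 5 * ((W.card : ℝ) + 1) ≤ W.card ^ 3 := by nlinarith [sq_nonneg ((W.card : ℝ) - 9)]
  rw [h3]
  have h5 : (0 : ℝ) ≤ (W.card : ℝ) ^ 3 := by positivity
  nlinarith

end Run

/-! ### Sampling without replacement -/

section Sampling

variable {V : Type*} [Fintype V] [DecidableEq V]

/-- Summation over the sets of size `M + 1` by adding one element to a set of size `M`. -/
theorem sum_powersetCard_succ (F : Finset V → ℝ) (M : ℕ) :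
    ((M + 1 : ℕ) : ℝ) * ∑ W ∈ Finset.powersetCard (M + 1) (Finset.univ : Finset V), F W =
      ∑ W ∈ Finset.powersetCard M (Finset.univ : Finset V), ∑ x ∈ Wᶜ, F (insert x W) := by
  have h : ∀ W ∈ Finset.powersetCard (M + 1) (Finset.univ : Finset V),
      ((M + 1 : ℕ) : ℝ) * F W = ∑ _x ∈ W, F W := by
    intro W hW
    rw [Finset.sum_const, nsmul_eq_mul, (Finset.mem_powersetCard.1 hW).2]
  rw [Finset.mul_sum, Finset.sum_congr rfl h, Finset.sum_sigma', Finset.sum_sigma']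
  refine Finset.sum_bij' (fun y _ => ⟨y.1.erase y.2, y.2⟩) (fun y _ => ⟨insert y.2 y.1, y.2⟩)
    ?_ ?_ ?_ ?_ ?_
  · rintro ⟨W, x⟩ hy
    simp only [Finset.mem_sigma, Finset.mem_powersetCard_univ, Finset.mem_compl] at hy ⊢
    rw [Finset.card_erase_of_mem hy.2, hy.1]
    simp
  · rintro ⟨W, x⟩ hy
    simp only [Finset.mem_sigma, Finset.mem_powersetCard_univ, Finset.mem_compl] at hy ⊢
    rw [Finset.card_insert_of_notMem hy.2, hy.1]
    simp
  · rintro ⟨W, x⟩ hy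
    simp only [Finset.mem_sigma] at hy
    simp [Finset.insert_erase hy.2]
  · rintro ⟨W, x⟩ hy
    simp only [Finset.mem_sigma, Finset.mem_compl] at hy
    simp [Finset.erase_insert hy.2]
  · rintro ⟨W, x⟩ hy
    simp only [Finset.mem_sigma] at hy
    simp [Finset.insert_erase hy.2]

variable (A : Finset V)

theorem card_insert_inter {W : Finset V} {x : V} (hx : x ∉ W) :
    (insert x W ∩ A).card = (W ∩ A).card + if x ∈ A then 1 else 0 := by
  by_cases hxA : x ∈ A
  · rw [Finset.insert_inter_of_mem hxA, Finset.card_insert_of_notMem (by simp [hx]), if_pos hxA]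
  · rw [Finset.insert_inter_of_notMem hxA, if_neg hxA, add_zero]

theorem sum_compl_ite (W : Finset V) (a b : ℝ) :
    ∑ x ∈ Wᶜ, (if x ∈ A then a else b) =
      (A.card - (W ∩ A).card) * (a - b) + (Fintype.card V - W.card) * b := by
  have h1 : ∀ x, (if x ∈ A then a else b) = (if x ∈ A then (a - b) else 0) + b := by
    intro x
    split_ifs <;> ring
  rw [Finset.sum_congr rfl fun x _ => h1 x, Finset.sum_add_distrib, ← Finset.sum_filter,
    Finset.sum_const, Finset.sum_const, nsmul_eq_mul, nsmul_eq_mul, Finset.card_compl,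
    Nat.cast_sub (Finset.card_le_univ W)]
  have h2 : (Wᶜ.filter fun x => x ∈ A) = A \ W := by
    ext x
    simp [and_comm]
  have h3 := Finset.card_sdiff_add_card_inter A W
  rw [Finset.inter_comm] at h3
  rw [h2, ← h3]
  push_cast
  ring

theorem choose_succ_cast {n M : ℕ} (hM : M ≤ n) :
    ((M + 1 : ℕ) : ℝ) * (n.choose (M + 1) : ℝ) = n.choose M * (n - M) := by
  have := Nat.choose_succ_right_eq n M
  rw [← Nat.cast_sub hM, mul_comm]
  exact_mod_cast this

/-- The mean of the number of sampled members of `A`. -/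
theorem sum_card_inter (M : ℕ) (hM : M ≤ Fintype.card V) :
    Fintype.card V * ∑ W ∈ Finset.powersetCard M (Finset.univ : Finset V), ((W ∩ A).card : ℝ) =
      M * A.card * (Fintype.card V).choose M := by
  induction M with
  | zero => simp
  | succ M ih =>
    have ih := ih (by omega)
    have h := sum_powersetCard_succ (fun W => ((W ∩ A).card : ℝ)) M
    have h2 : ∀ W ∈ Finset.powersetCard M (Finset.univ : Finset V),
        ∑ x ∈ Wᶜ, ((insert x W ∩ A).card : ℝ) =
          (Fintype.card V - M - 1) * ((W ∩ A).card : ℝ) + A.card := by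
      intro W hW
      have hWM := Finset.mem_powersetCard_univ.1 hW
      have h3 : ∀ x ∈ Wᶜ, ((insert x W ∩ A).card : ℝ) =
          (W ∩ A).card + if x ∈ A then (1 : ℝ) else 0 := by
        intro x hx
        rw [card_insert_inter A (Finset.mem_compl.1 hx)]
        push_cast
        rfl
      rw [Finset.sum_congr rfl h3, Finset.sum_add_distrib, sum_compl_ite, Finset.sum_const,
        nsmul_eq_mul, Finset.card_compl, Nat.cast_sub (Finset.card_le_univ W), hWM]
      ring
    rw [Finset.sum_congr rfl h2, Finset.sum_add_distrib, ← Finset.mul_sum, Finset.sum_const,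
      nsmul_eq_mul, Finset.card_powersetCard, Finset.card_univ] at h
    have hc := choose_succ_cast (n := Fintype.card V) (M := M) (by omega)
    have hM1 : ((M + 1 : ℕ) : ℝ) ≠ 0 := by positivity
    apply mul_left_cancel₀ hM1
    rw [mul_left_comm, h]
    push_cast at hc ⊢
    linear_combination ((Fintype.card V : ℝ) - M - 1) * ih - (M + 1) * (A.card : ℝ) * hc

/-- The bound known for sampling with replacement, by adding one point at a time. The step produces
the product of `|W ∩ A|` and `2^(-|W ∩ A|)`, which are oppositely ordered. Chebyshev's sum
inequality replaces the first factor by its mean `M |A| / n`, and the coefficients combine to `(n -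
M)(1 - |A| / (2n))`. -/
theorem sum_half_pow_le (M : ℕ) (hM : M ≤ Fintype.card V) :
    ∑ W ∈ Finset.powersetCard M (Finset.univ : Finset V), (1 / 2 : ℝ) ^ (W ∩ A).card ≤
      (1 - A.card / (2 * Fintype.card V)) ^ M * (Fintype.card V).choose M := by
  induction M with
  | zero => simp
  | succ M ih =>
    have ih := ih (by omega)
    have hn : (0 : ℝ) < Fintype.card V := by
      have : 0 < Fintype.card V := by omega
      exact_mod_cast this
    have hMn : (M : ℝ) ≤ Fintype.card V := by
      have : M ≤ Fintype.card V := by omega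
      exact_mod_cast this
    have ha : (A.card : ℝ) ≤ Fintype.card V := by exact_mod_cast Finset.card_le_univ A
    have h := sum_powersetCard_succ (fun W => (1 / 2 : ℝ) ^ (W ∩ A).card) M
    have h2 : ∀ W ∈ Finset.powersetCard M (Finset.univ : Finset V),
        ∑ x ∈ Wᶜ, (1 / 2 : ℝ) ^ (insert x W ∩ A).card =
          (Fintype.card V - M - A.card / 2) * (1 / 2 : ℝ) ^ (W ∩ A).card
            + 1 / 2 * (((W ∩ A).card : ℝ) * (1 / 2 : ℝ) ^ (W ∩ A).card) := by
      intro W hW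
      have hWM := Finset.mem_powersetCard_univ.1 hW
      have h3 : ∀ x ∈ Wᶜ, (1 / 2 : ℝ) ^ (insert x W ∩ A).card =
          (1 / 2 : ℝ) ^ (W ∩ A).card * if x ∈ A then (1 / 2 : ℝ) else 1 := by
        intro x hx
        rw [card_insert_inter A (Finset.mem_compl.1 hx)]
        split_ifs
        · rw [pow_succ]
        · rw [add_zero, mul_one]
      rw [Finset.sum_congr rfl h3, ← Finset.mul_sum, sum_compl_ite, hWM]
      ring
    rw [Finset.sum_congr rfl h2, Finset.sum_add_distrib, ← Finset.mul_sum, ← Finset.mul_sum] at h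
    have hanti : AntivaryOn (fun W : Finset V => ((W ∩ A).card : ℝ))
        (fun W => (1 / 2 : ℝ) ^ (W ∩ A).card)
        (Finset.powersetCard M (Finset.univ : Finset V)) := by
      intro W _ W' _ hlt
      by_contra hle
      rw [not_le, Nat.cast_lt] at hle
      exact absurd hlt (not_lt.2 (pow_le_pow_of_le_one (by norm_num) (by norm_num) hle.le))
    have hch := hanti.card_mul_sum_le_sum_mul_sum
    have hmean := sum_card_inter A M (by omega)
    have hc := choose_succ_cast (n := Fintype.card V) (M := M) (by omega)
    rw [Finset.card_powersetCard, Finset.card_univ] at hch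
    set S := ∑ W ∈ Finset.powersetCard M (Finset.univ : Finset V), (1 / 2 : ℝ) ^ (W ∩ A).card
    set T := ∑ W ∈ Finset.powersetCard M (Finset.univ : Finset V),
      ((W ∩ A).card : ℝ) * (1 / 2 : ℝ) ^ (W ∩ A).card
    set C := ((Fintype.card V).choose M : ℝ) with hC
    have hC0 : 0 < C := by
      rw [hC, Nat.cast_pos]
      exact Nat.choose_pos (by omega)
    have hT : T ≤ M * A.card / Fintype.card V * S := by
      have h4 : ∑ W ∈ Finset.powersetCard M (Finset.univ : Finset V), ((W ∩ A).card : ℝ) =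
          M * A.card / Fintype.card V * C := by
        field_simp
        linarith
      rw [h4] at hch
      have h5 : C * T ≤ C * (M * A.card / Fintype.card V * S) := by linarith
      exact le_of_mul_le_mul_left h5 hC0
    have hM1 : (0 : ℝ) < ((M + 1 : ℕ) : ℝ) := by positivity
    refine le_of_mul_le_mul_left ?_ hM1
    rw [h]
    have hr : 0 ≤ 1 - (A.card : ℝ) / (2 * Fintype.card V) := by
      rw [sub_nonneg, div_le_one (by positivity)]
      linarith
    calc ((Fintype.card V : ℝ) - M - A.card / 2) * S + 1 / 2 * T
        ≤ ((Fintype.card V : ℝ) - M - A.card / 2) * S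
          + 1 / 2 * (M * A.card / Fintype.card V * S) := by linarith
      _ = ((Fintype.card V : ℝ) - M) * (1 - A.card / (2 * Fintype.card V)) * S := by
          field_simp
          ring
      _ ≤ ((Fintype.card V : ℝ) - M) * (1 - A.card / (2 * Fintype.card V)) *
          ((1 - A.card / (2 * Fintype.card V)) ^ M * C) := by
          refine mul_le_mul_of_nonneg_left ih (mul_nonneg (by linarith) hr)
      _ = _ := by
          rw [pow_succ]
          linear_combination (-(1 - (A.card : ℝ) / (2 * Fintype.card V)) ^ M *
            (1 - (A.card : ℝ) / (2 * Fintype.card V))) * hc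

/-- A sample is unlikely to contain less than half of the expected number of members of `A`. -/
theorem sample_small_le {M : ℕ} (hM : M ≤ Fintype.card V) {β : ℝ} (hβ : 0 ≤ β)
    (hA : β * Fintype.card V ≤ A.card) (hV : 0 < Fintype.card V) :
    (PMF.uniformOfFinset (Finset.powersetCard M (Finset.univ : Finset V))
      (Finset.powersetCard_nonempty.2 hM)).toOuterMeasure {W | ((W ∩ A).card : ℝ) < β * M / 2} ≤
      ENNReal.ofReal (Real.exp (-(β * M / 8))) := by
  classical
  have hn : (0 : ℝ) < Fintype.card V := by exact_mod_cast hV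
  rw [PMF.toOuterMeasure_uniformOfFinset_apply]
  have hC : 0 < (Fintype.card V).choose M := Nat.choose_pos hM
  have hC' : (0 : ℝ) < (Fintype.card V).choose M := by exact_mod_cast hC
  rw [Finset.card_powersetCard, Finset.card_univ,
    ENNReal.div_le_iff (by exact_mod_cast hC.ne') (by simp), ← ENNReal.ofReal_natCast,
    ← ENNReal.ofReal_natCast, ← ENNReal.ofReal_mul (Real.exp_pos _).le]
  refine ENNReal.ofReal_le_ofReal ?_
  have hsum := sum_half_pow_le A M hM
  set F := (Finset.powersetCard M (Finset.univ : Finset V)).filter fun W =>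
    W ∈ {W : Finset V | ((W ∩ A).card : ℝ) < β * M / 2} with hF
  have hlow : (F.card : ℝ) * Real.exp (-(Real.log 2 * (β * M / 2))) ≤
      ∑ W ∈ Finset.powersetCard M (Finset.univ : Finset V), (1 / 2 : ℝ) ^ (W ∩ A).card := by
    rw [← nsmul_eq_mul, ← Finset.sum_const]
    refine (Finset.sum_le_sum fun W hW => ?_).trans
      (Finset.sum_le_sum_of_subset_of_nonneg (Finset.filter_subset _ _) fun _ _ _ => by positivity)
    have hW' : ((W ∩ A).card : ℝ) < β * M / 2 := (Finset.mem_filter.1 hW).2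
    have h2 : (1 / 2 : ℝ) ^ (W ∩ A).card = Real.exp (-(Real.log 2 * (W ∩ A).card)) := by
      rw [Real.exp_neg, mul_comm, Real.exp_nat_mul, Real.exp_log two_pos, one_div, inv_pow]
    rw [h2, Real.exp_le_exp]
    have := Real.log_pos one_lt_two
    nlinarith
  have hup : (1 - (A.card : ℝ) / (2 * Fintype.card V)) ^ M ≤ Real.exp (-(β * M / 2)) := by
    have h3 : β / 2 ≤ (A.card : ℝ) / (2 * Fintype.card V) := by
      rw [div_le_div_iff₀ two_pos (by positivity)]
      linarith
    have h4 : 1 - (A.card : ℝ) / (2 * Fintype.card V) ≤ Real.exp (-(β / 2)) := by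
      have := Real.add_one_le_exp (-(β / 2))
      linarith
    have h5 : 0 ≤ 1 - (A.card : ℝ) / (2 * Fintype.card V) := by
      have ha : (A.card : ℝ) ≤ Fintype.card V := by exact_mod_cast Finset.card_le_univ A
      rw [sub_nonneg, div_le_one (by positivity)]
      linarith
    refine (pow_le_pow_left₀ h5 h4 M).trans (le_of_eq ?_)
    rw [← Real.exp_nat_mul]
    congr 1
    ring
  have hmain : (F.card : ℝ) * Real.exp (-(Real.log 2 * (β * M / 2))) ≤
      Real.exp (-(β * M / 2)) * (Fintype.card V).choose M :=
    hlow.trans (hsum.trans (mul_le_mul_of_nonneg_right hup hC'.le))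
  have hstep : (F.card : ℝ) ≤ Real.exp (-(β * M / 2)) * (Fintype.card V).choose M *
      Real.exp (Real.log 2 * (β * M / 2)) := by
    have h6 := mul_le_mul_of_nonneg_right hmain (Real.exp_pos (Real.log 2 * (β * M / 2))).le
    rwa [mul_assoc, ← Real.exp_add, neg_add_cancel, Real.exp_zero, mul_one] at h6
  refine hstep.trans ?_
  rw [mul_right_comm, ← Real.exp_add]
  -- Markov's inequality for `2^(-|W ∩ A|)` leaves the exponent `(1 - log 2) β M / 2`, and `1 - log
  -- 2 > 1 / 4`.
  refine mul_le_mul_of_nonneg_right (Real.exp_le_exp.2 ?_) hC'.le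
  have h7 := Real.log_two_lt_d9
  have h8 : 0 ≤ β * M := by positivity
  nlinarith

end Sampling

/-! ### Mixtures -/

section Mixtures

variable {α γ : Type*}

/-- The term `h` is kept as an average, not bounded pointwise, so that it can be evaluated in the
other order of summation. -/
theorem PMF.toOuterMeasure_bind_le_add_tsum (q : PMF α) (F : α → PMF γ) (S : Set γ) (B : Set α)
    (ε : ℝ≥0∞) (h : α → ℝ≥0∞)
    (hF : ∀ a ∈ q.support, a ∉ B → (F a).toOuterMeasure S ≤ ε + h a) :
    (q.bind F).toOuterMeasure S ≤ q.toOuterMeasure B + ε + ∑' a, q a * h a := by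
  rw [PMF.toOuterMeasure_bind_apply, PMF.toOuterMeasure_apply]
  calc ∑' a, q a * (F a).toOuterMeasure S
      ≤ ∑' a, (B.indicator q a + q a * ε + q a * h a) := by
        refine ENNReal.tsum_le_tsum fun a => ?_
        by_cases ha : a ∈ B
        · rw [Set.indicator_of_mem ha, add_assoc]
          refine le_trans ?_ le_self_add
          exact mul_le_of_le_one_right' (PMF.toOuterMeasure_le_one _ _)
        · rw [Set.indicator_of_notMem ha, zero_add, ← mul_add]
          by_cases hs : a ∈ q.support
          · exact mul_le_mul_right (hF a hs ha) _
          · rw [PMF.apply_eq_zero_iff _ _ |>.2 hs, zero_mul, zero_mul]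
    _ = _ := by
        rw [ENNReal.tsum_add, ENNReal.tsum_add, ENNReal.tsum_mul_right, PMF.tsum_coe, one_mul]

theorem PMF.toOuterMeasure_bind_le (q : PMF α) (F : α → PMF γ) (S : Set γ) (B : Set α)
    (ε : ℝ≥0∞) (hF : ∀ a ∈ q.support, a ∉ B → (F a).toOuterMeasure S ≤ ε) :
    (q.bind F).toOuterMeasure S ≤ q.toOuterMeasure B + ε := by
  simpa using PMF.toOuterMeasure_bind_le_add_tsum q F S B ε 0 (by simpa using hF)

/-- Tonelli: it allows vote failures to be estimated for a fixed outcome of the search. -/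
theorem PMF.tsum_mul_toOuterMeasure_comm (q : PMF α) (r : PMF γ) (R : α → γ → Prop) :
    ∑' a, q a * r.toOuterMeasure {b | R a b} = ∑' b, r b * q.toOuterMeasure {a | R a b} := by
  classical
  simp_rw [PMF.toOuterMeasure_apply, ← ENNReal.tsum_mul_left]
  rw [ENNReal.tsum_comm]
  refine tsum_congr fun b => tsum_congr fun a => ?_
  by_cases h : R a b
  · rw [Set.indicator_of_mem (show b ∈ {b | R a b} from h),
      Set.indicator_of_mem (show a ∈ {a | R a b} from h), mul_comm]
  · rw [Set.indicator_of_notMem (show b ∉ {b | R a b} from h),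
      Set.indicator_of_notMem (show a ∉ {a | R a b} from h), mul_zero, mul_zero]

end Mixtures

/-! ### Labels by votes -/

section Votes

variable {V : Type*} [Fintype V] [DecidableEq V] {k : ℕ} {p : ℝ}
  {f : V → Fin k} {W : Finset V} {R : PickRule V}

/-- At least half of the answers about `v` and some class of `W` are wrong. -/
def VoteFails (f : V → Fin k) (W : Finset V) (ξ : Sym2 V → Bool) (v : V) : Prop :=
  ∃ j, (classPart f W j).card ≤ 2 * ((classPart f W j).filter fun u => ξ s(v, u) = true).card

theorem voteLabel_of_mem {n : ℕ} {s : MSState V} (h : IsFinal f n p W s) (ans : V → V → Bool)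
    {v : V} (hv : v ∈ W) : voteLabel ans s.out v = some (classPart f W (f v)) := by
  rw [voteLabel]
  cases hfind : s.out.find? fun S => decide (v ∈ S) with
  | some S =>
    obtain ⟨j, rfl⟩ := (h.out S).1 (List.mem_of_find?_eq_some hfind)
    have hm := List.find?_some hfind
    rw [decide_eq_true_eq, mem_classPart] at hm
    rw [hm.2]
  | none =>
    rw [List.find?_eq_none] at hfind
    have := hfind _ ((h.out _).2 ⟨f v, rfl⟩)
    rw [decide_eq_true_eq, mem_classPart] at this
    exact absurd ⟨hv, rfl⟩ this

/-- The proportion of "yes" exceeds one half in the own class and is below one half in all others,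
whatever their sizes. -/
theorem voteLabel_of_not_voteFails {n : ℕ} {s : MSState V} (h : IsFinal f n p W s)
    {ξ : Sym2 V → Bool} {v : V} (hv : v ∉ W) (hξ : ¬ VoteFails f W ξ v) :
    voteLabel (oracleAnswer f ξ) s.out v = some (classPart f W (f v)) := by
  have hfind : (s.out.find? fun S => decide (v ∈ S)) = none := by
    rw [List.find?_eq_none]
    intro S hS
    obtain ⟨j, rfl⟩ := (h.out S).1 hS
    rw [decide_eq_true_eq, mem_classPart]
    exact fun h' => hv h'.1
  rw [voteLabel, hfind]
  simp only [VoteFails, not_exists, not_le] at hξ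
  have hans : ∀ j, ((classPart f W j).filter fun u => oracleAnswer f ξ v u = true) =
      (classPart f W j).filter fun u => xor (decide (f v = j)) (ξ s(v, u)) = true := by
    intro j
    refine Finset.filter_congr fun u hu => ?_
    rw [oracleAnswer, (mem_classPart.1 hu).2]
  have hpos : ∀ j, (0 : ℚ) < (classPart f W j).card := by
    intro j
    have := hξ j
    exact_mod_cast (Nat.zero_le _).trans_lt this
  have hself : (1 / 2 : ℚ) < (((classPart f W (f v)).filter fun u =>
      oracleAnswer f ξ v u = true).card : ℚ) / ((classPart f W (f v)).card : ℚ) := by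
    rw [lt_div_iff₀ (hpos _), hans]
    have h1 := Finset.card_filter_add_card_filter_not (s := classPart f W (f v))
      (fun u => ξ s(v, u) = true)
    have h2 := hξ (f v)
    simp only [decide_true, Bool.true_xor, Bool.not_eq_true', Bool.not_eq_true] at h1 ⊢
    have h3 : ((classPart f W (f v)).card : ℚ) <
        2 * (((classPart f W (f v)).filter fun u => ξ s(v, u) = false).card : ℚ) := by
      have : (classPart f W (f v)).card <
        2 * ((classPart f W (f v)).filter fun u => ξ s(v, u) = false).card := by omega
      exact_mod_cast this
    linarith
  have hother : ∀ j, f v ≠ j → (((classPart f W j).filter fun u =>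
      oracleAnswer f ξ v u = true).card : ℚ) / ((classPart f W j).card : ℚ) < 1 / 2 := by
    intro j hj
    rw [div_lt_iff₀ (hpos _), hans]
    simp only [hj, decide_false, Bool.false_xor]
    have h3 : 2 * (((classPart f W j).filter fun u => ξ s(v, u) = true).card : ℚ) <
        ((classPart f W j).card : ℚ) := by exact_mod_cast hξ j
    linarith
  cases hmax : s.out.argmax fun S => ((S.filter fun u => oracleAnswer f ξ v u = true).card : ℚ)
      / (S.card : ℚ) with
  | none =>
    rw [List.argmax_eq_none] at hmax
    have := (h.out _).2 ⟨f v, rfl⟩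
    rw [hmax] at this
    simp at this
  | some S =>
    obtain ⟨j, rfl⟩ := (h.out S).1 (List.argmax_mem hmax)
    by_cases hj : f v = j
    · simp only [hj]
    · have h1 := List.le_of_mem_argmax ((h.out _).2 ⟨f v, rfl⟩) hmax
      have h2 := hother j hj
      linarith

theorem card_voteQueries_le {Λ : Type*} {n : ℕ} {s : MSState V} (h : IsFinal f n p W s)
    (L : V → Option Λ) : (voteQueries s.out L).card ≤ (labelled L).card * W.card := by
  classical
  have hsub : s.out.toFinset.sup id ⊆ W := by
    refine Finset.sup_le fun S hS => ?_
    rw [List.mem_toFinset] at hS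
    obtain ⟨j, rfl⟩ := (h.out S).1 hS
    exact Finset.filter_subset _ _
  refine Finset.card_image_le.trans ?_
  rw [Finset.card_product]
  refine Nat.mul_le_mul (Finset.card_le_card fun v hv => ?_) (Finset.card_le_card hsub)
  rw [Finset.mem_filter] at hv
  simp [labelled, hv.2.1]

variable (h0 : 0 ≤ p) (h1 : p ≤ 1)

/-- Each class fails with probability at most `δ / (8 (k - 1) Q)`, and there are `k ≤ 2 (k - 1)`
classes. -/
theorem voteFails_le (hp : p < 1 / 2) {m Q δ : ℝ} (hm : 0 < m) (hQ : 0 < Q) (hδ : 0 < δ)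
    (hk : 2 ≤ k) (hW : ∀ j, m ≤ (classPart f W j).card)
    (hM : 0 < p → Real.log (8 * (k - 1) * Q / δ) ≤ m * bernoulliKL (1 / 2) p)
    (hD : 0 < p → 0 ≤ bernoulliKL (1 / 2) p) (v : V) :
    (noiseLaw V p h0 h1).toOuterMeasure {ξ | VoteFails f W ξ v} ≤
      ENNReal.ofReal (δ / (4 * Q)) := by
  have hk' : (2 : ℝ) ≤ k := by exact_mod_cast hk
  have hinj : Function.Injective fun u => s(v, u) := fun u w h => Sym2.congr_right.1 h
  have heach : ∀ j, (noiseLaw V p h0 h1).toOuterMeasure {ξ | (classPart f W j).card ≤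
      2 * ((classPart f W j).filter fun u => ξ s(v, u) = true).card} ≤
      ENNReal.ofReal (δ / (8 * (k - 1) * Q)) := by
    intro j
    rcases h0.eq_or_lt with hp0 | hp0
    · rw [noise_half_eq_zero h0 h1 (z := fun u => s(v, u)) _ hp0.symm]
      · exact zero_le
      · rw [← Finset.card_pos]
        exact_mod_cast hm.trans_le (hW j)
    · refine (noise_half_le h0 h1 (z := fun u => s(v, u)) hinj.injOn hp0 hp).trans ?_
      refine ENNReal.ofReal_le_ofReal ?_
      have hc : 0 < 8 * ((k : ℝ) - 1) * Q := by
        have : 0 < (k : ℝ) - 1 := by linarith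
        positivity
      have h2 : δ / (8 * (k - 1) * Q) = Real.exp (-Real.log (8 * (k - 1) * Q / δ)) := by
        rw [Real.exp_neg, Real.exp_log (by positivity), inv_div]
      rw [h2, Real.exp_le_exp, neg_le_neg_iff]
      exact (hM hp0).trans (mul_le_mul_of_nonneg_right (hW j) (hD hp0))
  have hsub : {ξ | VoteFails f W ξ v} = ⋃ j ∈ (Finset.univ : Finset (Fin k)),
      {ξ | (classPart f W j).card ≤
        2 * ((classPart f W j).filter fun u => ξ s(v, u) = true).card} := by
    ext ξ
    simp [VoteFails]
  rw [hsub]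
  refine (MeasureTheory.measure_biUnion_finset_le _ _).trans
    ((Finset.sum_le_sum fun j _ => heach j).trans ?_)
  rw [Finset.sum_const, Finset.card_univ, Fintype.card_fin, nsmul_eq_mul,
    ← ENNReal.ofReal_natCast, ← ENNReal.ofReal_mul (by positivity)]
  refine ENNReal.ofReal_le_ofReal ?_
  have hk1 : 0 < (k : ℝ) - 1 := by linarith
  rw [mul_div_assoc', div_le_div_iff₀ (by positivity) (by positivity)]
  have : 0 < δ * Q := by positivity
  nlinarith

end Votes

/-! ### The two-phase algorithm -/

section Main

variable {V : Type*} [Fintype V] [DecidableEq V] {k : ℕ} {p : ℝ}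

theorem bernoulliKL_half_pos (hp0 : 0 < p) (hp : p < 1 / 2) : 0 < bernoulliKL (1 / 2) p := by
  have hp1 : 0 < 1 - p := by linarith
  have h : bernoulliKL (1 / 2) p = 1 / 2 * Real.log (1 / 2 / p * ((1 - 1 / 2) / (1 - p))) := by
    rw [bernoulliKL, Real.log_mul (by positivity) (by
      have : (1 - 1 / 2 : ℝ) = 1 / 2 := by norm_num
      rw [this]
      positivity)]
    ring
  rw [h]
  refine mul_pos (by norm_num) (Real.log_pos ?_)
  rw [div_mul_div_comm, lt_div_iff₀ (by positivity)]
  nlinarith [sq_nonneg (1 - 2 * p), mul_pos (sub_pos.2 hp) (sub_pos.2 hp)]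

/-- Every class contains a component of `G - C`. -/
theorem card_classPart_univ_ge {E : Finset (Finset V)} {f : V → Fin k}
    (hf : Function.Surjective f) {β : ℝ} (hbal : IsBalanced E f β) (j : Fin k) :
    β * Fintype.card V ≤ ((classPart f Finset.univ j).card : ℝ) := by
  obtain ⟨v, rfl⟩ := hf j
  refine (hbal ((cutFree E f).connectedComponentMk v)).trans ?_
  rw [← Set.ncard_coe_finset, Nat.cast_le]
  refine Set.ncard_le_ncard (fun u hu => ?_) (Set.toFinite _)
  rw [Finset.mem_coe, mem_classPart]
  exact ⟨Finset.mem_univ _, cutFree_reachable_label (SimpleGraph.ConnectedComponent.eq.1 hu)⟩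

theorem inter_classPart_univ (f : V → Fin k) (W : Finset V) (j : Fin k) :
    W ∩ classPart f Finset.univ j = classPart f W j := by
  ext v
  simp [mem_classPart]

/-- The probability that some class is badly represented in the sample. -/
theorem sample_classes_le {E : Finset (Finset V)} {f : V → Fin k} (hk : 2 ≤ k)
    (hf : Function.Surjective f) {β : ℝ} (hβ : 0 < β) (hbal : IsBalanced E f β)
    {M : ℕ} (hM : M ≤ Fintype.card V) {δ : ℝ} (hδ : 0 < δ) (hδ1 : δ ≤ 1)
    (hM2 : 12 / β * Real.log (4 * k / δ) ≤ M) :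
    (PMF.uniformOfFinset (Finset.powersetCard M (Finset.univ : Finset V))
      (Finset.powersetCard_nonempty.2 hM)).toOuterMeasure
        {W | ∃ j, ((classPart f W j).card : ℝ) < β * M / 2} ≤ ENNReal.ofReal (δ / 8) := by
  have hk' : (2 : ℝ) ≤ k := by exact_mod_cast hk
  have hV : 0 < Fintype.card V := by
    obtain ⟨v, -⟩ := hf ⟨0, by omega⟩
    exact Fintype.card_pos_iff.2 ⟨v⟩
  have hsub : {W | ∃ j, ((classPart f W j).card : ℝ) < β * M / 2} =
      ⋃ j ∈ (Finset.univ : Finset (Fin k)),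
        {W | ((W ∩ classPart f Finset.univ j).card : ℝ) < β * M / 2} := by
    ext W
    simp [inter_classPart_univ]
  rw [hsub]
  refine (MeasureTheory.measure_biUnion_finset_le _ _).trans
    ((Finset.sum_le_sum fun j _ => sample_small_le _ hM hβ.le
      (card_classPart_univ_ge hf hbal j) hV).trans ?_)
  rw [Finset.sum_const, Finset.card_univ, Fintype.card_fin, nsmul_eq_mul,
    ← ENNReal.ofReal_natCast, ← ENNReal.ofReal_mul (by positivity)]
  refine ENNReal.ofReal_le_ofReal ?_
  set y := δ / (4 * k) with hy
  have hy0 : 0 < y := by positivity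
  have hy1 : y ≤ 1 / 4 := by
    rw [hy, div_le_div_iff₀ (by positivity) (by norm_num)]
    nlinarith
  have hlog : Real.log (4 * k / δ) = -Real.log y := by
    rw [hy, ← Real.log_inv, inv_div]
  rw [hlog, div_mul_eq_mul_div, div_le_iff₀ hβ] at hM2
  -- The constant 12 gives `y^(3/2)`: the factor `y` absorbs the `k` classes, and `√y ≤ 1 / 2` gives
  -- the remaining factor.
  have hexp : Real.exp (-(β * M / 8)) ≤ y * √y := by
    have h1 : y * √y = Real.exp (Real.log y + Real.log y / 2) := by
      rw [Real.exp_add, Real.exp_log hy0, ← Real.log_sqrt hy0.le, Real.exp_log (Real.sqrt_pos.2 hy0)]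
    rw [h1, Real.exp_le_exp]
    linarith
  have hsq : √y ≤ 1 / 2 := by
    rw [Real.sqrt_le_left (by norm_num)]
    linarith
  have hky : k * y = δ / 4 := by
    rw [hy]
    field_simp
  calc (k : ℝ) * Real.exp (-(β * M / 8)) ≤ k * (y * √y) := by gcongr
    _ = δ / 4 * √y := by rw [← mul_assoc, hky]
    _ ≤ δ / 4 * (1 / 2) := by gcongr
    _ = δ / 8 := by ring

/-- The number of pairs queried in the first phase. -/
theorem phase_one_queries_le {M : ℕ} (hk : 2 ≤ k) (hM : 9 ≤ M) (h0 : 0 ≤ p) (hp : p < 1 / 2) :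
    ((M * ⌈msScale k M p⌉₊ + k * (M * msVotes M p) : ℕ) : ℝ) ≤
      100 * (M * (k : ℝ) ^ 2 * Real.log M / (1 - 2 * p) ^ 4) := by
  have hL := two_le_log hM
  have hk' : (2 : ℝ) ≤ k := by exact_mod_cast hk
  have hq : 0 < 1 - 2 * p := by linarith
  have hq2 : (1 - 2 * p) ^ 2 ≤ 1 := pow_le_one₀ hq.le (by linarith)
  have hq4 : (1 - 2 * p) ^ 4 ≤ (1 - 2 * p) ^ 2 :=
    pow_le_pow_of_le_one hq.le (by linarith) (by norm_num)
  have hq4p : 0 < (1 - 2 * p) ^ 4 := by positivity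
  have hq2p : 0 < (1 - 2 * p) ^ 2 := by positivity
  set Y := Real.log M / (1 - 2 * p) ^ 4 with hY
  have hY1 : 1 ≤ Y := by
    rw [hY, le_div_iff₀ hq4p]
    linarith
  have hs : (⌈msScale k M p⌉₊ : ℝ) ≤ 64 * (k : ℝ) ^ 2 * Y + 1 := by
    have h1 := (Nat.ceil_lt_add_one (msScale_nonneg (p := p) hk hM hp)).le
    have h2 : msScale k M p = 64 * (k : ℝ) ^ 2 * Y := by rw [msScale, hY, mul_div_assoc]
    linarith
  have hv : (msVotes M p : ℝ) ≤ 16 * Y + 1 := by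
    have h1 : (msVotes M p : ℝ) < 16 * Real.log M / (1 - 2 * p) ^ 2 + 1 :=
      Nat.ceil_lt_add_one (by positivity)
    have h2 : 16 * Real.log M / (1 - 2 * p) ^ 2 ≤ 16 * Y := by
      rw [hY, ← mul_div_assoc]
      exact div_le_div_of_nonneg_left (by positivity) hq4p hq4
    linarith
  have hkY : 1 ≤ (k : ℝ) ^ 2 * Y := by nlinarith
  have hM0 : (0 : ℝ) ≤ M := Nat.cast_nonneg M
  have h3 : (k : ℝ) * msVotes M p ≤ 17 * ((k : ℝ) ^ 2 * Y) := by
    calc (k : ℝ) * msVotes M p ≤ k * (17 * Y) := by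
          gcongr
          linarith
      _ = 17 * (k * Y) := by ring
      _ ≤ 17 * ((k : ℝ) ^ 2 * Y) := by
          have : (k : ℝ) ≤ (k : ℝ) ^ 2 := by nlinarith
          gcongr
  calc ((M * ⌈msScale k M p⌉₊ + k * (M * msVotes M p) : ℕ) : ℝ)
      = M * (⌈msScale k M p⌉₊ + k * msVotes M p) := by
        push_cast
        ring
    _ ≤ M * (100 * ((k : ℝ) ^ 2 * Y)) := by
        refine mul_le_mul_of_nonneg_left ?_ hM0
        linarith
    _ = _ := by
        rw [hY]
        ring

/-- The failure probability for a sample in which every class is well represented. -/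
theorem noisyHS2_sample_le {E : Finset (Finset V)} {f : V → Fin k} (hk : 2 ≤ k)
    (hf : Function.Surjective f) {β : ℝ} (hβ0 : 0 < β) (hβ : β ≤ 1 / 2) (hbal : IsBalanced E f β)
    {κ : ℕ} (hκ : κ ≤ Fintype.card V) (hclu : IsClustered E f κ)
    (h0 : 0 ≤ p) (h1 : p ≤ 1) (hp : p < 1 / 2) {δ : ℝ} (hδ : 0 < δ) (hδ1 : δ ≤ 1)
    {M : ℕ} (hM9 : 9 ≤ M) (hkM : k ≤ M) (hM3 : 8 / δ ≤ M)
    (hM4 : 2 / (β * bernoulliKL (1 / 2) p)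
      * Real.log (8 * (k - 1) * nodeBudget E f β κ (δ / 4) / δ) ≤ M)
    (hmin : msMinSize k M p ≤ β * M / 2)
    (R : PickRule V) (μ : MidpointRule V (Option (Finset V))) {W : Finset V} (hWM : W.card = M)
    (hW : ∀ j, β * M / 2 ≤ (classPart f W j).card) :
    ((noiseLaw V p h0 h1).bind fun ξ =>
      let ans := oracleAnswer f ξ
      let s := msCluster k p R ans W
      (hs2 E (voteLabel ans s.out) μ ⌊nodeBudget E f β κ (δ / 4)⌋₊ fun _ => none).map fun L =>
        (discovered E L, s.asked ∪ voteQueries s.out L)).toOuterMeasure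
      {z | ¬ (z.1 = cutSet E f ∧
        (z.2.card : ℝ) ≤ 100 * (M * (k : ℝ) ^ 2 * Real.log M / (1 - 2 * p) ^ 4)
                + M * nodeBudget E f β κ (δ / 4))} ≤
      ENNReal.ofReal (δ / 8) + ENNReal.ofReal (δ / 2) + ENNReal.ofReal (δ / 4) := by
  set Q := nodeBudget E f β κ (δ / 4) with hQ
  set b := ⌊Q⌋₊ with hb
  have hQ0 : 0 < Q := nodeBudget_pos E f hκ hβ0 hβ (by linarith) (by linarith)
  have hbQ : (b : ℝ) ≤ Q := Nat.floor_le hQ0.le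
  have hM0 : (0 : ℝ) < M := by
    have : 0 < M := by omega
    exact_mod_cast this
  have hWpos : ∀ j, (classPart f W j).Nonempty := by
    intro j
    rw [← Finset.card_pos]
    have : (0 : ℝ) < (classPart f W j).card := lt_of_lt_of_le (by positivity) (hW j)
    exact_mod_cast this
  -- The correct labels are written as the very clusters of Phase 1: the midpoint rule sees label
  -- values, so runs with equal labels also break ties alike.
  set g₀ : V → Option (Finset V) := fun v => some (classPart f W (f v)) with hg₀
  have hg : ∀ u v, g₀ u = g₀ v ↔ f u = f v := by
    intro u v
    rw [hg₀]
    simp only [Option.some.injEq]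
    refine ⟨fun h => ?_, fun h => by rw [h]⟩
    obtain ⟨w, hw⟩ := hWpos (f u)
    have hw' := hw
    rw [h] at hw'
    exact (mem_classPart.1 hw).2.symm.trans (mem_classPart.1 hw').2
  set H := hs2 E g₀ μ b fun _ => none with hH
  -- Limiting the number of labelled nodes makes the union bound valid for every `L`.
  set bad : (Sym2 V → Bool) → (V → Option (Option (Finset V))) → Prop := fun ξ L =>
    (labelled L).card ≤ b ∧ ∃ v ∈ labelled L, VoteFails f W ξ v with hbad
  have hcluster : (noiseLaw V p h0 h1).toOuterMeasure
      {ξ | ¬ IsFinal f W.card p W (msCluster k p R (oracleAnswer f ξ) W)} ≤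
      ENNReal.ofReal (δ / 8) := by
    refine (msCluster_not_isFinal_le h0 h1 hk (by omega) (by omega) hp fun j => ?_).trans
      (ENNReal.ofReal_le_ofReal ?_)
    · rw [hWM]
      exact hmin.trans (hW j)
    · rw [hWM, div_le_div_iff₀ hM0 (by norm_num)]
      rw [div_le_iff₀ hδ] at hM3
      linarith
  -- `H` does not involve the noise. For a fixed outcome at most `Q` nodes are labelled, each
  -- failing with probability at most `δ / (4 Q)`.
  have hvotes : ∑' ξ, (noiseLaw V p h0 h1) ξ * H.toOuterMeasure {L | bad ξ L} ≤
      ENNReal.ofReal (δ / 4) := by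
    rw [PMF.tsum_mul_toOuterMeasure_comm]
    have heach : ∀ L, H L * (noiseLaw V p h0 h1).toOuterMeasure {ξ | bad ξ L} ≤
        H L * ENNReal.ofReal (δ / 4) := by
      intro L
      refine mul_le_mul_right ?_ _
      by_cases hL : (labelled L).card ≤ b
      · have hsub : {ξ | bad ξ L} ⊆ ⋃ v ∈ labelled L, {ξ | VoteFails f W ξ v} := by
          rintro ξ ⟨-, v, hv, hξ⟩
          exact Set.mem_biUnion (show v ∈ (labelled L : Set V) from hv) hξ
        refine (MeasureTheory.measure_mono hsub).trans
          ((MeasureTheory.measure_biUnion_finset_le _ _).trans ?_)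
        refine (Finset.sum_le_sum fun v _ => voteFails_le h0 h1 hp
          (show 0 < β * M / 2 by positivity) hQ0 hδ hk hW ?_
          (fun hp0 => (bernoulliKL_half_pos hp0 hp).le) v).trans ?_
        · intro hp0
          have hD := bernoulliKL_half_pos hp0 hp
          rw [div_mul_eq_mul_div, div_le_iff₀ (by positivity)] at hM4
          linarith
        · rw [Finset.sum_const, nsmul_eq_mul, ← ENNReal.ofReal_natCast,
            ← ENNReal.ofReal_mul (by positivity)]
          refine ENNReal.ofReal_le_ofReal ?_
          have hLQ : ((labelled L).card : ℝ) ≤ Q := le_trans (by exact_mod_cast hL) hbQ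
          rw [mul_div_assoc', div_le_div_iff₀ (by positivity) (by norm_num)]
          nlinarith
      · have : {ξ | bad ξ L} = ∅ := by
          refine Set.eq_empty_iff_forall_notMem.2 fun ξ hξ => hL hξ.1
        rw [this, MeasureTheory.measure_empty]
        exact zero_le
    refine (ENNReal.tsum_le_tsum heach).trans ?_
    rw [ENNReal.tsum_mul_right, PMF.tsum_coe, one_mul]
  have hfail : H.toOuterMeasure {L | discovered E L ≠ cutSet E f} ≤ ENNReal.ofReal (δ / 2) := by
    have := hs2_budget hk hf hg hclu hκ hβ0 hβ hbal μ (ε := δ / 4) (by linarith) (by linarith)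
    convert this using 2
    ring
  refine (PMF.toOuterMeasure_bind_le_add_tsum _ _ _ _ (ENNReal.ofReal (δ / 2))
    (fun ξ => H.toOuterMeasure {L | bad ξ L}) ?_).trans
    (add_le_add (add_le_add hcluster le_rfl) hvotes)
  intro ξ _ hξ
  have hfin : IsFinal f W.card p W (msCluster k p R (oracleAnswer f ξ) W) := not_not.1 hξ
  simp only
  rw [PMF.toOuterMeasure_map_apply]
  have hdiff : ∀ v, voteLabel (oracleAnswer f ξ) (msCluster k p R (oracleAnswer f ξ) W).out v
      ≠ g₀ v → VoteFails f W ξ v := by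
    intro v hv
    by_contra hvf
    by_cases hvW : v ∈ W
    · exact hv (voteLabel_of_mem hfin _ hvW)
    · exact hv (voteLabel_of_not_voteFails hfin hvW hvf)
  have hpre : ((fun L : V → Option (Option (Finset V)) => (discovered E L, (msCluster k p R (oracleAnswer f ξ) W).asked ∪
      voteQueries (msCluster k p R (oracleAnswer f ξ) W).out L)) ⁻¹' {z | ¬ (z.1 = cutSet E f ∧
        (z.2.card : ℝ) ≤ 100 * (M * (k : ℝ) ^ 2 * Real.log M / (1 - 2 * p) ^ 4) + M * Q)}) ⊆
      {L : V → Option (Option (Finset V)) | discovered E L ≠ cutSet E f} ∪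
        {L | b < (labelled L).card} := by
    intro L hL
    by_contra hno
    simp only [Set.mem_union, Set.mem_ofPred_eq, not_or, not_not, not_lt] at hno
    apply hL
    refine ⟨hno.1, ?_⟩
    have hq1 := card_voteQueries_le hfin L
    have hq2 := hfin.asked
    rw [hWM] at hq1 hq2
    have hq3 := phase_one_queries_le hk hM9 h0 hp
    have hq4 := Nat.mul_le_mul_right M hno.2
    have hq5 := (Finset.card_union_le (msCluster k p R (oracleAnswer f ξ) W).asked
      (voteQueries (msCluster k p R (oracleAnswer f ξ) W).out L)).trans
      (add_le_add hq2 (hq1.trans hq4))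
    have hq6 : (((msCluster k p R (oracleAnswer f ξ) W).asked ∪
      voteQueries (msCluster k p R (oracleAnswer f ξ) W).out L).card : ℝ) ≤
      ((M * ⌈msScale k M p⌉₊ + k * (M * msVotes M p) : ℕ) : ℝ) + ((b * M : ℕ) : ℝ) := by
      exact_mod_cast hq5
    have hq7 : ((b * M : ℕ) : ℝ) ≤ M * Q := by
      rw [Nat.cast_mul, mul_comm]
      gcongr
    simp only
    linarith
  -- Passing to `g₀` costs the event that a labelled node got a wrong label, which implies a failed
  -- vote there and is covered by `bad`.
  refine (MeasureTheory.measure_mono hpre).trans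
    ((hs2_le_of_agree _ g₀ μ _ b _).trans ?_)
  have hmany : H.toOuterMeasure {L | b < (labelled L).card} = 0 := by
    rw [PMF.toOuterMeasure_apply_eq_zero_iff, Set.disjoint_left]
    intro L hL
    exact not_lt.2 (hs2_card_labelled μ b hL)
  have hsub : {L : V → Option (Option (Finset V)) | discovered E L ≠ cutSet E f} ∪ {L | b < (labelled L).card} ∪
      {L' | ∃ v, L' v ≠ none ∧ voteLabel (oracleAnswer f ξ)
        (msCluster k p R (oracleAnswer f ξ) W).out v ≠ g₀ v} ⊆
      {L | discovered E L ≠ cutSet E f} ∪ {L | bad ξ L} ∪ {L | b < (labelled L).card} := by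
    rintro L ((hL | hL) | ⟨v, hv, hne⟩)
    · exact Or.inl (Or.inl hL)
    · exact Or.inr hL
    · by_cases hL : (labelled L).card ≤ b
      · exact Or.inl (Or.inr ⟨hL, v, by simpa [labelled] using hv, hdiff v hne⟩)
      · exact Or.inr (not_le.1 hL)
  refine (MeasureTheory.measure_mono hsub).trans ((MeasureTheory.measure_union_le _ _).trans ?_)
  rw [hmany, add_zero]
  exact (MeasureTheory.measure_union_le _ _).trans (add_le_add_left hfail _)

end Main

end

/-! ### Assembly of the two phases -/

theorem mainTheorem3 :
    ∃ c : ℝ, 0 < c ∧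
      ∀ {V : Type*} [Fintype V] [DecidableEq V] (E : Finset (Finset V))
        {k : ℕ} (hk : 2 ≤ k) (f : V → Fin k) (hf : Function.Surjective f)
        (β : ℝ) (hβ : 0 < β) (hbal : IsBalanced E f β)
        (κ : ℕ) (hκ : 1 ≤ κ) (hκn : κ ≤ Fintype.card V) (hclu : IsClustered E f κ)
        (p : ℝ) (hp0 : 0 ≤ p) (hp : p < 1 / 2) (δ : ℝ) (hδ : 0 < δ)
        (M : ℕ) (hM : M ≤ Fintype.card V)
        (hM1 : 128 * k / (β * (2 * p - 1) ^ 4) ≤ M / Real.log M)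
        (hM2 : 12 / β * Real.log (4 * k / δ) ≤ M)
        (hM3 : 8 / δ ≤ M)
        (hM4 : 2 / (β * bernoulliKL (1 / 2) p)
          * Real.log (8 * (k - 1) * nodeBudget E f β κ (δ / 4) / δ) ≤ M)
        (R : PickRule V) (μ : MidpointRule V (Option (Finset V))),
        ENNReal.ofReal (1 - δ) ≤
          (noisyHS2 E f p hp0 (by linarith) M hM R μ
              ⌊nodeBudget E f β κ (δ / 4)⌋₊).toOuterMeasure
            {z | z.1 = cutSet E f ∧
              (z.2.card : ℝ) ≤ c * (M * (k : ℝ) ^ 2 * Real.log M / (1 - 2 * p) ^ 4)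
                + M * nodeBudget E f β κ (δ / 4)} := by
  refine ⟨100, by norm_num, ?_⟩
  intro V _ _ E k hk f hf β hβ hbal κ _ hκn hclu p hp0 hp δ hδ M hM hM1 hM2 hM3 hM4 R μ
  rcases le_or_gt 1 δ with hδ1 | hδ1
  · rw [ENNReal.ofReal_of_nonpos (by linarith)]
    exact zero_le
  have hk' : (2 : ℝ) ≤ k := by exact_mod_cast hk
  have hM9 : 9 ≤ M := by
    rw [div_le_iff₀ hδ] at hM3
    have h8 : (8 : ℝ) < M := by
      have : (0 : ℝ) ≤ M := Nat.cast_nonneg M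
      nlinarith
    have : 8 < M := by exact_mod_cast h8
    omega
  have hL := two_le_log hM9
  have hM0 : (0 : ℝ) < M := by
    have : 0 < M := by omega
    exact_mod_cast this
  have hV : 0 < Fintype.card V := by omega
  -- Two classes force two components, each with at least a fraction `β` of the nodes.
  have hβ2 : β ≤ 1 / 2 := by
    have h1 := card_piece_mul_le hbal hV
    have h2 : (2 : ℝ) ≤ Fintype.card (Piece E f) := by exact_mod_cast two_le_card_piece hk hf
    nlinarith
  have hq : 0 < 1 - 2 * p := by linarith
  have hq4 : (2 * p - 1) ^ 4 = (1 - 2 * p) ^ 4 := by ring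
  have hq4p : 0 < (1 - 2 * p) ^ 4 := by positivity
  rw [hq4, div_le_div_iff₀ (by positivity) (by linarith)] at hM1
  have hmin : msMinSize k M p ≤ β * M / 2 := by
    rw [msMinSize, div_le_div_iff₀ hq4p two_pos]
    linarith
  have hkM : k ≤ M := by
    have h1 : β * (1 - 2 * p) ^ 4 ≤ 1 := by
      have : (1 - 2 * p) ^ 4 ≤ 1 := pow_le_one₀ hq.le (by linarith)
      nlinarith
    have h2 : (k : ℝ) ≤ M := by nlinarith
    exact_mod_cast h2
  have hle1 : p ≤ 1 := by linarith
  set G : Set (Finset (Finset V) × Finset (Sym2 V)) := {z | z.1 = cutSet E f ∧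
      (z.2.card : ℝ) ≤ 100 * (M * (k : ℝ) ^ 2 * Real.log M / (1 - 2 * p) ^ 4)
        + M * nodeBudget E f β κ (δ / 4)} with hG
  set N := noisyHS2 E f p hp0 hle1 M hM R μ ⌊nodeBudget E f β κ (δ / 4)⌋₊ with hN
  have hbadN : N.toOuterMeasure Gᶜ ≤ ENNReal.ofReal δ := by
    rw [hN, noisyHS2]
    refine (PMF.toOuterMeasure_bind_le _ _ _
      {W | ∃ j, ((classPart f W j).card : ℝ) < β * M / 2} _ fun W hW hWB =>
      noisyHS2_sample_le hk hf hβ hβ2 hbal hκn hclu hp0 hle1 hp hδ hδ1.le hM9 hkM hM3 hM4 hmin R μ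
        ?_ ?_).trans ?_
    · rw [PMF.mem_support_uniformOfFinset_iff, Finset.mem_powersetCard_univ] at hW
      exact hW
    · intro j
      by_contra hlt
      exact hWB ⟨j, not_le.1 hlt⟩
    -- The shares of `δ`: 1/8 for the sample, 1/8 for the clustering, 1/2 for the search and 1/4 for
    -- the votes.
    · refine (add_le_add_left (sample_classes_le hk hf hβ hbal hM hδ hδ1.le hM2) _).trans ?_
      rw [← ENNReal.ofReal_add (by positivity) (by positivity),
        ← ENNReal.ofReal_add (by positivity) (by positivity),
        ← ENNReal.ofReal_add (by positivity) (by positivity)]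
      refine ENNReal.ofReal_le_ofReal (le_of_eq ?_)
      ring
  have htot : 1 ≤ N.toOuterMeasure G + N.toOuterMeasure Gᶜ := by
    rw [← (PMF.toOuterMeasure_apply_eq_one_iff N Set.univ).2 (Set.subset_univ _),
      ← Set.union_compl_self G]
    exact MeasureTheory.measure_union_le _ _
  rw [ENNReal.ofReal_sub _ hδ.le, ENNReal.ofReal_one, tsub_le_iff_right]
  exact htot.trans (add_le_add_right hbadN _)
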